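/- Let $d\ge 2$. For $L>0$ let $\Omega$ be the flat torus $[-L/2,L/2]^d$ with periodic boundary conditions, let $G(s)=\tfrac14(1-s^2)^2$ and $$E(u)=\int_\Omega \tfrac12|\nabla u|^2+G(u)\,dx ,\qquad X_\phi=\Big\{u\in H^1\cap L^4(\Omega):\ \frac1{L^d}\int_\Omega u\,dx=-1+\phi\Big\}$$ for $\phi>0$. Let $\bar u=-1+\phi$ be the uniform state, and define the energy barrier $$\Delta E=\inf_{\gamma\in\mathcal A}\ \max_{t\in[0,1]}\big(E(\gamma(t))-E(\bar u)\big),\qquad \mathcal A=\big\{\gamma\in C([0,1];X_\phi):\gamma(0)=\bar u,\ E(\gamma(1))<E(\bar u)\big\},$$ with $\Delta E=+\infty$ if $\mathcal A=\emptyset$; here $X_\phi$ carries the topology of the norm $\|\nabla w\|_{2}+\|w\|_{4}$. A saddle point of $E$ on $X_\phi$ is a point $u\in X_\phi$ at which the Fréchet derivative of $E$ along the mean-zero functions of $H^1\cap L^4(\Omega)$ vanishes and every neighbourhood of which in $X_\phi$ contains points $y,z$ with $E(y)<E(u)<E(z)$. Let $$\xi_d=c_0^{d/(d+1)}\,\sigma_d^{1/(d+1)}\,\frac{d+1}{4^{d/(d+1)}\,d^{1/(d+1)}},\qquad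 c_0=\int_{-1}^1\sqrt{2G(s)}\,ds ,$$ where $\sigma_d$ is the surface area of the unit sphere in $\mathbb R^d$. **Corollary (Saddle point).** (i) (Off-critical regime, $L^{-d/(d+1)}\ll\phi\ll1$.) There is $\varepsilon>0$, depending only on $d$, such that the conclusion below holds for all $\phi,L>0$ with $L^{-d/(d+1)}\le\varepsilon\phi$ and $\phi\le\varepsilon$. (ii) (Critical regime, $\xi L^{-d/(d+1)}=\phi\ll1$ with $\xi>\xi_d$.) For every $\xi>\xi_d$ there is $\phi_0>0$, depending only on $d$ and $\xi$, such that the conclusion below holds for all $\phi,L>0$ with $\phi=\xi L^{-d/(d+1)}$ and $\phi\le\phi_0$. Conclusion: there is a nonconstant saddle point $u_s\in X_\phi$ of $E$ on $X_\phi$, which satisfies, for some $\lambda\in\mathbb R$, the equation $$-\Delta u_s+G'(u_s)=\lambda$$ weakly, i.e. $\int_\Omega\nabla u_s\cdot\nabla v+G'(u_s)\,v\,dx=\lambda\int_\Omega v\,dx$ for all $v\in H^1\cap L^4(\Omega)$, and $$E(u_s)=E(\bar u)+\Delta E .$$ -/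

import Mathlib

open MeasureTheory Set Filter Topology
open scoped ENNReal ContDiff unitInterval

namespace CahnHilliard

noncomputable section

instance fact_one_le_four : Fact ((1 : ℝ≥0∞) ≤ 4) := ⟨by norm_num⟩

/-- The double-well potential `G(s) = (1 - s²)² / 4`. -/
def doubleWell (s : ℝ) : ℝ := (1 - s ^ 2) ^ 2 / 4

/-! ### The flat torus of side `L`

The torus is the cube `[-L/2, L/2]^d` with periodic boundary conditions: functions are taken up to
null sets on the cube, and periodicity enters through the class of test functions. -/

/-- The cube `[-L/2, L/2]^d`. -/
def cell (d : ℕ) (L : ℝ) : Set (Fin d → ℝ) := Icc (fun _ => -(L / 2)) (fun _ => L / 2)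

/-- Lebesgue measure on the cube. -/
def cellMeasure (d : ℕ) (L : ℝ) : Measure (Fin d → ℝ) := volume.restrict (cell d L)

instance isFiniteMeasure_cellMeasure (d : ℕ) (L : ℝ) : IsFiniteMeasure (cellMeasure d L) := by
  unfold cellMeasure cell
  exact ⟨by simpa using isCompact_Icc.measure_lt_top⟩

/-- Smooth functions on the torus: smooth functions on `ℝ^d`, `L`-periodic in each variable. -/
structure IsTestFunction {d : ℕ} (L : ℝ) (ψ : (Fin d → ℝ) → ℝ) : Prop where
  contDiff : ContDiff ℝ ∞ ψ
  periodic : ∀ (i : Fin d) (x : Fin d → ℝ), ψ (x + Pi.single i L) = ψ x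

/-- `g` is the weak gradient of `u` on the torus. -/
def HasWeakGradient {d : ℕ} (L : ℝ) (u : (Fin d → ℝ) → ℝ)
    (g : (Fin d → ℝ) → EuclideanSpace ℝ (Fin d)) : Prop :=
  ∀ ψ : (Fin d → ℝ) → ℝ, IsTestFunction L ψ → ∀ i : Fin d,
    ∫ x, u x * fderiv ℝ ψ x (Pi.single i 1) ∂(cellMeasure d L) =
      -∫ x, g x i * ψ x ∂(cellMeasure d L)

theorem integrable_mul_of_continuous {d : ℕ} {L : ℝ} {f h : (Fin d → ℝ) → ℝ}
    (hf : Integrable f (cellMeasure d L)) (hh : Continuous h) :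
    Integrable (fun x => f x * h x) (cellMeasure d L) := by
  have hK : IsCompact (cell d L) := isCompact_Icc
  have hf' : IntegrableOn f (cell d L) volume := hf
  exact hf'.mul_continuousOn hh.continuousOn hK

theorem IsTestFunction.continuous_partial {d : ℕ} {L : ℝ} {ψ : (Fin d → ℝ) → ℝ}
    (hψ : IsTestFunction L ψ) (i : Fin d) :
    Continuous fun x => fderiv ℝ ψ x (Pi.single i 1) :=
  (hψ.contDiff.continuous_fderiv (by simp)).clm_apply continuous_const

theorem integrable_L4 {d : ℕ} {L : ℝ} (u : Lp ℝ 4 (cellMeasure d L)) :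
    Integrable u (cellMeasure d L) :=
  (Lp.memLp u).integrable (by norm_num)

theorem integrable_L2 {d : ℕ} {L : ℝ} (g : Lp (EuclideanSpace ℝ (Fin d)) 2 (cellMeasure d L))
    (i : Fin d) : Integrable (fun x => g x i) (cellMeasure d L) :=
  (EuclideanSpace.proj (𝕜 := ℝ) i).integrable_comp ((Lp.memLp g).integrable (by norm_num))

/-- The space `H¹ ∩ L⁴` on the torus, as the space of pairs `(u, ∇u)` with `u ∈ L⁴` and weak
gradient `∇u ∈ L²`, normed as a subspace of `L⁴ × L²`. As the torus has finite measure, `u ∈ L⁴`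
already gives `u ∈ L²`, and the norm is equivalent to `‖∇u‖₂ + ‖u‖₄` and to
`‖u‖_{H¹} + ‖u‖₄`. -/
def H1L4 (d : ℕ) (L : ℝ) : Submodule ℝ
    (Lp ℝ 4 (cellMeasure d L) × Lp (EuclideanSpace ℝ (Fin d)) 2 (cellMeasure d L)) where
  carrier := {p | HasWeakGradient L p.1 p.2}
  add_mem' := by
    rintro ⟨u, g⟩ ⟨v, h⟩ hu hv ψ hψ i
    have hc := hψ.continuous_partial i
    have hc' := hψ.contDiff.continuous
    have e1 : ∫ x, (u + v : Lp ℝ 4 (cellMeasure d L)) x * fderiv ℝ ψ x (Pi.single i 1)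
        ∂(cellMeasure d L) = ∫ x, (u x * fderiv ℝ ψ x (Pi.single i 1) +
          v x * fderiv ℝ ψ x (Pi.single i 1)) ∂(cellMeasure d L) := by
      refine integral_congr_ae ?_
      filter_upwards [Lp.coeFn_add u v] with x hx
      rw [hx, Pi.add_apply, add_mul]
    have e2 : ∫ x, (g + h : Lp (EuclideanSpace ℝ (Fin d)) 2 (cellMeasure d L)) x i * ψ x
        ∂(cellMeasure d L) = ∫ x, (g x i * ψ x + h x i * ψ x) ∂(cellMeasure d L) := by
      refine integral_congr_ae ?_
      filter_upwards [Lp.coeFn_add g h] with x hx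
      rw [hx, Pi.add_apply, PiLp.add_apply, add_mul]
    change ∫ x, (u + v : Lp ℝ 4 (cellMeasure d L)) x * _ ∂_ =
      -∫ x, (g + h : Lp (EuclideanSpace ℝ (Fin d)) 2 (cellMeasure d L)) x i * ψ x ∂_
    rw [e1, e2, integral_add (integrable_mul_of_continuous (integrable_L4 u) hc)
      (integrable_mul_of_continuous (integrable_L4 v) hc),
      integral_add (integrable_mul_of_continuous (integrable_L2 g i) hc')
      (integrable_mul_of_continuous (integrable_L2 h i) hc'), neg_add]
    exact congrArg₂ (· + ·) (hu ψ hψ i) (hv ψ hψ i)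
  zero_mem' := by
    intro ψ hψ i
    have e1 : ∫ x, (0 : Lp ℝ 4 (cellMeasure d L)) x * fderiv ℝ ψ x (Pi.single i 1)
        ∂(cellMeasure d L) = 0 := by
      refine integral_eq_zero_of_ae ?_
      filter_upwards [Lp.coeFn_zero ℝ 4 (cellMeasure d L)] with x hx
      rw [hx]
      simp
    have e2 : ∫ x, (0 : Lp (EuclideanSpace ℝ (Fin d)) 2 (cellMeasure d L)) x i * ψ x
        ∂(cellMeasure d L) = 0 := by
      refine integral_eq_zero_of_ae ?_
      filter_upwards [Lp.coeFn_zero (EuclideanSpace ℝ (Fin d)) 2 (cellMeasure d L)] with x hx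
      rw [hx]
      simp
    change ∫ x, (0 : Lp ℝ 4 (cellMeasure d L)) x * _ ∂_ =
      -∫ x, (0 : Lp (EuclideanSpace ℝ (Fin d)) 2 (cellMeasure d L)) x i * ψ x ∂_
    rw [e1, e2, neg_zero]
  smul_mem' := by
    rintro c ⟨u, g⟩ hu ψ hψ i
    have e1 : ∫ x, (c • u : Lp ℝ 4 (cellMeasure d L)) x * fderiv ℝ ψ x (Pi.single i 1)
        ∂(cellMeasure d L) = ∫ x, c * (u x * fderiv ℝ ψ x (Pi.single i 1))
          ∂(cellMeasure d L) := by
      refine integral_congr_ae ?_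
      filter_upwards [Lp.coeFn_smul c u] with x hx
      rw [hx, Pi.smul_apply, smul_eq_mul, mul_assoc]
    have e2 : ∫ x, (c • g : Lp (EuclideanSpace ℝ (Fin d)) 2 (cellMeasure d L)) x i * ψ x
        ∂(cellMeasure d L) = ∫ x, c * (g x i * ψ x) ∂(cellMeasure d L) := by
      refine integral_congr_ae ?_
      filter_upwards [Lp.coeFn_smul c g] with x hx
      rw [hx, Pi.smul_apply, PiLp.smul_apply, smul_eq_mul, mul_assoc]
    change ∫ x, (c • u : Lp ℝ 4 (cellMeasure d L)) x * _ ∂_ =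
      -∫ x, (c • g : Lp (EuclideanSpace ℝ (Fin d)) 2 (cellMeasure d L)) x i * ψ x ∂_
    rw [e1, e2, integral_const_mul, integral_const_mul, ← mul_neg]
    exact congrArg (c * ·) (hu ψ hψ i)

/-- The underlying function of an element of `H¹ ∩ L⁴`. -/
def fn {d : ℕ} {L : ℝ} (u : H1L4 d L) : (Fin d → ℝ) → ℝ := u.1.1

/-- The weak gradient of an element of `H¹ ∩ L⁴`. -/
def grad {d : ℕ} {L : ℝ} (u : H1L4 d L) : (Fin d → ℝ) → EuclideanSpace ℝ (Fin d) := u.1.2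

/-- The energy `E(u) = ∫ ½ |∇u|² + G(u)`. -/
def energy {d : ℕ} {L : ℝ} (u : H1L4 d L) : ℝ :=
  ∫ x, (1 / 2 * ‖grad u x‖ ^ 2 + doubleWell (fn u x)) ∂(cellMeasure d L)

/-- `X_φ`: the functions in `H¹ ∩ L⁴` of mean `-1 + φ`. -/
def XSpace (d : ℕ) (L φ : ℝ) : Set (H1L4 d L) :=
  {u | ⨍ x, fn u x ∂(cellMeasure d L) = -1 + φ}

/-- The functions in `H¹ ∩ L⁴` of mean zero: the directions of the affine space `X_φ`. -/
def meanZero (d : ℕ) (L : ℝ) : Submodule ℝ (H1L4 d L) where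
  carrier := {w | ∫ x, fn w x ∂(cellMeasure d L) = 0}
  add_mem' := by
    intro u v hu hv
    have e : ∫ x, fn (u + v) x ∂(cellMeasure d L) =
        ∫ x, (fn u x + fn v x) ∂(cellMeasure d L) := integral_congr_ae (Lp.coeFn_add u.1.1 v.1.1)
    have hu' : ∫ x, fn u x ∂(cellMeasure d L) = 0 := hu
    have hv' : ∫ x, fn v x ∂(cellMeasure d L) = 0 := hv
    change ∫ x, fn (u + v) x ∂(cellMeasure d L) = 0
    rw [e, integral_add (f := fn u) (g := fn v) (integrable_L4 u.1.1) (integrable_L4 v.1.1), hu', hv', add_zero]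
  zero_mem' := integral_eq_zero_of_ae (Lp.coeFn_zero ℝ 4 (cellMeasure d L))
  smul_mem' := by
    intro c u hu
    have e : ∫ x, fn (c • u) x ∂(cellMeasure d L) =
        ∫ x, c * fn u x ∂(cellMeasure d L) := integral_congr_ae (Lp.coeFn_smul c u.1.1)
    have hu' : ∫ x, fn u x ∂(cellMeasure d L) = 0 := hu
    change ∫ x, fn (c • u) x ∂(cellMeasure d L) = 0
    rw [e, integral_const_mul, hu', mul_zero]

/-- The partial derivatives of a periodic smooth function have integral zero over the cube. -/
theorem integral_partial_eq_zero {d : ℕ} {L : ℝ} {ψ : (Fin d → ℝ) → ℝ}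
    (hψ : IsTestFunction L ψ) (i : Fin d) :
    ∫ x, fderiv ℝ ψ x (Pi.single i 1) ∂(cellMeasure d L) = 0 := by
  rcases d with _ | n
  · exact i.elim0
  rcases lt_or_ge L 0 with hL | hL
  · have : cell (n + 1) L = ∅ := by
      refine Icc_eq_empty fun h => ?_
      have := h 0
      dsimp only at this
      linarith
    simp [cellMeasure, this]
  · have hfd : ∀ x, HasFDerivAt ψ (fderiv ℝ ψ x) x := fun x =>
      (hψ.contDiff.differentiable (by simp)).differentiableAt.hasFDerivAt
    have key := integral_divergence_of_hasFDerivAt_off_countable'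
      (fun _ : Fin (n + 1) => -(L / 2)) (fun _ => L / 2)
      (fun _ => by linarith) (fun j => if j = i then ψ else 0)
      (fun j x => if j = i then fderiv ℝ ψ x else 0) ∅ countable_empty
      (fun j => by
        split_ifs
        · exact hψ.contDiff.continuous.continuousOn
        · exact continuousOn_const)
      (fun x _ j => by
        split_ifs
        · exact hfd x
        · exact hasFDerivAt_const 0 x)
      (by
        refine ContinuousOn.integrableOn_compact isCompact_Icc (Continuous.continuousOn ?_)
        refine continuous_finsetSum _ fun j _ => ?_
        by_cases hj : j = i
        · subst hj
          simpa using hψ.continuous_partial j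
        · simpa [hj] using continuous_const)
    have hsum : ∀ x, ∑ j, (if j = i then fderiv ℝ ψ x else 0) (Pi.single j 1) =
        fderiv ℝ ψ x (Pi.single i 1) := by
      intro x
      rw [Finset.sum_eq_single i (fun j _ hj => by simp [hj]) (by simp)]
      simp
    simp only [hsum] at key
    refine Eq.trans key (Finset.sum_eq_zero fun j _ => ?_)
    by_cases hj : j = i
    · subst hj
      rw [sub_eq_zero]
      refine integral_congr_ae (Eventually.of_forall fun x => ?_)
      have hx : j.insertNth (L / 2) x =
          (j.insertNth (-(L / 2)) x : Fin (n + 1) → ℝ) + Pi.single j L := by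
        ext k
        rcases eq_or_ne k j with rfl | hk
        · simp only [Fin.insertNth_apply_same, Pi.add_apply, Pi.single_eq_same]
          ring
        · obtain ⟨m, rfl⟩ := Fin.exists_succAbove_eq hk
          simp
      simp only [if_true]
      rw [hx, hψ.periodic]
    · simp [hj]

/-- The constant function `c` as an element of `H¹ ∩ L⁴`. -/
def constState (d : ℕ) (L c : ℝ) : H1L4 d L :=
  ⟨(Lp.const 4 (cellMeasure d L) c, 0), by
    intro ψ hψ i
    have e1 : ∫ x, (Lp.const 4 (cellMeasure d L) c) x * fderiv ℝ ψ x (Pi.single i 1)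
        ∂(cellMeasure d L) = ∫ x, c * fderiv ℝ ψ x (Pi.single i 1) ∂(cellMeasure d L) := by
      refine integral_congr_ae ?_
      filter_upwards [Lp.coeFn_const 4 (cellMeasure d L) c] with x hx
      rw [hx, Function.const_apply]
    have e2 : ∫ x, (0 : Lp (EuclideanSpace ℝ (Fin d)) 2 (cellMeasure d L)) x i * ψ x
        ∂(cellMeasure d L) = 0 := by
      refine integral_eq_zero_of_ae ?_
      filter_upwards [Lp.coeFn_zero (EuclideanSpace ℝ (Fin d)) 2 (cellMeasure d L)] with x hx
      rw [hx]
      simp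
    change ∫ x, (Lp.const 4 (cellMeasure d L) c) x * _ ∂_ =
      -∫ x, (0 : Lp (EuclideanSpace ℝ (Fin d)) 2 (cellMeasure d L)) x i * ψ x ∂_
    rw [e1, e2, integral_const_mul, integral_partial_eq_zero hψ i, mul_zero, neg_zero]⟩

/-- The uniform state `ū = -1 + φ`. -/
def uniformState (d : ℕ) (L φ : ℝ) : H1L4 d L := constState d L (-1 + φ)

/-- The continuous paths in `X_φ` from the uniform state to a state of lower energy. -/
def admissiblePaths (d : ℕ) (L φ : ℝ) : Set C(I, H1L4 d L) :=
  {γ | (∀ t, γ t ∈ XSpace d L φ) ∧ γ 0 = uniformState d L φ ∧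
    energy (γ 1) < energy (uniformState d L φ)}

/-- The energy barrier `ΔE = inf_γ max_t (E(γ(t)) - E(ū))`, with value `⊤` if there is no
admissible path. -/
def energyBarrier (d : ℕ) (L φ : ℝ) : EReal :=
  ⨅ γ ∈ admissiblePaths d L φ, ⨆ t : I,
    ((energy (γ t) - energy (uniformState d L φ) : ℝ) : EReal)

/-- A saddle point of `F`: a critical point, every neighbourhood of which contains points of
lower and points of higher value. -/
def IsSaddlePoint {X : Type*} [NormedAddCommGroup X] [NormedSpace ℝ X] (F : X → ℝ) (x : X) :
    Prop :=
  HasFDerivAt F (0 : X →L[ℝ] ℝ) x ∧ ∀ U ∈ 𝓝 x, ∃ y ∈ U, ∃ z ∈ U, F y < F x ∧ F x < F z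

/-- `u` is a saddle point of the energy restricted to the affine space `u + {mean zero}`, which is
`X_φ` if `u` belongs to `X_φ`. -/
def IsConstrainedSaddlePoint {d : ℕ} {L : ℝ} (u : H1L4 d L) : Prop :=
  IsSaddlePoint (fun w : meanZero d L => energy (u + (w : H1L4 d L))) 0

/-- `u` is a weak solution of `-Δu + G'(u) = lam` on the torus. -/
def IsWeakSolution {d : ℕ} {L : ℝ} (u : H1L4 d L) (lam : ℝ) : Prop :=
  ∀ v : H1L4 d L,
    ∫ x, (inner ℝ (grad u x) (grad v x) + deriv doubleWell (fn u x) * fn v x)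
      ∂(cellMeasure d L) = lam * ∫ x, fn v x ∂(cellMeasure d L)

/-- `u` is not (almost everywhere equal to) a constant. -/
def IsNonconstant {d : ℕ} {L : ℝ} (u : H1L4 d L) : Prop :=
  ¬ ∃ c : ℝ, fn u =ᵐ[cellMeasure d L] fun _ => c

/-- The surface area of the unit sphere in `ℝ^d`. -/
def sphereArea (d : ℕ) : ℝ := (volume : Measure (EuclideanSpace ℝ (Fin d))).toSphere.real univ

/-- The transition cost `c₀ = ∫_{-1}^1 √(2 G(s)) ds`. -/
def transitionCost : ℝ := ∫ s in (-1 : ℝ)..1, Real.sqrt (2 * doubleWell s)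

/-- The critical constant
`ξ_d = c₀^{d/(d+1)} σ_d^{1/(d+1)} (d+1) / (4^{d/(d+1)} d^{1/(d+1)})`. -/
def criticalXi (d : ℕ) : ℝ :=
  transitionCost ^ ((d : ℝ) / (d + 1)) * sphereArea d ^ (1 / ((d : ℝ) + 1)) *
    (((d : ℝ) + 1) / ((4 : ℝ) ^ ((d : ℝ) / (d + 1)) * (d : ℝ) ^ (1 / ((d : ℝ) + 1))))

/-- There is a nonconstant saddle point of the energy on `X_φ` at the height of the barrier,
which solves the Euler-Lagrange equation with some Lagrange multiplier. -/
def HasBarrierSaddle (d : ℕ) (L φ : ℝ) : Prop :=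
  ∃ u ∈ XSpace d L φ, IsNonconstant u ∧ IsConstrainedSaddlePoint u ∧
    (∃ lam : ℝ, IsWeakSolution u lam) ∧
    (energy u : EReal) = (energy (uniformState d L φ) : EReal) + energyBarrier d L φ

end

end CahnHilliard

/-!
The saddle point comes from a minimax argument over paths, driven by a convex splitting of the
energy `E(u) = ½ ∫ |∇u|² + ¼ ∫ u⁴ - ½ ∫ u² + const`.

*The splitting step.* Linearizing the concave part of `E` at `f` leaves the uniformly convex
problem of minimizing `½ ∫ |∇v|² + ¼ ∫ v⁴ - ∫ f v` over `X_φ`. Its minimizer `T f` (`splitStep`)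
has three properties: `E(T f) + ½ ‖f - T f‖₂² ≤ E(f)` (`energy_splitStep_le`); `T` is continuous
from the `L²` topology to that of `H¹ ∩ L⁴` (`convexEnergy_splitStep_sub_le`); and its fixed
points are the critical points of `E` on `X_φ` (`firstVariation_eq_zero`, `splitStep_eq_self`). In
particular `T` fixes the uniform state `ū` and maps admissible paths to admissible paths.

*The saddle point.* Let `c = E(ū) + ΔE`. Since `ū` is a strict local minimizer with respect to the
`L²` distance (`exists_energy_lower_bound`), `c > E(ū)` as soon as there is an admissible path.
Take paths `γₙ` with `max E(γₙ) → c`. The path `T γₙ` first reaches the level `c` at some `yₙ = T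
xₙ`, and `E(yₙ) = c`, `E(xₙ) ≤ c + o(1)` force `‖xₙ - yₙ‖₂ → 0`. By Rellich's theorem
(`exists_cauchy_subseq`, from Parseval's identity) a subsequence of `xₙ` converges in `L²`; the
continuity of `T` turns this into convergence of `yₙ` in `H¹ ∩ L⁴` to a fixed point `u` of `T`
with `E(u) = c`, in the closure of `{E < c}` (`exists_fixed_point_at_level`). So there are points
of lower energy near `u`; points of higher energy are found in directions that oscillate fast. As
`E(u) > E(ū)` and `ū` is the only constant in `X_φ`, the saddle point is not constant.

*Admissible paths.* It remains to find a state of `X_φ` with energy below `E(ū)`; the segment from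
`ū` to it is an admissible path. The competitor is a droplet of radius `R = K / φ`, with `K = (d +
1) c₀ / 4`, bounded by an almost optimal transition layer, on a background lowered so as to keep
the mean (`exists_droplet`). In terms of `z = φ^{-(d+1)} L^{-d}` and `a = σ_d / d`, its energy
relative to `ū`, times `φ^{d-1}`, tends to `c₀ σ_d K^{d-1} - 4 a K^d + 4 a² K^{2d} z` as `φ → 0`.
This is negative exactly when `ξ_d^{d+1} z < 1`, that is, when `φ > ξ_d L^{-d/(d+1)}`
(`sharp_droplet_neg`). Both regimes are covered by `exists_lower_energy`, which is uniform over `φ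
≥ ξ L^{-d/(d+1)}` for each fixed `ξ > ξ_d`.
-/


namespace CahnHilliard

noncomputable section

/-! ### The energy as a polynomial functional -/

section Functionals

variable {d : ℕ} {L : ℝ}

theorem memLp_fn (u : H1L4 d L) : MemLp (fn u) 4 (cellMeasure d L) := Lp.memLp u.1.1

theorem memLp_grad (u : H1L4 d L) : MemLp (grad u) 2 (cellMeasure d L) := Lp.memLp u.1.2

theorem memLp_two_fn (u : H1L4 d L) : MemLp (fn u) 2 (cellMeasure d L) :=
  (memLp_fn u).mono_exponent (by norm_num)

theorem fn_add_smul (u w : H1L4 d L) (t : ℝ) :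
    fn (u + t • w) =ᵐ[cellMeasure d L] fun x => fn u x + t * fn w x := by
  filter_upwards [Lp.coeFn_add u.1.1 (t • w.1.1), Lp.coeFn_smul t w.1.1] with x h1 h2
  change (u.1.1 + t • w.1.1 : Lp ℝ 4 (cellMeasure d L)) x = u.1.1 x + t * w.1.1 x
  rw [h1, Pi.add_apply, h2, Pi.smul_apply, smul_eq_mul]

theorem grad_add_smul (u w : H1L4 d L) (t : ℝ) :
    grad (u + t • w) =ᵐ[cellMeasure d L] fun x => grad u x + t • grad w x := by
  filter_upwards [Lp.coeFn_add u.1.2 (t • w.1.2), Lp.coeFn_smul t w.1.2] with x h1 h2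
  change (u.1.2 + t • w.1.2 : Lp (EuclideanSpace ℝ (Fin d)) 2 (cellMeasure d L)) x =
    u.1.2 x + t • w.1.2 x
  rw [h1, Pi.add_apply, h2, Pi.smul_apply]

theorem integrable_mul_two {α : Type*} [MeasurableSpace α] {μ : Measure α} {f g : α → ℝ}
    (hf : MemLp f 2 μ) (hg : MemLp g 2 μ) : Integrable (fun x => f x * g x) μ :=
  hf.integrable_mul hg

theorem memLp_mul_four {α : Type*} [MeasurableSpace α] {μ : Measure α} {f g : α → ℝ}
    (hf : MemLp f 4 μ) (hg : MemLp g 4 μ) : MemLp (fun x => f x * g x) 2 μ := by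
  have : ENNReal.HolderTriple 4 4 2 := ⟨by
    rw [show (4 : ℝ≥0∞) = 2 * 2 by norm_num, ENNReal.mul_inv (by simp) (by simp), ← mul_add,
      ENNReal.inv_two_add_inv_two, mul_one]⟩
  exact hg.mul hf

theorem integrable_mul_four {α : Type*} [MeasurableSpace α] {μ : Measure α} {f g h k : α → ℝ}
    (hf : MemLp f 4 μ) (hg : MemLp g 4 μ) (hh : MemLp h 4 μ) (hk : MemLp k 4 μ) :
    Integrable (fun x => f x * g x * (h x * k x)) μ :=
  integrable_mul_two (memLp_mul_four hf hg) (memLp_mul_four hh hk)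

theorem integrable_fun_add {α : Type*} [MeasurableSpace α] {μ : Measure α} {f g : α → ℝ}
    (hf : Integrable f μ) (hg : Integrable g μ) : Integrable (fun x => f x + g x) μ := hf.add hg

theorem integrable_fun_sub {α : Type*} [MeasurableSpace α] {μ : Measure α} {f g : α → ℝ}
    (hf : Integrable f μ) (hg : Integrable g μ) : Integrable (fun x => f x - g x) μ := hf.sub hg

/-- The Dirichlet integral `∫ |∇u|²`. -/
def dirichlet (u : H1L4 d L) : ℝ := ∫ x, ‖grad u x‖ ^ 2 ∂(cellMeasure d L)

/-- The bilinear form `∫ ∇u · ∇v` of the Dirichlet integral. -/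
def gradPairing (u v : H1L4 d L) : ℝ := ∫ x, inner ℝ (grad u x) (grad v x) ∂(cellMeasure d L)

/-- The `L²` inner product `∫ u v`. -/
def pairing (u v : H1L4 d L) : ℝ := ∫ x, fn u x * fn v x ∂(cellMeasure d L)

/-- The quadrilinear form `∫ u v w z`, which polarizes the quartic part of the energy. -/
def quad (u v w z : H1L4 d L) : ℝ :=
  ∫ x, fn u x * fn v x * (fn w x * fn z x) ∂(cellMeasure d L)

theorem integrable_norm_grad_sq (u : H1L4 d L) :
    Integrable (fun x => ‖grad u x‖ ^ 2) (cellMeasure d L) :=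
  (memLp_grad u).integrable_norm_pow (by norm_num)

theorem integrable_inner_grad (u v : H1L4 d L) :
    Integrable (fun x => inner ℝ (grad u x) (grad v x)) (cellMeasure d L) := by
  refine Integrable.mono' ((integrable_norm_grad_sq u).add (integrable_norm_grad_sq v))
    ((memLp_grad u).1.inner (memLp_grad v).1) (Eventually.of_forall fun x => ?_)
  have := norm_inner_le_norm (𝕜 := ℝ) (grad u x) (grad v x)
  simp only [Pi.add_apply]
  nlinarith [sq_nonneg (‖grad u x‖ - ‖grad v x‖), sq_nonneg (‖grad u x‖), sq_nonneg (‖grad v x‖)]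

theorem integrable_fn_mul (u v : H1L4 d L) :
    Integrable (fun x => fn u x * fn v x) (cellMeasure d L) :=
  integrable_mul_two (memLp_two_fn u) (memLp_two_fn v)

theorem integrable_quad (u v w z : H1L4 d L) :
    Integrable (fun x => fn u x * fn v x * (fn w x * fn z x)) (cellMeasure d L) :=
  integrable_mul_four (memLp_fn u) (memLp_fn v) (memLp_fn w) (memLp_fn z)

theorem integrable_fn (u : H1L4 d L) : Integrable (fn u) (cellMeasure d L) := integrable_L4 u.1.1

theorem dirichlet_nonneg (u : H1L4 d L) : 0 ≤ dirichlet u := integral_nonneg fun _ => by positivity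

theorem pairing_self_nonneg (u : H1L4 d L) : 0 ≤ pairing u u :=
  integral_nonneg fun _ => mul_self_nonneg _

theorem quad_sq_nonneg (u w : H1L4 d L) : 0 ≤ quad u u w w :=
  integral_nonneg fun _ => mul_nonneg (mul_self_nonneg _) (mul_self_nonneg _)

theorem pairing_comm (u v : H1L4 d L) : pairing u v = pairing v u := by
  simp only [pairing, mul_comm]

theorem dirichlet_add_smul (u w : H1L4 d L) (t : ℝ) :
    dirichlet (u + t • w) = dirichlet u + 2 * t * gradPairing u w + t ^ 2 * dirichlet w := by
  have h : dirichlet (u + t • w) = ∫ x, (‖grad u x‖ ^ 2 + 2 * t * inner ℝ (grad u x) (grad w x) +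
      t ^ 2 * ‖grad w x‖ ^ 2) ∂(cellMeasure d L) := by
    refine integral_congr_ae ?_
    filter_upwards [grad_add_smul u w t] with x hx
    rw [hx, norm_add_sq_real, inner_smul_right, norm_smul, mul_pow, Real.norm_eq_abs, sq_abs]
    ring
  have i1 := integrable_norm_grad_sq u
  have i2 := (integrable_inner_grad u w).const_mul (2 * t)
  have i3 := (integrable_norm_grad_sq w).const_mul (t ^ 2)
  rw [h, integral_add (integrable_fun_add i1 i2) i3, integral_add i1 i2, integral_const_mul,
    integral_const_mul]
  rfl

theorem pairing_add_smul (f u w : H1L4 d L) (t : ℝ) :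
    pairing f (u + t • w) = pairing f u + t * pairing f w := by
  have h : pairing f (u + t • w) = ∫ x, (fn f x * fn u x + t * (fn f x * fn w x))
      ∂(cellMeasure d L) := by
    refine integral_congr_ae ?_
    filter_upwards [fn_add_smul u w t] with x hx
    rw [hx]
    ring
  rw [h, integral_add (integrable_fn_mul f u) ((integrable_fn_mul f w).const_mul t),
    integral_const_mul]
  rfl

theorem gradPairing_add_smul (f u w : H1L4 d L) (t : ℝ) :
    gradPairing f (u + t • w) = gradPairing f u + t * gradPairing f w := by
  have h : gradPairing f (u + t • w) = ∫ x, (inner ℝ (grad f x) (grad u x) +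
      t * inner ℝ (grad f x) (grad w x)) ∂(cellMeasure d L) := by
    refine integral_congr_ae ?_
    filter_upwards [grad_add_smul u w t] with x hx
    rw [hx, inner_add_right, inner_smul_right]
  rw [h, integral_add (integrable_inner_grad f u) ((integrable_inner_grad f w).const_mul t),
    integral_const_mul]
  rfl

theorem quad_add_smul_right (f g h u w : H1L4 d L) (t : ℝ) :
    quad f g h (u + t • w) = quad f g h u + t * quad f g h w := by
  have e : quad f g h (u + t • w) = ∫ x, (fn f x * fn g x * (fn h x * fn u x) +
      t * (fn f x * fn g x * (fn h x * fn w x))) ∂(cellMeasure d L) := by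
    refine integral_congr_ae ?_
    filter_upwards [fn_add_smul u w t] with x hx
    rw [hx]
    ring
  rw [e, integral_add (integrable_quad f g h u) ((integrable_quad f g h w).const_mul t),
    integral_const_mul]
  rfl

theorem pairing_self_add_smul (u w : H1L4 d L) (t : ℝ) :
    pairing (u + t • w) (u + t • w) =
      pairing u u + 2 * t * pairing u w + t ^ 2 * pairing w w := by
  rw [pairing_add_smul, pairing_comm _ u, pairing_comm _ w, pairing_add_smul, pairing_add_smul,
    pairing_comm w u]
  ring

theorem quad_self_add_smul (u w : H1L4 d L) (t : ℝ) :
    quad (u + t • w) (u + t • w) (u + t • w) (u + t • w) = quad u u u u +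
      4 * t * quad u u u w + 6 * t ^ 2 * quad u u w w + 4 * t ^ 3 * quad u w w w +
      t ^ 4 * quad w w w w := by
  have e : quad (u + t • w) (u + t • w) (u + t • w) (u + t • w) =
      ∫ x, (fn u x * fn u x * (fn u x * fn u x) +
      4 * t * (fn u x * fn u x * (fn u x * fn w x)) +
      6 * t ^ 2 * (fn u x * fn u x * (fn w x * fn w x)) +
      4 * t ^ 3 * (fn u x * fn w x * (fn w x * fn w x)) +
      t ^ 4 * (fn w x * fn w x * (fn w x * fn w x))) ∂(cellMeasure d L) := by
    refine integral_congr_ae ?_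
    filter_upwards [fn_add_smul u w t] with x hx
    rw [hx]
    ring
  have i0 := integrable_quad u u u u
  have i1 := (integrable_quad u u u w).const_mul (4 * t)
  have i2 := (integrable_quad u u w w).const_mul (6 * t ^ 2)
  have i3 := (integrable_quad u w w w).const_mul (4 * t ^ 3)
  have i4 := (integrable_quad w w w w).const_mul (t ^ 4)
  have i01 := integrable_fun_add i0 i1
  have i02 := integrable_fun_add i01 i2
  rw [e, integral_add (integrable_fun_add i02 i3) i4, integral_add i02 i3,
    integral_add i01 i2, integral_add i0 i1, integral_const_mul, integral_const_mul,
    integral_const_mul, integral_const_mul]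
  rfl

theorem energy_eq (u : H1L4 d L) : energy u = 1 / 2 * dirichlet u + 1 / 4 * quad u u u u -
    1 / 2 * pairing u u + 1 / 4 * (cellMeasure d L).real univ := by
  have e : energy u = ∫ x, (1 / 2 * ‖grad u x‖ ^ 2 +
      1 / 4 * (fn u x * fn u x * (fn u x * fn u x)) - 1 / 2 * (fn u x * fn u x) + 1 / 4)
      ∂(cellMeasure d L) := by
    refine integral_congr_ae (Eventually.of_forall fun x => ?_)
    simp only [doubleWell]
    ring
  have i1 := (integrable_norm_grad_sq u).const_mul (1 / 2)
  have i2 := (integrable_quad u u u u).const_mul (1 / 4)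
  have i3 := (integrable_fn_mul u u).const_mul (1 / 2)
  have i12 := integrable_fun_add i1 i2
  rw [e, integral_add (integrable_fun_sub i12 i3) (integrable_const _), integral_sub i12 i3,
    integral_add i1 i2, integral_const_mul, integral_const_mul, integral_const_mul, integral_const,
    smul_eq_mul, mul_comm _ (1 / 4 : ℝ)]
  rfl

/-- The first variation `∫ ∇u · ∇w + (u³ - u) w` of the energy at `u` in the direction `w`. -/
def firstVariation (u w : H1L4 d L) : ℝ := gradPairing u w + quad u u u w - pairing u w

theorem energy_add_smul (u w : H1L4 d L) (t : ℝ) :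
    energy (u + t • w) = energy u + t * firstVariation u w +
      t ^ 2 * (1 / 2 * dirichlet w + 3 / 2 * quad u u w w - 1 / 2 * pairing w w) +
      t ^ 3 * quad u w w w + t ^ 4 * (1 / 4 * quad w w w w) := by
  rw [energy_eq, energy_eq, dirichlet_add_smul, quad_self_add_smul, pairing_self_add_smul,
    firstVariation]
  ring

theorem sq_integral_mul_le {α : Type*} [MeasurableSpace α] {μ : Measure α} {f g : α → ℝ}
    (hf : MemLp f 2 μ) (hg : MemLp g 2 μ) :
    (∫ x, f x * g x ∂μ) ^ 2 ≤ (∫ x, f x * f x ∂μ) * ∫ x, g x * g x ∂μ := by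
  have key : ∀ t : ℝ, 0 ≤ (∫ x, g x * g x ∂μ) * (t * t) + (2 * ∫ x, f x * g x ∂μ) * t +
      ∫ x, f x * f x ∂μ := by
    intro t
    have i1 := integrable_mul_two hf hf
    have i2 := (integrable_mul_two hf hg).const_mul (2 * t)
    have i3 := (integrable_mul_two hg hg).const_mul (t * t)
    have : 0 ≤ ∫ x, (f x * f x + 2 * t * (f x * g x) + t * t * (g x * g x)) ∂μ :=
      integral_nonneg fun x => by
        have : f x * f x + 2 * t * (f x * g x) + t * t * (g x * g x) = (f x + t * g x) ^ 2 := by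
          ring
        simp only [Pi.zero_apply, this]
        positivity
    rw [integral_add (integrable_fun_add i1 i2) i3, integral_add i1 i2, integral_const_mul,
      integral_const_mul] at this
    linarith
  have := discrim_le_zero key
  rw [discrim] at this
  linarith

theorem pairing_sq_le (u v : H1L4 d L) : pairing u v ^ 2 ≤ pairing u u * pairing v v :=
  sq_integral_mul_le (memLp_two_fn u) (memLp_two_fn v)

theorem quad_sq_le (u w : H1L4 d L) : quad u u w w ^ 2 ≤ quad u u u u * quad w w w w :=
  sq_integral_mul_le (memLp_mul_four (memLp_fn u) (memLp_fn u))
    (memLp_mul_four (memLp_fn w) (memLp_fn w))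

theorem pairing_self_sq_le (w : H1L4 d L) :
    pairing w w ^ 2 ≤ (cellMeasure d L).real univ * quad w w w w := by
  have := sq_integral_mul_le (memLp_const (1 : ℝ) (p := 2) (μ := cellMeasure d L))
    (memLp_mul_four (memLp_fn w) (memLp_fn w))
  simpa [pairing, quad] using this

theorem quad_eq_norm (u : H1L4 d L) : quad u u u u = ‖u.1.1‖ ^ 4 := by
  have h := (memLp_fn u).eLpNorm_eq_integral_rpow_norm (by norm_num) (by norm_num)
  have h0 : 0 ≤ quad u u u u := quad_sq_nonneg u u
  have h1 : ‖u.1.1‖ = (quad u u u u) ^ ((4 : ℝ)⁻¹) := by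
    rw [Lp.norm_def]
    change (eLpNorm (fn u) 4 (cellMeasure d L)).toReal = _
    rw [h, ENNReal.toReal_ofReal (by positivity)]
    congr 1
    refine integral_congr_ae (Eventually.of_forall fun x => ?_)
    have : (4 : ℝ≥0∞).toReal = ((4 : ℕ) : ℝ) := by norm_num
    simp only [this, Real.rpow_natCast, Real.norm_eq_abs]
    rw [show |fn u x| ^ 4 = (|fn u x| ^ 2) ^ 2 by ring, sq_abs]
    ring
  rw [h1, ← Real.rpow_natCast, ← Real.rpow_mul h0]
  norm_num

theorem dirichlet_eq_norm (u : H1L4 d L) : dirichlet u = ‖u.1.2‖ ^ 2 := by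
  have h := (memLp_grad u).eLpNorm_eq_integral_rpow_norm (by norm_num) (by norm_num)
  have h0 := dirichlet_nonneg u
  have h1 : ‖u.1.2‖ = (dirichlet u) ^ ((2 : ℝ)⁻¹) := by
    rw [Lp.norm_def]
    change (eLpNorm (grad u) 2 (cellMeasure d L)).toReal = _
    rw [h, ENNReal.toReal_ofReal (by positivity)]
    simp [dirichlet]
  rw [h1, ← Real.rpow_natCast, ← Real.rpow_mul h0]
  norm_num

theorem dirichlet_le (u : H1L4 d L) : dirichlet u ≤ ‖u‖ ^ 2 := by
  rw [dirichlet_eq_norm]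
  exact pow_le_pow_left₀ (norm_nonneg _) (norm_snd_le u.1) 2

theorem quad_le (u : H1L4 d L) : quad u u u u ≤ ‖u‖ ^ 4 := by
  rw [quad_eq_norm]
  exact pow_le_pow_left₀ (norm_nonneg _) (norm_fst_le u.1) 4

theorem pairing_self_le (u : H1L4 d L) :
    pairing u u ≤ √((cellMeasure d L).real univ) * ‖u‖ ^ 2 := by
  refine abs_le_of_sq_le_sq' ?_ (by positivity) |>.2
  rw [mul_pow, Real.sq_sqrt measureReal_nonneg, ← pow_mul]
  exact (pairing_self_sq_le u).trans (mul_le_mul_of_nonneg_left (quad_le u) measureReal_nonneg)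

theorem norm_lt_of_small {u : H1L4 d L} {ε : ℝ} (hε : 0 < ε) (hD : dirichlet u < ε ^ 2)
    (hQ : quad u u u u < ε ^ 4) : ‖u‖ < ε := by
  rw [dirichlet_eq_norm] at hD
  rw [quad_eq_norm] at hQ
  exact max_lt (lt_of_pow_lt_pow_left₀ 4 hε.le hQ) (lt_of_pow_lt_pow_left₀ 2 hε.le hD)

theorem continuous_dirichlet : Continuous (dirichlet : H1L4 d L → ℝ) := by
  simp_rw [funext dirichlet_eq_norm]
  fun_prop

theorem continuous_quad : Continuous fun u : H1L4 d L => quad u u u u := by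
  simp_rw [quad_eq_norm]
  fun_prop

theorem add_one_smul_sub (u v : H1L4 d L) : u + (1 : ℝ) • (v - u) = v := by
  rw [one_smul]
  abel

theorem continuous_pairing (f : H1L4 d L) : Continuous (pairing f) := by
  have hz : pairing f 0 = 0 := by
    have := pairing_add_smul f 0 0 1
    rw [smul_zero, add_zero] at this
    linarith
  let l : H1L4 d L →ₗ[ℝ] ℝ :=
    { toFun := pairing f
      map_add' := fun u v => by simpa using pairing_add_smul f u v 1
      map_smul' := fun t u => by simpa [hz] using pairing_add_smul f 0 u t }
  refine (l.mkContinuous (√(pairing f f * √((cellMeasure d L).real univ))) fun u => ?_).continuous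
  change |pairing f u| ≤ _
  refine abs_le_of_sq_le_sq ?_ (by positivity)
  rw [mul_pow, Real.sq_sqrt (mul_nonneg (pairing_self_nonneg f) (Real.sqrt_nonneg _)), mul_assoc]
  exact (pairing_sq_le f u).trans
    (mul_le_mul_of_nonneg_left (pairing_self_le u) (pairing_self_nonneg f))

theorem continuous_pairing_self : Continuous fun u : H1L4 d L => pairing u u := by
  rw [continuous_iff_continuousAt]
  intro u
  have h1 : ∀ v, pairing v v = pairing u u + 2 * pairing u (v - u) + pairing (v - u) (v - u) := by
    intro v
    have := pairing_self_add_smul u (v - u) 1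
    rw [add_one_smul_sub] at this
    linarith
  have hc : Tendsto (fun v : H1L4 d L => v - u) (𝓝 u) (𝓝 0) := by
    have : Continuous fun v : H1L4 d L => v - u := by fun_prop
    simpa using this.tendsto u
  have h0 : Tendsto (fun v : H1L4 d L => pairing v v) (𝓝 0) (𝓝 0) := by
    refine squeeze_zero (fun v => pairing_self_nonneg v) pairing_self_le ?_
    have : Continuous fun v : H1L4 d L => √((cellMeasure d L).real univ) * ‖v‖ ^ 2 := by fun_prop
    simpa using this.tendsto 0
  have hz : pairing u 0 = 0 := by
    have := pairing_add_smul u 0 0 1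
    rw [smul_zero, add_zero] at this
    linarith
  have h2 : Tendsto (fun v => pairing u (v - u)) (𝓝 u) (𝓝 0) := by
    have := ((continuous_pairing u).tendsto 0).comp hc
    rwa [hz] at this
  have h3 := h0.comp hc
  have h4 := ((h2.const_mul 2).const_add (pairing u u)).add h3
  simp only [mul_zero, add_zero] at h4
  exact h4.congr fun v => (h1 v).symm

theorem continuous_energy : Continuous (energy : H1L4 d L → ℝ) := by
  simp_rw [funext energy_eq]
  have := continuous_dirichlet (d := d) (L := L)
  have := continuous_quad (d := d) (L := L)
  have := continuous_pairing_self (d := d) (L := L)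
  fun_prop

theorem fn_constState (c : ℝ) : fn (constState d L c) =ᵐ[cellMeasure d L] fun _ => c :=
  Lp.coeFn_const 4 (cellMeasure d L) c

theorem grad_constState (c : ℝ) : grad (constState d L c) =ᵐ[cellMeasure d L] 0 :=
  Lp.coeFn_zero (EuclideanSpace ℝ (Fin d)) 2 (cellMeasure d L)

theorem pairing_const (c : ℝ) (u : H1L4 d L) :
    pairing (constState d L c) u = c * ∫ x, fn u x ∂(cellMeasure d L) := by
  rw [← integral_const_mul]
  refine integral_congr_ae ?_
  filter_upwards [fn_constState (d := d) (L := L) c] with x hx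
  rw [hx]

theorem measureReal_cell (hL : 0 < L) : (cellMeasure d L).real univ = L ^ d := by
  simp [cellMeasure, cell, Measure.real, Real.volume_Icc_pi, ENNReal.toReal_ofReal hL.le]

theorem mem_XSpace_iff (hL : 0 < L) {φ : ℝ} {u : H1L4 d L} :
    u ∈ XSpace d L φ ↔ ∫ x, fn u x ∂(cellMeasure d L) = (-1 + φ) * L ^ d := by
  change ⨍ x, fn u x ∂(cellMeasure d L) = -1 + φ ↔ _
  have : (0 : ℝ) < L ^ d := by positivity
  rw [average_eq, measureReal_cell hL, smul_eq_mul, inv_mul_eq_div, div_eq_iff this.ne']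

theorem constState_mem_XSpace (hL : 0 < L) (φ : ℝ) : uniformState d L φ ∈ XSpace d L φ := by
  rw [mem_XSpace_iff hL, uniformState,
    integral_congr_ae (fn_constState (d := d) (L := L) (-1 + φ)),
    integral_const, measureReal_cell hL, smul_eq_mul, mul_comm]

theorem integral_fn_eq_pairing (u : H1L4 d L) :
    ∫ x, fn u x ∂(cellMeasure d L) = pairing (constState d L 1) u := by
  rw [pairing_const, one_mul]

theorem integral_fn_add_smul (u w : H1L4 d L) (t : ℝ) :
    ∫ x, fn (u + t • w) x ∂(cellMeasure d L) =
      ∫ x, fn u x ∂(cellMeasure d L) + t * ∫ x, fn w x ∂(cellMeasure d L) := by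
  simp only [integral_fn_eq_pairing, pairing_add_smul]

theorem isClosed_XSpace (hL : 0 < L) (φ : ℝ) : IsClosed (XSpace d L φ) := by
  have : XSpace d L φ = {u | pairing (constState d L 1) u = (-1 + φ) * L ^ d} := by
    ext u
    rw [mem_XSpace_iff hL, integral_fn_eq_pairing]
    rfl
  rw [this]
  exact isClosed_eq (continuous_pairing _) continuous_const

end Functionals

/-! ### The convex splitting step -/

section ConvexSplitting

variable {d : ℕ} {L : ℝ}

/-- The convex part `½ ∫ |∇u|² + ¼ ∫ u⁴` of the energy. -/
def convexEnergy (u : H1L4 d L) : ℝ := 1 / 2 * dirichlet u + 1 / 4 * quad u u u u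

/-- The energy with its concave part `-½ ∫ v²` linearized at `f`, up to a constant. -/
def splitEnergy (f v : H1L4 d L) : ℝ := convexEnergy v - pairing f v

theorem convexEnergy_nonneg (u : H1L4 d L) : 0 ≤ convexEnergy u := by
  have := dirichlet_nonneg u
  have := quad_sq_nonneg u u
  unfold convexEnergy
  positivity

theorem continuous_convexEnergy : Continuous (convexEnergy : H1L4 d L → ℝ) :=
  (continuous_dirichlet.const_mul _).add (continuous_quad.const_mul _)

theorem energy_eq_convexEnergy (u : H1L4 d L) : energy u =
    convexEnergy u - 1 / 2 * pairing u u + 1 / 4 * (cellMeasure d L).real univ := by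
  rw [energy_eq, convexEnergy]

theorem convexEnergy_add_smul (u w : H1L4 d L) (t : ℝ) :
    convexEnergy (u + t • w) = convexEnergy u + t * (gradPairing u w + quad u u u w) +
      t ^ 2 * (1 / 2 * dirichlet w + 3 / 2 * quad u u w w) + t ^ 3 * quad u w w w +
      t ^ 4 * (1 / 4 * quad w w w w) := by
  rw [convexEnergy, convexEnergy, dirichlet_add_smul, quad_self_add_smul]
  ring

/-- The convex energy controls the norm of `H¹ ∩ L⁴`. -/
theorem norm_lt_of_convexEnergy_lt {u : H1L4 d L} {ε : ℝ} (hε : 0 < ε)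
    (h : convexEnergy u < min (ε ^ 2 / 2) (ε ^ 4 / 4)) : ‖u‖ < ε := by
  have h1 := h.trans_le (min_le_left _ _)
  have h2 := h.trans_le (min_le_right _ _)
  have := dirichlet_nonneg u
  have := quad_sq_nonneg u u
  unfold convexEnergy at h1 h2
  exact norm_lt_of_small hε (by linarith) (by linarith)

theorem quad_mixed_sq_le (u w : H1L4 d L) :
    quad u w w w ^ 2 ≤ quad u u w w * quad w w w w := by
  have h := sq_integral_mul_le (memLp_mul_four (memLp_fn u) (memLp_fn w))
    (memLp_mul_four (memLp_fn w) (memLp_fn w))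
  have e : ∫ x, fn u x * fn w x * (fn u x * fn w x) ∂(cellMeasure d L) = quad u u w w :=
    integral_congr_ae (Eventually.of_forall fun x => by ring)
  rwa [e] at h

/-- Uniform convexity: a quantitative form of Clarkson's inequality. -/
theorem convexEnergy_midpoint (u v : H1L4 d L) :
    convexEnergy (u + (1 / 2 : ℝ) • (v - u)) + 1 / 16 * convexEnergy (v - u) ≤
      1 / 2 * (convexEnergy u + convexEnergy v) := by
  have hv := convexEnergy_add_smul u (v - u) 1
  rw [add_one_smul_sub] at hv
  rw [convexEnergy_add_smul, hv]
  set w := v - u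
  -- the cubic term is absorbed by the quadratic and the quartic one
  have h1 := dirichlet_nonneg w
  have h2 := quad_sq_nonneg w w
  have h3 := quad_sq_nonneg u w
  have h4 := quad_mixed_sq_le u w
  have h5 : -quad u w w w ≤ quad u u w w + 1 / 4 * quad w w w w := by
    refine abs_le_of_sq_le_sq' ?_ (by positivity) |>.2
    nlinarith [sq_nonneg (quad u u w w - 1 / 4 * quad w w w w)]
  unfold convexEnergy
  linarith

theorem pairing_self_le_quad (v : H1L4 d L) :
    pairing v v ≤ 1 / 2 * ((cellMeasure d L).real univ + quad v v v v) := by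
  have h1 := pairing_self_sq_le v
  have h2 := quad_sq_nonneg v v
  have h3 : 0 ≤ (cellMeasure d L).real univ := measureReal_nonneg
  refine abs_le_of_sq_le_sq' ?_ (by positivity) |>.2
  nlinarith [sq_nonneg ((cellMeasure d L).real univ - quad v v v v)]

theorem pairing_le_half (f v : H1L4 d L) :
    pairing f v ≤ 1 / 2 * pairing f f + 1 / 2 * pairing v v := by
  have h1 := pairing_self_nonneg (f + (-1 : ℝ) • v)
  rw [pairing_self_add_smul] at h1
  linarith

/-- The quartic term keeps the linearized energy bounded below. -/
theorem le_splitEnergy (f v : H1L4 d L) :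
    -(1 / 2 * pairing f f + 1 / 4 * (cellMeasure d L).real univ) ≤ splitEnergy f v := by
  have h1 := pairing_le_half f v
  have h2 := pairing_self_le_quad v
  have h3 := dirichlet_nonneg v
  unfold splitEnergy convexEnergy
  linarith

theorem splitEnergy_midpoint (f u v : H1L4 d L) :
    splitEnergy f (u + (1 / 2 : ℝ) • (v - u)) + 1 / 16 * convexEnergy (v - u) ≤
      1 / 2 * (splitEnergy f u + splitEnergy f v) := by
  have h1 := convexEnergy_midpoint u v
  have h2 := pairing_add_smul f u (v - u) 1
  rw [add_one_smul_sub] at h2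
  unfold splitEnergy
  rw [pairing_add_smul]
  linarith

theorem add_smul_sub_mem_XSpace (hL : 0 < L) {φ : ℝ} {u v : H1L4 d L} (hu : u ∈ XSpace d L φ)
    (hv : v ∈ XSpace d L φ) (t : ℝ) : u + t • (v - u) ∈ XSpace d L φ := by
  rw [mem_XSpace_iff hL] at *
  have h2 := integral_fn_add_smul u (v - u) 1
  rw [add_one_smul_sub, hu, hv] at h2
  have h3 : ∫ x, fn (v - u) x ∂(cellMeasure d L) = 0 := by linarith
  rw [integral_fn_add_smul, h3, hu]
  ring

/-- Testing against a continuous function is continuous on `Lᵖ`: on a space of finite measure the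
`L¹` norm is controlled by the `Lᵖ` norm. -/
theorem continuous_integral_clm_mul {E : Type*} [NormedAddCommGroup E] [NormedSpace ℝ E]
    {p : ℝ≥0∞} [hp : Fact (1 ≤ p)] (l : E →L[ℝ] ℝ) {h : (Fin d → ℝ) → ℝ} (hh : Continuous h) :
    Continuous fun u : Lp E p (cellMeasure d L) => ∫ x, l (u x) * h x ∂(cellMeasure d L) := by
  have hint : ∀ u : Lp E p (cellMeasure d L), Integrable u (cellMeasure d L) := fun u =>
    (Lp.memLp u).integrable hp.out
  have hlint : ∀ u : Lp E p (cellMeasure d L),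
      Integrable (fun x => l (u x) * h x) (cellMeasure d L) := fun u =>
    integrable_mul_of_continuous (l.integrable_comp (hint u)) hh
  obtain ⟨C, hC⟩ := (isCompact_Icc : IsCompact (cell d L)).exists_bound_of_continuousOn
    hh.continuousOn
  have hC' : ∀ᵐ x ∂(cellMeasure d L), ‖h x‖ ≤ C := by
    filter_upwards [ae_restrict_mem (measurableSet_Icc : MeasurableSet (cell d L))] with x hx
    exact hC x hx
  set K : ℝ≥0∞ := cellMeasure d L univ ^ (1 / (1 : ℝ≥0∞).toReal - 1 / p.toReal) with hK
  have hKtop : K ≠ ⊤ := by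
    refine ENNReal.rpow_ne_top_of_nonneg ?_ (measure_ne_top _ _)
    rcases eq_or_ne p ⊤ with rfl | hpt
    · simp
    · have : (1 : ℝ) ≤ p.toReal := by
        have := ENNReal.toReal_mono hpt hp.out
        simpa using this
      rw [ENNReal.toReal_one, sub_nonneg, one_div_one]
      exact (div_le_one (by linarith)).2 this
  refine continuous_of_linear_of_bound (𝕜 := ℝ) (C := ‖l‖ * C * K.toReal) ?_ ?_ ?_
  · intro u v
    rw [← integral_add (hlint u) (hlint v)]
    refine integral_congr_ae ?_
    filter_upwards [Lp.coeFn_add u v] with x hx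
    rw [hx, Pi.add_apply, map_add, add_mul]
  · intro c u
    rw [smul_eq_mul, ← integral_const_mul]
    refine integral_congr_ae ?_
    filter_upwards [Lp.coeFn_smul c u] with x hx
    rw [hx, Pi.smul_apply, map_smul, smul_eq_mul, mul_assoc]
  · intro u
    have hC0 : cellMeasure d L = 0 ∨ 0 ≤ C := by
      by_cases h0 : cellMeasure d L = 0
      · exact Or.inl h0
      · have : (ae (cellMeasure d L)).NeBot := ae_neBot.2 h0
        obtain ⟨x, hx⟩ := hC'.exists
        exact Or.inr ((norm_nonneg _).trans hx)
    change ‖∫ x, l (u x) * h x ∂(cellMeasure d L)‖ ≤ _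
    rcases hC0 with h0 | hC0
    · have : ‖u‖ = 0 := by simp [Lp.norm_def, h0]
      rw [this]
      simp [h0]
    have h1 : ‖∫ x, l (u x) * h x ∂(cellMeasure d L)‖ ≤
        ∫ x, ‖l‖ * C * ‖u x‖ ∂(cellMeasure d L) := by
      refine norm_integral_le_of_norm_le ((hint u).norm.const_mul _) ?_
      filter_upwards [hC'] with x hx
      rw [norm_mul]
      calc ‖l (u x)‖ * ‖h x‖ ≤ (‖l‖ * ‖u x‖) * C :=
            mul_le_mul (l.le_opNorm _) hx (norm_nonneg _) (by positivity)
        _ = ‖l‖ * C * ‖u x‖ := by ring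
    rw [integral_const_mul] at h1
    refine h1.trans ?_
    rw [mul_assoc (‖l‖ * C)]
    refine mul_le_mul_of_nonneg_left ?_ (by positivity)
    have h2 := eLpNorm_le_eLpNorm_mul_rpow_measure_univ hp.out (Lp.memLp u).1
    rw [integral_norm_eq_lintegral_enorm (Lp.memLp u).1, ← eLpNorm_one_eq_lintegral_enorm,
      Lp.norm_def, mul_comm, ← ENNReal.toReal_mul]
    exact ENNReal.toReal_mono (ENNReal.mul_ne_top (Lp.memLp u).eLpNorm_ne_top hKtop) h2

instance completeSpace_H1L4 : CompleteSpace (H1L4 d L) := by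
  have hc : IsClosed ((H1L4 d L : Submodule ℝ _) :
      Set (Lp ℝ 4 (cellMeasure d L) × Lp (EuclideanSpace ℝ (Fin d)) 2 (cellMeasure d L))) := by
    have : ((H1L4 d L : Submodule ℝ _) :
        Set (Lp ℝ 4 (cellMeasure d L) × Lp (EuclideanSpace ℝ (Fin d)) 2 (cellMeasure d L))) =
        ⋂ (ψ : (Fin d → ℝ) → ℝ) (_ : IsTestFunction L ψ) (i : Fin d),
          {p | ∫ x, p.1 x * fderiv ℝ ψ x (Pi.single i 1) ∂(cellMeasure d L) =
            -∫ x, p.2 x i * ψ x ∂(cellMeasure d L)} := by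
      ext p
      simp only [mem_iInter]
      rfl
    rw [this]
    refine isClosed_iInter fun ψ => isClosed_iInter fun hψ => isClosed_iInter fun i => ?_
    refine isClosed_eq ?_ (Continuous.neg ?_)
    · exact (continuous_integral_clm_mul (ContinuousLinearMap.id ℝ ℝ)
        (hψ.continuous_partial i)).comp continuous_fst
    · exact (continuous_integral_clm_mul (EuclideanSpace.proj (𝕜 := ℝ) i)
        hψ.contDiff.continuous).comp continuous_snd
  exact hc.completeSpace_coe

/-- The linearized energy has a minimizer on `X_φ`: by uniform convexity every minimizing sequence
is a Cauchy sequence. -/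
theorem exists_splitEnergy_minimizer (hL : 0 < L) (φ : ℝ) (f : H1L4 d L) :
    ∃ v ∈ XSpace d L φ, ∀ u ∈ XSpace d L φ,
      splitEnergy f v + 1 / 8 * convexEnergy (u - v) ≤ splitEnergy f u := by
  set S := splitEnergy f '' XSpace d L φ with hS
  have hne : S.Nonempty := ⟨_, _, constState_mem_XSpace hL φ, rfl⟩
  have hbdd : BddBelow S := ⟨_, by rintro _ ⟨v, -, rfl⟩; exact le_splitEnergy f v⟩
  have hinf : ∀ v ∈ XSpace d L φ, sInf S ≤ splitEnergy f v := fun v hv =>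
    csInf_le hbdd ⟨v, hv, rfl⟩
  have hseq : ∀ n : ℕ, ∃ v ∈ XSpace d L φ, splitEnergy f v < sInf S + 1 / ((n : ℝ) + 1) := by
    intro n
    obtain ⟨_, ⟨v, hv, rfl⟩, hlt⟩ :=
      exists_lt_of_csInf_lt hne (lt_add_of_pos_right (sInf S) (Nat.one_div_pos_of_nat (n := n)))
    exact ⟨v, hv, hlt⟩
  choose v hvX hv using hseq
  have hanti : ∀ N n : ℕ, N ≤ n → splitEnergy f (v n) < sInf S + 1 / ((N : ℝ) + 1) :=
    fun N n hn => (hv n).trans_le (by gcongr)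
  have hcau : CauchySeq v := by
    rw [Metric.cauchySeq_iff]
    intro ε hε
    have hpos : 0 < min (ε ^ 2 / 2) (ε ^ 4 / 4) := by positivity
    obtain ⟨N, hN⟩ := exists_nat_one_div_lt
      (show 0 < min (ε ^ 2 / 2) (ε ^ 4 / 4) / 16 by positivity)
    refine ⟨N, fun m hm n hn => ?_⟩
    rw [dist_eq_norm]
    refine norm_lt_of_convexEnergy_lt hε ?_
    have h1 := splitEnergy_midpoint f (v n) (v m)
    have h2 := hinf _ (add_smul_sub_mem_XSpace hL (hvX n) (hvX m) (1 / 2))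
    have h3 := hanti N n hn
    have h4 := hanti N m hm
    linarith
  obtain ⟨v₀, hv₀⟩ := cauchySeq_tendsto_of_complete hcau
  have hv₀X : v₀ ∈ XSpace d L φ :=
    (isClosed_XSpace hL φ).mem_of_tendsto hv₀ (Eventually.of_forall hvX)
  have hcont : Continuous (splitEnergy f) := continuous_convexEnergy.sub (continuous_pairing f)
  have hlim : Tendsto (fun n : ℕ => sInf S + 1 / ((n : ℝ) + 1)) atTop (𝓝 (sInf S + 0)) :=
    tendsto_one_div_add_atTop_nhds_zero_nat.const_add _
  have hle : splitEnergy f v₀ ≤ sInf S := by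
    rw [add_zero] at hlim
    exact le_of_tendsto_of_tendsto' ((hcont.tendsto v₀).comp hv₀) hlim fun n => (hv n).le
  refine ⟨v₀, hv₀X, fun u hu => ?_⟩
  have h1 := splitEnergy_midpoint f v₀ u
  have h2 := hinf _ (add_smul_sub_mem_XSpace hL hv₀X hu (1 / 2))
  linarith

/-- The convex splitting step `f ↦ argmin {½ ∫ |∇v|² + ¼ ∫ v⁴ - ∫ f v : v ∈ X_φ}`. Its fixed points
are the critical points of the energy on `X_φ`. -/
def splitStep (hL : 0 < L) (φ : ℝ) (f : H1L4 d L) : H1L4 d L :=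
  (exists_splitEnergy_minimizer hL φ f).choose

theorem splitStep_mem (hL : 0 < L) (φ : ℝ) (f : H1L4 d L) : splitStep hL φ f ∈ XSpace d L φ :=
  (exists_splitEnergy_minimizer hL φ f).choose_spec.1

theorem splitStep_spec (hL : 0 < L) {φ : ℝ} (f : H1L4 d L) {u : H1L4 d L}
    (hu : u ∈ XSpace d L φ) : splitEnergy f (splitStep hL φ f) +
      1 / 8 * convexEnergy (u - splitStep hL φ f) ≤ splitEnergy f u :=
  (exists_splitEnergy_minimizer hL φ f).choose_spec.2 u hu

theorem add_neg_one_smul (u v : H1L4 d L) : u + (-1 : ℝ) • v = u - v := by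
  module

theorem pairing_self_sub (u v : H1L4 d L) :
    pairing (u - v) (u - v) = pairing u u - 2 * pairing u v + pairing v v := by
  have h := pairing_self_add_smul u v (-1)
  rw [add_neg_one_smul] at h
  rw [h]
  ring

/-- The convex splitting step decreases the energy. -/
theorem energy_splitStep_le (hL : 0 < L) {φ : ℝ} {f : H1L4 d L} (hf : f ∈ XSpace d L φ) :
    energy (splitStep hL φ f) +
      1 / 2 * pairing (f - splitStep hL φ f) (f - splitStep hL φ f) ≤ energy f := by
  have h1 := splitStep_spec hL f hf
  have h2 := convexEnergy_nonneg (f - splitStep hL φ f)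
  rw [energy_eq_convexEnergy, energy_eq_convexEnergy, pairing_self_sub]
  unfold splitEnergy at h1
  linarith

theorem pairing_sub_sub (f g u v : H1L4 d L) :
    pairing (f - g) (u - v) = pairing f u - pairing f v - pairing g u + pairing g v := by
  have h := pairing_add_smul (f - g) u v (-1)
  rw [add_neg_one_smul] at h
  have h1 := pairing_add_smul u f g (-1)
  have h2 := pairing_add_smul v f g (-1)
  rw [add_neg_one_smul] at h1 h2
  rw [h, pairing_comm _ u, pairing_comm _ v, h1, h2, pairing_comm u, pairing_comm v,
    pairing_comm u, pairing_comm v]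
  ring

/-- The convex splitting step is Hölder continuous from the `L²` topology to the topology of
`H¹ ∩ L⁴`. -/
theorem convexEnergy_splitStep_sub_le (hL : 0 < L) (φ : ℝ) (f g : H1L4 d L) :
    convexEnergy (splitStep hL φ f - splitStep hL φ g) ^ 3 ≤
      1024 * (cellMeasure d L).real univ * pairing (f - g) (f - g) ^ 2 := by
  have h1 := splitStep_spec hL f (splitStep_mem hL φ g)
  have h2 := splitStep_spec hL g (splitStep_mem hL φ f)
  set u := splitStep hL φ f
  set v := splitStep hL φ g
  have hsym : convexEnergy (v - u) = convexEnergy (u - v) := by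
    rw [convexEnergy, convexEnergy, dirichlet_eq_norm, dirichlet_eq_norm, quad_eq_norm,
      quad_eq_norm]
    change 1 / 2 * ‖v.1.2 - u.1.2‖ ^ 2 + 1 / 4 * ‖v.1.1 - u.1.1‖ ^ 4 =
      1 / 2 * ‖u.1.2 - v.1.2‖ ^ 2 + 1 / 4 * ‖u.1.1 - v.1.1‖ ^ 4
    rw [norm_sub_rev v.1.2, norm_sub_rev v.1.1]
  have h3 : 1 / 4 * convexEnergy (u - v) ≤ pairing (f - g) (u - v) := by
    rw [pairing_sub_sub]
    rw [hsym] at h1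
    unfold splitEnergy at h1 h2
    linarith
  have h4 := pairing_sq_le (f - g) (u - v)
  have h5 := pairing_self_sq_le (u - v)
  have h6 := convexEnergy_nonneg (u - v)
  have h7 : quad (u - v) (u - v) (u - v) (u - v) ≤ 4 * convexEnergy (u - v) := by
    have := dirichlet_nonneg (u - v)
    unfold convexEnergy
    linarith
  have h0 : 0 ≤ (cellMeasure d L).real univ := measureReal_nonneg
  rcases h6.eq_or_lt with h6 | h6
  · rw [← h6, zero_pow three_ne_zero]
    positivity
  set c := convexEnergy (u - v)
  set q := pairing (f - g) (f - g)
  set p := pairing (u - v) (u - v)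
  have h8 : (1 / 4 * c) ^ 2 ≤ q * p := (pow_le_pow_left₀ (by positivity) h3 2).trans h4
  have h9 : ((1 / 4 * c) ^ 2) ^ 2 ≤ q ^ 2 * ((cellMeasure d L).real univ * (4 * c)) :=
    (pow_le_pow_left₀ (by positivity) h8 2).trans (by
      rw [mul_pow]
      exact mul_le_mul_of_nonneg_left (h5.trans (mul_le_mul_of_nonneg_left h7 h0)) (sq_nonneg q))
  refine le_of_mul_le_mul_right ?_ h6
  linarith

/-- The convex splitting step turns `L²` convergence into convergence in `H¹ ∩ L⁴`. -/
theorem tendsto_norm_splitStep_sub (hL : 0 < L) (φ : ℝ) {ι : Type*} {l : Filter ι}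
    {f g : ι → H1L4 d L} (h : Tendsto (fun n => pairing (f n - g n) (f n - g n)) l (𝓝 0)) :
    Tendsto (fun n => ‖splitStep hL φ (f n) - splitStep hL φ (g n)‖) l (𝓝 0) := by
  have h1 : Tendsto (fun n => 1024 * (cellMeasure d L).real univ *
      pairing (f n - g n) (f n - g n) ^ 2) l (𝓝 0) := by
    simpa using (h.pow 2).const_mul (1024 * (cellMeasure d L).real univ)
  rw [Metric.tendsto_nhds]
  intro ε hε
  have hpos : 0 < min (ε ^ 2 / 2) (ε ^ 4 / 4) := by positivity
  filter_upwards [h1.eventually_lt_const (pow_pos hpos 3)] with n hn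
  rw [Real.dist_eq, sub_zero, abs_norm]
  refine norm_lt_of_convexEnergy_lt hε (lt_of_pow_lt_pow_left₀ 3 hpos.le ?_)
  exact (convexEnergy_splitStep_sub_le hL φ (f n) (g n)).trans_lt hn

theorem continuous_splitStep (hL : 0 < L) (φ : ℝ) :
    Continuous (splitStep hL φ : H1L4 d L → H1L4 d L) := by
  rw [continuous_iff_continuousAt]
  intro f
  rw [ContinuousAt, tendsto_iff_norm_sub_tendsto_zero]
  refine tendsto_norm_splitStep_sub hL φ (f := fun g => g) (g := fun _ => f) ?_
  have : Continuous fun g : H1L4 d L => pairing (g - f) (g - f) :=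
    continuous_pairing_self.comp (continuous_id.sub continuous_const)
  have h := this.tendsto f
  have h0 : pairing (0 : H1L4 d L) 0 = 0 := by
    refine le_antisymm ?_ (pairing_self_nonneg _)
    simpa using pairing_self_le (0 : H1L4 d L)
  simpa [h0] using h

end ConvexSplitting

/-! ### Fourier series on the torus -/

section Parseval

variable {d : ℕ} {L : ℝ}

/-- The phase `2π (k · x) / L` of the `k`-th Fourier mode. -/
def phase (L : ℝ) (k : Fin d → ℤ) (x : Fin d → ℝ) : ℝ :=
  ∑ i, 2 * Real.pi / L * k i * x i

theorem hasFDerivAt_phase (k : Fin d → ℤ) (x : Fin d → ℝ) :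
    HasFDerivAt (phase L k)
      (∑ i, (2 * Real.pi / L * k i) • ContinuousLinearMap.proj (R := ℝ) (φ := fun _ => ℝ) i) x := by
  unfold phase
  refine HasFDerivAt.fun_sum fun i _ => ?_
  exact (ContinuousLinearMap.proj (R := ℝ) (φ := fun _ : Fin d => ℝ) i).hasFDerivAt.const_mul _

theorem contDiff_phase (k : Fin d → ℤ) : ContDiff ℝ ∞ (phase L k) := by
  unfold phase
  fun_prop

theorem phase_add_single (hL : 0 < L) (k : Fin d → ℤ) (x : Fin d → ℝ) (i : Fin d) :
    phase L k (x + Pi.single i L) = phase L k x + k i * (2 * Real.pi) := by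
  simp only [phase, Pi.add_apply, mul_add, Finset.sum_add_distrib]
  congr 1
  rw [Finset.sum_eq_single i (fun j _ hj => by simp [hj]) (by simp), Pi.single_eq_same]
  field_simp

theorem isTestFunction_cos_phase (hL : 0 < L) (k : Fin d → ℤ) :
    IsTestFunction L fun x => Real.cos (phase L k x) :=
  ⟨Real.contDiff_cos.comp (contDiff_phase k), fun i x => by
    rw [phase_add_single hL, Real.cos_add_int_mul_two_pi]⟩

theorem isTestFunction_sin_phase (hL : 0 < L) (k : Fin d → ℤ) :
    IsTestFunction L fun x => Real.sin (phase L k x) :=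
  ⟨Real.contDiff_sin.comp (contDiff_phase k), fun i x => by
    rw [phase_add_single hL, Real.sin_add_int_mul_two_pi]⟩

theorem sum_proj_single (c : Fin d → ℝ) (i : Fin d) :
    (∑ j, c j • ContinuousLinearMap.proj (R := ℝ) (φ := fun _ : Fin d => ℝ) j)
      (Pi.single i 1) = c i := by
  simp only [sum_apply, smul_apply,
    ContinuousLinearMap.proj_apply, smul_eq_mul]
  rw [Finset.sum_eq_single i (fun j _ hj => by simp [hj]) (by simp), Pi.single_eq_same, mul_one]

theorem fderiv_cos_phase (k : Fin d → ℤ) (x : Fin d → ℝ) (i : Fin d) :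
    fderiv ℝ (fun x => Real.cos (phase L k x)) x (Pi.single i 1) =
      -(2 * Real.pi / L * k i) * Real.sin (phase L k x) := by
  rw [(hasFDerivAt_phase k x).cos.fderiv, smul_apply, sum_proj_single,
    smul_eq_mul]
  ring

theorem fderiv_sin_phase (k : Fin d → ℤ) (x : Fin d → ℝ) (i : Fin d) :
    fderiv ℝ (fun x => Real.sin (phase L k x)) x (Pi.single i 1) =
      2 * Real.pi / L * k i * Real.cos (phase L k x) := by
  rw [(hasFDerivAt_phase k x).sin.fderiv, smul_apply, sum_proj_single,
    smul_eq_mul]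
  ring

/-- The cosine coefficient of `f` at frequency `k`, not normalized. -/
def cosCoeff (L : ℝ) (f : (Fin d → ℝ) → ℝ) (k : Fin d → ℤ) : ℝ :=
  ∫ x, f x * Real.cos (phase L k x) ∂(cellMeasure d L)

/-- The sine coefficient of `f` at frequency `k`, not normalized. -/
def sinCoeff (L : ℝ) (f : (Fin d → ℝ) → ℝ) (k : Fin d → ℤ) : ℝ :=
  ∫ x, f x * Real.sin (phase L k x) ∂(cellMeasure d L)

attribute [local instance] instMeasureSpaceUnitAddCircle

/-- A fundamental domain of the unit torus, scaled to the cell. -/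
def chart (d : ℕ) (L : ℝ) (t : UnitAddTorus (Fin d)) : Fin d → ℝ :=
  L • (UnitAddTorus.measurableEquivPiIoc (fun _ : Fin d => -(1 / 2 : ℝ)) t).1

theorem chart_coe (hL : 0 < L) (t : UnitAddTorus (Fin d)) (i : Fin d) :
    ((chart d L t i / L : ℝ) : UnitAddCircle) = t i := by
  simp only [chart, UnitAddTorus.coe_measurableEquivPiIoc_apply, Pi.smul_apply, smul_eq_mul,
    mul_div_cancel_left₀ _ hL.ne']
  exact AddCircle.coe_equivIoc

theorem measurePreserving_chart (hL : 0 < L) :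
    MeasurePreserving (chart d L) volume (ENNReal.ofReal ((L ^ d)⁻¹) • cellMeasure d L) := by
  set B : Set (Fin d → ℝ) := {x | ∀ i, x i ∈ Ioc (-(1 / 2 : ℝ)) (-(1 / 2) + 1)} with hB
  have hBm : MeasurableSet B := MeasurableSet.univ_pi' (fun i => measurableSet_Ioc)
  have h1 := (measurePreserving_subtype_coe (μa := (volume : Measure (Fin d → ℝ))) hBm).comp
    (UnitAddTorus.measurePreserving_equivPiIoc (fun _ : Fin d => -(1 / 2 : ℝ)))
  have h2 : MeasurePreserving (fun x : Fin d → ℝ => L • x) (volume.restrict B)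
      (ENNReal.ofReal ((L ^ d)⁻¹) • cellMeasure d L) := by
    refine ⟨measurable_const_smul L, ?_⟩
    set C : Set (Fin d → ℝ) := univ.pi fun _ => Ioc (-(L / 2)) (L / 2) with hC
    have hCm : MeasurableSet C := MeasurableSet.univ_pi fun i => measurableSet_Ioc
    have hpre : (fun x : Fin d → ℝ => L • x) ⁻¹' C = B := by
      ext x
      simp only [hC, hB, mem_preimage, mem_univ_pi, Pi.smul_apply, smul_eq_mul, mem_Ioc,
        mem_ofPred_eq]
      refine forall_congr' fun i => ?_
      constructor
      · rintro ⟨a, b⟩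
        exact ⟨by nlinarith, by nlinarith⟩
      · rintro ⟨a, b⟩
        exact ⟨by nlinarith, by nlinarith⟩
    rw [← hpre, ← Measure.restrict_map (measurable_const_smul L) hCm,
      Measure.map_addHaar_smul _ hL.ne', Measure.restrict_smul]
    have hfin : Module.finrank ℝ (Fin d → ℝ) = d := by simp
    rw [hfin, abs_of_pos (by positivity)]
    congr 1
    exact Measure.restrict_congr_set Measure.univ_pi_Ioc_ae_eq_Icc
  exact h2.comp h1

theorem mFourier_neg_eq (hL : 0 < L) (k : Fin d → ℤ) (t : UnitAddTorus (Fin d)) :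
    UnitAddTorus.mFourier (-k) t =
      (Real.cos (phase L k (chart d L t)) : ℂ) -
        Real.sin (phase L k (chart d L t)) * Complex.I := by
  have h1 : UnitAddTorus.mFourier (-k) t =
      Complex.exp (((-phase L k (chart d L t) : ℝ) : ℂ) * Complex.I) := by
    simp only [UnitAddTorus.mFourier, ContinuousMap.coe_mk, phase]
    rw [← Finset.sum_neg_distrib, Complex.ofReal_sum, Finset.sum_mul, Complex.exp_sum]
    refine Finset.prod_congr rfl fun i _ => ?_
    rw [← chart_coe hL t i, fourier_coe_apply]
    congr 1
    have : (L : ℂ) ≠ 0 := by exact_mod_cast hL.ne'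
    push_cast
    field_simp
    simp [mul_comm]
  rw [h1, Complex.exp_mul_I, ← Complex.ofReal_cos, ← Complex.ofReal_sin, Real.cos_neg,
    Real.sin_neg]
  push_cast
  ring

/-- Parseval's identity on the torus of side `L`, for real functions. -/
theorem hasSum_sq_coeff (hL : 0 < L) {f : (Fin d → ℝ) → ℝ} (hf : MemLp f 2 (cellMeasure d L)) :
    HasSum (fun k => cosCoeff L f k ^ 2 + sinCoeff L f k ^ 2)
      (L ^ d * ∫ x, f x ^ 2 ∂(cellMeasure d L)) := by
  have hLd : (0 : ℝ) < L ^ d := by positivity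
  have hmp := measurePreserving_chart (d := d) hL
  have hint : ∀ g : (Fin d → ℝ) → ℂ, AEStronglyMeasurable g (cellMeasure d L) →
      ∫ t, g (chart d L t) = (L ^ d)⁻¹ • ∫ x, g x ∂(cellMeasure d L) := by
    intro g hg
    have h := integral_map hmp.measurable.aemeasurable (μ := volume)
      (f := g) (by rw [hmp.map_eq]; exact hg.smul_measure _)
    rw [hmp.map_eq, integral_smul_measure, ENNReal.toReal_ofReal (by positivity)] at h
    exact h.symm
  have hfC : MemLp (fun x => (f x : ℂ)) 2 (cellMeasure d L) := hf.ofReal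
  have hF : MemLp (fun t => (f (chart d L t) : ℂ)) 2 (volume : Measure (UnitAddTorus (Fin d))) :=
    (hfC.smul_measure ENNReal.ofReal_ne_top).comp_measurePreserving hmp
  set F : Lp ℂ 2 (volume : Measure (UnitAddTorus (Fin d))) := hF.toLp _
  have hFae : F =ᵐ[volume] fun t => (f (chart d L t) : ℂ) := hF.coeFn_toLp
  have hsum := UnitAddTorus.hasSum_sq_mFourierCoeff F
  have hfi : Integrable f (cellMeasure d L) := hf.integrable (by norm_num)
  have hcoef : ∀ k, ‖UnitAddTorus.mFourierCoeff F k‖ ^ 2 =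
      ((L ^ d)⁻¹) ^ 2 * (cosCoeff L f k ^ 2 + sinCoeff L f k ^ 2) := by
    intro k
    have hc : Integrable (fun x => f x * Real.cos (phase L k x)) (cellMeasure d L) :=
      integrable_mul_of_continuous hfi (isTestFunction_cos_phase hL k).contDiff.continuous
    have hs : Integrable (fun x => f x * Real.sin (phase L k x)) (cellMeasure d L) :=
      integrable_mul_of_continuous hfi (isTestFunction_sin_phase hL k).contDiff.continuous
    have hcC : Integrable (fun x => ((f x * Real.cos (phase L k x) : ℝ) : ℂ))
        (cellMeasure d L) := hc.ofReal
    have hsI : Integrable (fun x => ((f x * Real.sin (phase L k x) : ℝ) : ℂ) * Complex.I)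
        (cellMeasure d L) := hs.ofReal.mul_const _
    have hcs : Integrable (fun x => ((f x * Real.cos (phase L k x) : ℝ) : ℂ) -
        ((f x * Real.sin (phase L k x) : ℝ) : ℂ) * Complex.I) (cellMeasure d L) :=
      hcC.sub hsI
    have e1 : UnitAddTorus.mFourierCoeff F k =
        ∫ t, (fun x => ((f x * Real.cos (phase L k x) : ℝ) : ℂ) -
          ((f x * Real.sin (phase L k x) : ℝ) : ℂ) * Complex.I) (chart d L t) := by
      refine integral_congr_ae ?_
      filter_upwards [hFae] with t ht
      rw [ht, mFourier_neg_eq hL, smul_eq_mul]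
      push_cast
      ring
    rw [e1, hint _ hcs.1, integral_sub hcC hsI, integral_mul_const, integral_complex_ofReal,
      integral_complex_ofReal]
    change ‖(L ^ d)⁻¹ • ((cosCoeff L f k : ℂ) - (sinCoeff L f k : ℂ) * Complex.I)‖ ^ 2 = _
    rw [norm_smul, mul_pow, Real.norm_eq_abs, sq_abs, ← Complex.normSq_eq_norm_sq]
    congr 1
    simp [Complex.normSq_apply]
    ring
  have hnorm : ∫ t, ‖F t‖ ^ 2 = (L ^ d)⁻¹ * ∫ x, f x ^ 2 ∂(cellMeasure d L) := by
    have e1 : ∫ t, ‖F t‖ ^ 2 = ∫ t, (fun x => f x ^ 2) (chart d L t) := by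
      refine integral_congr_ae ?_
      filter_upwards [hFae] with t ht
      rw [ht, Complex.norm_real, Real.norm_eq_abs, sq_abs]
    have h := integral_map hmp.measurable.aemeasurable (μ := volume)
      (f := fun x => f x ^ 2) (by rw [hmp.map_eq]; exact (hf.1.pow 2).smul_measure _)
    rw [hmp.map_eq, integral_smul_measure, ENNReal.toReal_ofReal (by positivity)] at h
    rw [e1, ← h, smul_eq_mul]
  rw [hnorm] at hsum
  simp_rw [hcoef] at hsum
  have h := hsum.mul_left ((L ^ d) ^ 2)
  have e1 : ∀ k, (L ^ d) ^ 2 * (((L ^ d)⁻¹) ^ 2 * (cosCoeff L f k ^ 2 + sinCoeff L f k ^ 2)) =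
      cosCoeff L f k ^ 2 + sinCoeff L f k ^ 2 := fun k => by field_simp
  have e2 : ∀ s : ℝ, (L ^ d) ^ 2 * ((L ^ d)⁻¹ * s) = L ^ d * s := fun s => by field_simp
  simp_rw [e1, e2] at h
  exact h

theorem cosCoeff_grad (hL : 0 < L) (u : H1L4 d L) (k : Fin d → ℤ) (i : Fin d) :
    cosCoeff L (fun x => grad u x i) k = 2 * Real.pi / L * k i * sinCoeff L (fn u) k := by
  have h := u.2 _ (isTestFunction_cos_phase hL k) i
  simp_rw [fderiv_cos_phase] at h
  have e : ∀ x, u.1.1 x * (-(2 * Real.pi / L * k i) * Real.sin (phase L k x)) =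
      -(2 * Real.pi / L * k i) * (fn u x * Real.sin (phase L k x)) := fun x => by
    rw [fn]
    ring
  simp_rw [e, integral_const_mul] at h
  unfold cosCoeff sinCoeff grad
  linarith

theorem sinCoeff_grad (hL : 0 < L) (u : H1L4 d L) (k : Fin d → ℤ) (i : Fin d) :
    sinCoeff L (fun x => grad u x i) k = -(2 * Real.pi / L * k i) * cosCoeff L (fn u) k := by
  have h := u.2 _ (isTestFunction_sin_phase hL k) i
  simp_rw [fderiv_sin_phase] at h
  have e : ∀ x, u.1.1 x * (2 * Real.pi / L * k i * Real.cos (phase L k x)) =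
      2 * Real.pi / L * k i * (fn u x * Real.cos (phase L k x)) := fun x => by
    rw [fn]
    ring
  simp_rw [e, integral_const_mul] at h
  unfold cosCoeff sinCoeff grad
  linarith

theorem memLp_grad_apply (u : H1L4 d L) (i : Fin d) :
    MemLp (fun x => grad u x i) 2 (cellMeasure d L) :=
  (EuclideanSpace.proj (𝕜 := ℝ) i).comp_memLp' (memLp_grad u)

theorem dirichlet_eq_sum (u : H1L4 d L) :
    dirichlet u = ∑ i, ∫ x, grad u x i ^ 2 ∂(cellMeasure d L) := by
  rw [← integral_finsetSum _ fun i _ => (memLp_grad_apply u i).integrable_sq]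
  refine integral_congr_ae (Eventually.of_forall fun x => ?_)
  exact EuclideanSpace.real_norm_sq_eq _

theorem integral_fn_sq (u : H1L4 d L) : ∫ x, fn u x ^ 2 ∂(cellMeasure d L) = pairing u u := by
  simp only [pairing, sq]

theorem hasSum_sq_coeff_fn (hL : 0 < L) (u : H1L4 d L) :
    HasSum (fun k => cosCoeff L (fn u) k ^ 2 + sinCoeff L (fn u) k ^ 2)
      (L ^ d * pairing u u) := by
  rw [← integral_fn_sq]
  exact hasSum_sq_coeff hL (memLp_two_fn u)

theorem hasSum_dirichlet (hL : 0 < L) (u : H1L4 d L) :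
    HasSum (fun k => (2 * Real.pi / L) ^ 2 * (∑ i, (k i : ℝ) ^ 2) *
      (cosCoeff L (fn u) k ^ 2 + sinCoeff L (fn u) k ^ 2)) (L ^ d * dirichlet u) := by
  have h := hasSum_sum (s := Finset.univ) fun (i : Fin d) _ =>
    hasSum_sq_coeff hL (memLp_grad_apply u i)
  rw [← Finset.mul_sum, ← dirichlet_eq_sum] at h
  refine h.congr_fun fun k => ?_
  simp only [cosCoeff_grad hL, sinCoeff_grad hL]
  rw [Finset.mul_sum, Finset.sum_mul]
  refine Finset.sum_congr rfl fun i _ => ?_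
  ring

/-- Up to a small multiple of the Dirichlet integral, the `L²` norm is controlled by finitely many
Fourier coefficients. -/
theorem pairing_le_sum_coeff (hL : 0 < L) {ε : ℝ} (hε : 0 < ε) :
    ∃ F : Finset (Fin d → ℤ), ∀ u : H1L4 d L, L ^ d * pairing u u ≤
      ∑ k ∈ F, (cosCoeff L (fn u) k ^ 2 + sinCoeff L (fn u) k ^ 2) + ε * dirichlet u := by
  have hκ : 0 < (2 * Real.pi / L) ^ 2 := by positivity
  have hLd : 0 < L ^ d := by positivity
  obtain ⟨N, hN⟩ := exists_nat_gt (L ^ d / (ε * (2 * Real.pi / L) ^ 2))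
  refine ⟨Fintype.piFinset fun _ => Finset.Icc (-(N : ℤ)) N, fun u => ?_⟩
  set F : Finset (Fin d → ℤ) := Fintype.piFinset fun _ => Finset.Icc (-(N : ℤ)) N with hF
  have hN0 : (0 : ℝ) < N := lt_trans (by positivity) hN
  set a := fun k => cosCoeff L (fn u) k ^ 2 + sinCoeff L (fn u) k ^ 2 with ha
  have ha0 : ∀ k, 0 ≤ a k := fun k => by positivity
  have h1 := hasSum_sum_of_ne_finset_zero (L := .unconditional _)
    (f := fun k => if k ∈ F then a k else 0) (s := F) fun k hk => if_neg hk
  have h2 := (hasSum_dirichlet hL u).mul_left (ε / L ^ d)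
  have h3 := hasSum_le (fun k => ?_) (hasSum_sq_coeff_fn hL u) (h1.add h2)
  · rw [Finset.sum_congr rfl fun k hk => if_pos hk] at h3
    refine h3.trans_eq ?_
    field_simp
  · change a k ≤ (if k ∈ F then a k else 0) + ε / L ^ d * (_ * a k)
    split_ifs with hk
    · have := ha0 k
      have : 0 ≤ ∑ i, (k i : ℝ) ^ 2 := by positivity
      have : 0 ≤ ε / L ^ d * ((2 * Real.pi / L) ^ 2 * (∑ i, (k i : ℝ) ^ 2) * a k) := by positivity
      linarith
    · have hsum : (N : ℝ) ≤ ∑ i, (k i : ℝ) ^ 2 := by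
        simp only [hF, Fintype.mem_piFinset, Finset.mem_Icc, not_forall] at hk
        obtain ⟨i, hi⟩ := hk
        have hi' : (N : ℤ) ≤ (k i) ^ 2 := by
          rcases not_and_or.1 hi with h | h
          · nlinarith [Int.natCast_nonneg N]
          · nlinarith [Int.natCast_nonneg N]
        calc (N : ℝ) ≤ (k i : ℝ) ^ 2 := by exact_mod_cast hi'
          _ ≤ _ := Finset.single_le_sum (f := fun i => (k i : ℝ) ^ 2)
            (fun i _ => sq_nonneg _) (Finset.mem_univ i)
      -- outside `F` the weight of the Dirichlet integral exceeds `L ^ d / ε`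
      have hone : 1 ≤ ε / L ^ d * ((2 * Real.pi / L) ^ 2 * ∑ i, (k i : ℝ) ^ 2) := by
        rw [div_lt_iff₀ (by positivity)] at hN
        rw [div_mul_eq_mul_div, le_div_iff₀ hLd, one_mul]
        calc L ^ d ≤ N * (ε * (2 * Real.pi / L) ^ 2) := hN.le
          _ ≤ (∑ i, (k i : ℝ) ^ 2) * (ε * (2 * Real.pi / L) ^ 2) := by gcongr
          _ = _ := by ring
      rw [zero_add, ← mul_assoc]
      exact le_mul_of_one_le_left (ha0 k) hone

theorem cosCoeff_sub (hL : 0 < L) (u v : H1L4 d L) (k : Fin d → ℤ) :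
    cosCoeff L (fn (u - v)) k = cosCoeff L (fn u) k - cosCoeff L (fn v) k := by
  have hc := (isTestFunction_cos_phase hL k).contDiff.continuous
  rw [cosCoeff, cosCoeff, cosCoeff, ← integral_sub
    (integrable_mul_of_continuous (integrable_fn u) hc)
    (integrable_mul_of_continuous (integrable_fn v) hc)]
  refine integral_congr_ae ?_
  filter_upwards [fn_add_smul u v (-1)] with x hx
  rw [← add_neg_one_smul, hx]
  ring

theorem sinCoeff_sub (hL : 0 < L) (u v : H1L4 d L) (k : Fin d → ℤ) :
    sinCoeff L (fn (u - v)) k = sinCoeff L (fn u) k - sinCoeff L (fn v) k := by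
  have hc := (isTestFunction_sin_phase hL k).contDiff.continuous
  rw [sinCoeff, sinCoeff, sinCoeff, ← integral_sub
    (integrable_mul_of_continuous (integrable_fn u) hc)
    (integrable_mul_of_continuous (integrable_fn v) hc)]
  refine integral_congr_ae ?_
  filter_upwards [fn_add_smul u v (-1)] with x hx
  rw [← add_neg_one_smul, hx]
  ring

theorem dirichlet_sub_le (u v : H1L4 d L) :
    dirichlet (u - v) ≤ 2 * dirichlet u + 2 * dirichlet v := by
  have h1 := dirichlet_add_smul u v 1
  have h2 := dirichlet_add_smul u v (-1)
  rw [add_neg_one_smul] at h2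
  have h3 := dirichlet_nonneg (u + (1 : ℝ) • v)
  linarith

/-- Rellich's theorem: a sequence bounded in `H¹` has a subsequence that is Cauchy in `L²`. All
Fourier coefficients converge along a subsequence, by compactness of a countable product. -/
theorem exists_cauchy_subseq (hL : 0 < L) {C : ℝ} {u : ℕ → H1L4 d L}
    (hP : ∀ n, pairing (u n) (u n) ≤ C) (hD : ∀ n, dirichlet (u n) ≤ C) :
    ∃ τ : ℕ → ℕ, StrictMono τ ∧ ∀ ε > 0, ∃ N, ∀ m ≥ N, ∀ n ≥ N,
      pairing (u (τ m) - u (τ n)) (u (τ m) - u (τ n)) < ε := by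
  have hLd : 0 < L ^ d := by positivity
  set M := √(L ^ d * C) with hM
  have hcoef : ∀ n k, cosCoeff L (fn (u n)) k ^ 2 + sinCoeff L (fn (u n)) k ^ 2 ≤ L ^ d * C :=
    fun n k => (le_hasSum (hasSum_sq_coeff_fn hL (u n)) k fun j _ => by positivity).trans
      (mul_le_mul_of_nonneg_left (hP n) hLd.le)
  -- the sequences of coefficients lie in a compact and metrizable product of squares
  set K : Set ((Fin d → ℤ) → ℝ × ℝ) := univ.pi fun _ => Icc (-M) M ×ˢ Icc (-M) M
  have hK : IsCompact K := isCompact_univ_pi fun _ => isCompact_Icc.prod isCompact_Icc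
  have hmem : ∀ n, (fun k => (cosCoeff L (fn (u n)) k, sinCoeff L (fn (u n)) k)) ∈ K := by
    intro n k _
    have h := hcoef n k
    exact ⟨abs_le.1 (Real.abs_le_sqrt (by nlinarith [sq_nonneg (sinCoeff L (fn (u n)) k)])),
      abs_le.1 (Real.abs_le_sqrt (by nlinarith [sq_nonneg (cosCoeff L (fn (u n)) k)]))⟩
  obtain ⟨a, -, τ, hτ, hlim⟩ := hK.tendsto_subseq hmem
  refine ⟨τ, hτ, fun ε hε => ?_⟩
  have hC0 : 0 ≤ C := (pairing_self_nonneg _).trans (hP 0)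
  obtain ⟨F, hF⟩ := pairing_le_sum_coeff (d := d) hL
    (show 0 < L ^ d * ε / (2 * (4 * C + 1)) by positivity)
  rw [tendsto_pi_nhds] at hlim
  have hcos : ∀ k, Tendsto (fun n => cosCoeff L (fn (u (τ n))) k) atTop (𝓝 (a k).1) := fun k =>
    (continuous_fst.tendsto _).comp (hlim k)
  have hsin : ∀ k, Tendsto (fun n => sinCoeff L (fn (u (τ n))) k) atTop (𝓝 (a k).2) := fun k =>
    (continuous_snd.tendsto _).comp (hlim k)
  have hsum : Tendsto (fun p : ℕ × ℕ => ∑ k ∈ F,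
      ((cosCoeff L (fn (u (τ p.1))) k - cosCoeff L (fn (u (τ p.2))) k) ^ 2 +
      (sinCoeff L (fn (u (τ p.1))) k - sinCoeff L (fn (u (τ p.2))) k) ^ 2)) atTop (𝓝 0) := by
    have : (0 : ℝ) = ∑ k ∈ F, (((a k).1 - (a k).1) ^ 2 + ((a k).2 - (a k).2) ^ 2) := by simp
    rw [this, ← prod_atTop_atTop_eq]
    refine tendsto_finsetSum _ fun k _ => ?_
    exact ((((hcos k).comp tendsto_fst).sub ((hcos k).comp tendsto_snd)).pow 2).add
      ((((hsin k).comp tendsto_fst).sub ((hsin k).comp tendsto_snd)).pow 2)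
  obtain ⟨⟨N₁, N₂⟩, hN⟩ := eventually_atTop.1
    (hsum.eventually_lt_const (show 0 < L ^ d * ε / 2 by positivity))
  refine ⟨max N₁ N₂, fun m hm n hn => ?_⟩
  have h1 := hN (m, n) ⟨(le_max_left _ _).trans hm, (le_max_right _ _).trans hn⟩
  have h2 := hF (u (τ m) - u (τ n))
  simp_rw [cosCoeff_sub hL, sinCoeff_sub hL] at h2
  have h3 : dirichlet (u (τ m) - u (τ n)) ≤ 4 * C := by
    have := dirichlet_sub_le (u (τ m)) (u (τ n))
    have := hD (τ m)
    have := hD (τ n)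
    linarith
  have h4 : L ^ d * ε / (2 * (4 * C + 1)) * dirichlet (u (τ m) - u (τ n)) ≤ L ^ d * ε / 2 := by
    rw [div_mul_eq_mul_div, div_le_div_iff₀ (by positivity) (by positivity)]
    have : 0 ≤ L ^ d * ε := by positivity
    nlinarith
  refine lt_of_mul_lt_mul_left ?_ hLd.le
  linarith

end Parseval

/-! ### Critical points -/

section CriticalPoints

variable {d : ℕ} {L : ℝ}

theorem eq_zero_of_forall_polynomial_nonneg {a b c e : ℝ}
    (h : ∀ t : ℝ, 0 ≤ t * a + t ^ 2 * b + t ^ 3 * c + t ^ 4 * e) : a = 0 := by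
  have hd : HasDerivAt (fun t : ℝ => t * a + t ^ 2 * b + t ^ 3 * c + t ^ 4 * e) a 0 := by
    have h1 := (hasDerivAt_id (0 : ℝ)).mul_const a
    have h2 := (hasDerivAt_pow 2 (0 : ℝ)).mul_const b
    have h3 := (hasDerivAt_pow 3 (0 : ℝ)).mul_const c
    have h4 := (hasDerivAt_pow 4 (0 : ℝ)).mul_const e
    simpa using ((h1.fun_add h2).fun_add h3).fun_add h4
  refine IsLocalMin.hasDerivAt_eq_zero (Eventually.of_forall fun t => ?_) hd
  simpa using h t

theorem mem_meanZero_iff {w : H1L4 d L} :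
    w ∈ meanZero d L ↔ ∫ x, fn w x ∂(cellMeasure d L) = 0 := Iff.rfl

theorem add_smul_mem_XSpace (hL : 0 < L) {φ : ℝ} {u w : H1L4 d L} (hu : u ∈ XSpace d L φ)
    (hw : w ∈ meanZero d L) (t : ℝ) : u + t • w ∈ XSpace d L φ := by
  rw [mem_XSpace_iff hL] at *
  rw [integral_fn_add_smul, mem_meanZero_iff.1 hw, hu, mul_zero, add_zero]

theorem sub_mem_meanZero (hL : 0 < L) {φ : ℝ} {u v : H1L4 d L} (hu : u ∈ XSpace d L φ)
    (hv : v ∈ XSpace d L φ) : v - u ∈ meanZero d L := by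
  rw [mem_XSpace_iff hL] at *
  have h := integral_fn_add_smul v u (-1)
  rw [add_neg_one_smul, hu, hv] at h
  rw [mem_meanZero_iff, h]
  ring

/-- Fixed points of the convex splitting step are critical points of the energy on `X_φ`. -/
theorem firstVariation_eq_zero (hL : 0 < L) {φ : ℝ} {u : H1L4 d L} (hu : splitStep hL φ u = u)
    {w : H1L4 d L} (hw : w ∈ meanZero d L) : firstVariation u w = 0 := by
  have huX : u ∈ XSpace d L φ := hu ▸ splitStep_mem hL φ u
  refine eq_zero_of_forall_polynomial_nonneg
    (b := 1 / 2 * dirichlet w + 3 / 2 * quad u u w w) (c := quad u w w w)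
    (e := 1 / 4 * quad w w w w) fun t => ?_
  have h1 := splitStep_spec hL u (add_smul_mem_XSpace hL huX hw t)
  rw [hu] at h1
  have h2 := convexEnergy_nonneg (u + t • w - u)
  have h3 : splitEnergy u u ≤ splitEnergy u (u + t • w) := by linarith
  unfold splitEnergy at h3
  rw [convexEnergy_add_smul, pairing_add_smul] at h3
  unfold firstVariation
  linarith

theorem firstVariation_add_smul (u v w : H1L4 d L) (t : ℝ) :
    firstVariation u (v + t • w) = firstVariation u v + t * firstVariation u w := by
  unfold firstVariation
  rw [gradPairing_add_smul, quad_add_smul_right, pairing_add_smul]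
  ring

theorem deriv_doubleWell (s : ℝ) : deriv doubleWell s = s ^ 3 - s := by
  have h : HasDerivAt (fun s : ℝ => (1 - s ^ 2) ^ 2 / 4) (2 * (1 - s ^ 2) * (-(2 * s)) / 4) s := by
    have := (((hasDerivAt_pow 2 s).const_sub 1).fun_pow 2).div_const 4
    simpa using this
  rw [show doubleWell = fun s : ℝ => (1 - s ^ 2) ^ 2 / 4 from rfl, h.deriv]
  ring

/-- The Lagrange multiplier is the mean value of `G'(u)`, that is, the first variation in the
direction of the constants; every direction is a constant plus one of mean zero. -/
theorem exists_isWeakSolution (hL : 0 < L) {u : H1L4 d L}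
    (hu : ∀ w ∈ meanZero d L, firstVariation u w = 0) : ∃ lam, IsWeakSolution u lam := by
  have hLd : (0 : ℝ) < L ^ d := by positivity
  refine ⟨firstVariation u (constState d L 1) / L ^ d, fun v => ?_⟩
  have h1 : ∫ x, (inner ℝ (grad u x) (grad v x) + deriv doubleWell (fn u x) * fn v x)
      ∂(cellMeasure d L) = firstVariation u v := by
    have e : ∀ x, inner ℝ (grad u x) (grad v x) + deriv doubleWell (fn u x) * fn v x =
        inner ℝ (grad u x) (grad v x) + fn u x * fn u x * (fn u x * fn v x) - fn u x * fn v x :=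
      fun x => by
        rw [deriv_doubleWell]
        ring
    simp_rw [e]
    have i1 := integrable_inner_grad u v
    have i2 := integrable_quad u u u v
    rw [integral_sub (integrable_fun_add i1 i2) (integrable_fn_mul u v), integral_add i1 i2]
    rfl
  have h2 : v + (-((∫ x, fn v x ∂(cellMeasure d L)) / L ^ d)) • constState d L 1 ∈
      meanZero d L := by
    rw [mem_meanZero_iff, integral_fn_add_smul,
      integral_congr_ae (fn_constState (d := d) (L := L) 1), integral_const, measureReal_cell hL]
    simp only [smul_eq_mul]
    field_simp
    ring
  have h3 := hu _ h2
  rw [firstVariation_add_smul] at h3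
  rw [h1]
  field_simp at h3 ⊢
  linarith

/-- Where the first variation vanishes, the energy differs from its value at `u` by terms that
are at least quadratic in the norm of `H¹ ∩ L⁴`. -/
theorem hasFDerivAt_energy (u : H1L4 d L) (hu : ∀ w ∈ meanZero d L, firstVariation u w = 0) :
    HasFDerivAt (fun w : meanZero d L => energy (u + (w : H1L4 d L)))
      (0 : meanZero d L →L[ℝ] ℝ) 0 := by
  have hbig : (fun w : meanZero d L => energy (u + (w : H1L4 d L)) - energy u) =O[𝓝 0]
      fun w => ‖w - 0‖ ^ 2 := by
    set B := 1 / 2 + 2 * ‖u‖ ^ 2 + 1 / 2 * √((cellMeasure d L).real univ) + 3 / 4 with hB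
    refine Asymptotics.IsBigO.of_bound B ?_
    filter_upwards [Metric.ball_mem_nhds (0 : meanZero d L) one_pos] with w hw
    replace hw : ‖(w : H1L4 d L)‖ < 1 := (mem_ball_zero_iff (E := meanZero d L)).1 hw
    have hnorm : ‖‖w - 0‖ ^ 2‖ = ‖(w : H1L4 d L)‖ ^ 2 := by
      rw [norm_pow, norm_norm]
      exact congrArg (‖·‖ ^ 2) (sub_zero w)
    rw [hnorm]
    have e := energy_add_smul u (w : H1L4 d L) 1
    rw [one_smul, hu _ w.2] at e
    have h1 := dirichlet_nonneg (w : H1L4 d L)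
    have h2 := dirichlet_le (w : H1L4 d L)
    have h3 := pairing_self_nonneg (w : H1L4 d L)
    have h4 := pairing_self_le (w : H1L4 d L)
    have h5 := quad_sq_nonneg (w : H1L4 d L) w
    have h6 := quad_le (w : H1L4 d L)
    have h7 := quad_sq_nonneg u w
    have h8 : quad u u w w ≤ ‖u‖ ^ 2 * ‖(w : H1L4 d L)‖ ^ 2 := by
      refine abs_le_of_sq_le_sq' ?_ (by positivity) |>.2
      calc quad u u w w ^ 2 ≤ quad u u u u * quad (w : H1L4 d L) w w w := quad_sq_le u w
        _ ≤ ‖u‖ ^ 4 * ‖(w : H1L4 d L)‖ ^ 4 := mul_le_mul (quad_le u) h6 h5 (by positivity)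
        _ = (‖u‖ ^ 2 * ‖(w : H1L4 d L)‖ ^ 2) ^ 2 := by ring
    have h9 : |quad u w w w| ≤ 1 / 2 * (quad u u w w + quad (w : H1L4 d L) w w w) := by
      refine abs_le_of_sq_le_sq ?_ (by positivity)
      have := quad_mixed_sq_le u (w : H1L4 d L)
      nlinarith [sq_nonneg (quad u u w w - quad (w : H1L4 d L) w w w)]
    have h10 : ‖(w : H1L4 d L)‖ ^ 4 ≤ ‖(w : H1L4 d L)‖ ^ 2 :=
      pow_le_pow_of_le_one (norm_nonneg _) hw.le (by norm_num)
    have h11 := abs_le.1 h9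
    rw [Real.norm_eq_abs, abs_le]
    constructor
    · nlinarith
    · nlinarith
  have h := (Asymptotics.IsBigO.hasFDerivAt (𝕜 := ℝ) (E := meanZero d L) hbig
    one_lt_two).add_const (energy u)
  simpa using h

/-- The element of `H¹ ∩ L⁴` with given function and given weak gradient. -/
def ofWeakGradient {f : (Fin d → ℝ) → ℝ} {g : (Fin d → ℝ) → EuclideanSpace ℝ (Fin d)}
    (hf : MemLp f 4 (cellMeasure d L)) (hg : MemLp g 2 (cellMeasure d L))
    (h : HasWeakGradient L f g) : H1L4 d L :=
  ⟨(hf.toLp f, hg.toLp g), by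
    intro ψ hψ i
    have h1 : ∫ x, hf.toLp f x * fderiv ℝ ψ x (Pi.single i 1) ∂(cellMeasure d L) =
        ∫ x, f x * fderiv ℝ ψ x (Pi.single i 1) ∂(cellMeasure d L) := by
      refine integral_congr_ae ?_
      filter_upwards [hf.coeFn_toLp] with x hx
      rw [hx]
    have h2 : ∫ x, hg.toLp g x i * ψ x ∂(cellMeasure d L) =
        ∫ x, g x i * ψ x ∂(cellMeasure d L) := by
      refine integral_congr_ae ?_
      filter_upwards [hg.coeFn_toLp] with x hx
      rw [hx]
    change ∫ x, hf.toLp f x * _ ∂_ = -∫ x, hg.toLp g x i * ψ x ∂_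
    rw [h1, h2]
    exact h ψ hψ i⟩

theorem fn_ofWeakGradient {f : (Fin d → ℝ) → ℝ} {g : (Fin d → ℝ) → EuclideanSpace ℝ (Fin d)}
    (hf : MemLp f 4 (cellMeasure d L)) (hg : MemLp g 2 (cellMeasure d L))
    (h : HasWeakGradient L f g) : fn (ofWeakGradient hf hg h) =ᵐ[cellMeasure d L] f :=
  hf.coeFn_toLp

theorem grad_ofWeakGradient {f : (Fin d → ℝ) → ℝ} {g : (Fin d → ℝ) → EuclideanSpace ℝ (Fin d)}
    (hf : MemLp f 4 (cellMeasure d L)) (hg : MemLp g 2 (cellMeasure d L))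
    (h : HasWeakGradient L f g) : grad (ofWeakGradient hf hg h) =ᵐ[cellMeasure d L] g :=
  hg.coeFn_toLp

theorem memLp_of_continuous {E : Type*} [NormedAddCommGroup E] [SecondCountableTopology E]
    {f : (Fin d → ℝ) → E} (hf : Continuous f)
    (p : ℝ≥0∞) : MemLp f p (cellMeasure d L) := by
  obtain ⟨C, hC⟩ := (isCompact_Icc : IsCompact (cell d L)).exists_bound_of_continuousOn
    hf.continuousOn
  refine MemLp.of_bound hf.aestronglyMeasurable C ?_
  filter_upwards [ae_restrict_mem (measurableSet_Icc : MeasurableSet (cell d L))] with x hx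
  exact hC x hx

theorem hasWeakGradient_of_isTestFunction {ψ : (Fin d → ℝ) → ℝ} (hψ : IsTestFunction L ψ) :
    HasWeakGradient L ψ fun x => WithLp.toLp 2 fun i => fderiv ℝ ψ x (Pi.single i 1) := by
  intro χ hχ i
  have hprod : IsTestFunction L fun x => ψ x * χ x :=
    ⟨hψ.contDiff.mul hχ.contDiff, fun j x => by rw [hψ.periodic, hχ.periodic]⟩
  have h := integral_partial_eq_zero hprod i
  have hd : ∀ x, fderiv ℝ (fun x => ψ x * χ x) x (Pi.single i 1) =
      ψ x * fderiv ℝ χ x (Pi.single i 1) + fderiv ℝ ψ x (Pi.single i 1) * χ x := fun x => by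
    rw [fderiv_fun_mul (hψ.contDiff.differentiable (by simp)).differentiableAt
      (hχ.contDiff.differentiable (by simp)).differentiableAt]
    simp only [add_apply, smul_apply, smul_eq_mul]
    ring
  simp_rw [hd] at h
  rw [integral_add] at h
  · exact eq_neg_of_add_eq_zero_left h
  · exact memLp_one_iff_integrable.1
      (memLp_of_continuous (hψ.contDiff.continuous.mul (hχ.continuous_partial i)) 1)
  · exact memLp_one_iff_integrable.1
      (memLp_of_continuous ((hψ.continuous_partial i).mul hχ.contDiff.continuous) 1)

theorem continuous_testGradient {ψ : (Fin d → ℝ) → ℝ} (hψ : IsTestFunction L ψ) :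
    Continuous fun x => (WithLp.toLp 2 fun i => fderiv ℝ ψ x (Pi.single i 1) :
      EuclideanSpace ℝ (Fin d)) :=
  (PiLp.continuous_toLp 2 _).comp (continuous_pi fun i => hψ.continuous_partial i)

/-- There are mean zero directions of arbitrarily fast oscillation, that is, of arbitrarily large
Rayleigh quotient. -/
theorem exists_oscillating (hd : 0 < d) (hL : 0 < L) (C : ℝ) :
    ∃ w ∈ meanZero d L, 0 < pairing w w ∧ C * pairing w w ≤ dirichlet w := by
  have hLd : (0 : ℝ) < L ^ d := by positivity
  obtain ⟨N, hN⟩ := exists_nat_gt (max 1 (C / (2 * Real.pi / L) ^ 2))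
  have hN1 : (1 : ℝ) < N := (le_max_left _ _).trans_lt hN
  have hNC : C / (2 * Real.pi / L) ^ 2 < N := (le_max_right _ _).trans_lt hN
  set j : Fin d := ⟨0, hd⟩
  set k : Fin d → ℤ := Pi.single j (N : ℤ) with hk
  have hkj : (k j : ℝ) = N := by simp [hk]
  have hki : ∀ i, i ≠ j → (k i : ℝ) = 0 := fun i hi => by simp [hk, hi]
  have hκ : (0 : ℝ) < 2 * Real.pi / L * k j := by
    rw [hkj]
    have := Real.pi_pos
    positivity
  set w := ofWeakGradient
    (memLp_of_continuous (isTestFunction_cos_phase hL k).contDiff.continuous 4)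
    (memLp_of_continuous (continuous_testGradient (isTestFunction_cos_phase hL k)) 2)
    (hasWeakGradient_of_isTestFunction (isTestFunction_cos_phase hL k))
  have hfn : fn w =ᵐ[cellMeasure d L] fun x => Real.cos (phase L k x) := fn_ofWeakGradient _ _ _
  have hgr : grad w =ᵐ[cellMeasure d L] fun x => WithLp.toLp 2 fun i =>
      -(2 * Real.pi / L * k i) * Real.sin (phase L k x) := by
    filter_upwards [grad_ofWeakGradient (memLp_of_continuous
      (isTestFunction_cos_phase hL k).contDiff.continuous 4)
      (memLp_of_continuous (continuous_testGradient (isTestFunction_cos_phase hL k)) 2)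
      (hasWeakGradient_of_isTestFunction (isTestFunction_cos_phase hL k))] with x hx
    rw [hx]
    congr 1
    funext i
    exact fderiv_cos_phase k x i
  set S := ∫ x, Real.sin (phase L k x) ^ 2 ∂(cellMeasure d L)
  have hP : pairing w w = ∫ x, Real.cos (phase L k x) ^ 2 ∂(cellMeasure d L) := by
    refine integral_congr_ae ?_
    filter_upwards [hfn] with x hx
    rw [hx, sq]
  -- `∫ sin² = ∫ cos²`: test the weak gradient of the cosine with the sine
  have hSP : S = pairing w w := by
    have h := sinCoeff_grad hL w k j
    have e1 : sinCoeff L (fun x => grad w x j) k = -(2 * Real.pi / L * k j) * S := by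
      rw [sinCoeff, ← integral_const_mul]
      refine integral_congr_ae ?_
      filter_upwards [hgr] with x hx
      rw [hx]
      change -(2 * Real.pi / L * k j) * Real.sin (phase L k x) * Real.sin (phase L k x) = _
      ring
    have e2 : cosCoeff L (fn w) k = pairing w w := by
      refine integral_congr_ae ?_
      filter_upwards [hfn] with x hx
      rw [hx]
    rw [e1, e2] at h
    exact mul_left_cancel₀ (neg_ne_zero.2 hκ.ne') h
  have hcc := (isTestFunction_cos_phase hL k).contDiff.continuous
  have hcs := (isTestFunction_sin_phase hL k).contDiff.continuous
  have hsum : S + pairing w w = L ^ d := by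
    have i1 : Integrable (fun x => Real.sin (phase L k x) ^ 2) (cellMeasure d L) :=
      memLp_one_iff_integrable.1 (memLp_of_continuous (hcs.pow 2) 1)
    have i2 : Integrable (fun x => Real.cos (phase L k x) ^ 2) (cellMeasure d L) :=
      memLp_one_iff_integrable.1 (memLp_of_continuous (hcc.pow 2) 1)
    rw [hP, ← integral_add i1 i2]
    simp_rw [Real.sin_sq_add_cos_sq]
    rw [integral_const, measureReal_cell hL, smul_eq_mul, mul_one]
  have hpos : 0 < pairing w w := by linarith
  refine ⟨w, ?_, hpos, ?_⟩
  -- the mean of the cosine is a Fourier coefficient of a constant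
  · have h := sinCoeff_grad hL (constState d L 1) k j
    have e1 : sinCoeff L (fun x => grad (constState d L 1) x j) k = 0 := by
      refine integral_eq_zero_of_ae ?_
      filter_upwards [grad_constState (d := d) (L := L) 1] with x hx
      rw [hx]
      simp
    have e2 : cosCoeff L (fn (constState d L 1)) k = ∫ x, fn w x ∂(cellMeasure d L) := by
      refine integral_congr_ae ?_
      filter_upwards [hfn, fn_constState (d := d) (L := L) 1] with x hx hx'
      rw [hx, hx', one_mul]
    rw [e1, e2] at h
    exact (mul_eq_zero.1 h.symm).resolve_left (neg_ne_zero.2 hκ.ne')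
  · have hD : dirichlet w = (2 * Real.pi / L * k j) ^ 2 * pairing w w := by
      rw [← hSP, ← integral_const_mul]
      refine integral_congr_ae ?_
      filter_upwards [hgr] with x hx
      rw [hx, EuclideanSpace.real_norm_sq_eq,
        Finset.sum_eq_single j (fun i _ hi => by simp [hki i hi]) (by simp)]
      change (-(2 * Real.pi / L * k j) * Real.sin (phase L k x)) ^ 2 = _
      ring
    rw [hD]
    refine mul_le_mul_of_nonneg_right ?_ hpos.le
    have hκ2 : 0 < (2 * Real.pi / L) ^ 2 := by
      have := Real.pi_pos
      positivity
    rw [div_lt_iff₀ hκ2] at hNC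
    rw [mul_pow, hkj]
    calc C ≤ N * (2 * Real.pi / L) ^ 2 := hNC.le
      _ ≤ (N : ℝ) ^ 2 * (2 * Real.pi / L) ^ 2 :=
        mul_le_mul_of_nonneg_right (by nlinarith) hκ2.le
      _ = _ := mul_comm _ _

/-- Near a critical point there are states of higher energy, since the second variation is positive
in directions that oscillate fast. -/
theorem exists_higher_energy (hd : 0 < d) (hL : 0 < L) (u : H1L4 d L)
    (hu : ∀ w ∈ meanZero d L, firstVariation u w = 0) {U : Set (meanZero d L)} (hU : U ∈ 𝓝 0) :
    ∃ z ∈ U, energy u < energy (u + (z : H1L4 d L)) := by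
  obtain ⟨w, hw, hw0, hw2⟩ := exists_oscillating hd hL 2
  set b := 1 / 2 * dirichlet w + 3 / 2 * quad u u w w - 1 / 2 * pairing w w with hb
  have hb0 : 0 < b := by
    have := quad_sq_nonneg u w
    linarith
  have h1 : ∀ᶠ t : ℝ in 𝓝[>] 0, 0 < b + t * quad u w w w + t ^ 2 * (1 / 4 * quad w w w w) := by
    have hc : Continuous fun t : ℝ => b + t * quad u w w w + t ^ 2 * (1 / 4 * quad w w w w) := by
      fun_prop
    have := (hc.tendsto 0).eventually_const_lt (u := 0) (by simpa using hb0)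
    exact this.filter_mono nhdsWithin_le_nhds
  have h2 : ∀ᶠ t : ℝ in 𝓝[>] 0, t • (⟨w, hw⟩ : meanZero d L) ∈ U := by
    have hc : Continuous fun t : ℝ => t • (⟨w, hw⟩ : meanZero d L) := by fun_prop
    have := (hc.tendsto 0).eventually_mem (show U ∈ 𝓝 _ by simpa using hU)
    exact this.filter_mono nhdsWithin_le_nhds
  obtain ⟨t, ht1, ht2, ht0⟩ := (h1.and (h2.and self_mem_nhdsWithin)).exists
  refine ⟨_, ht2, ?_⟩
  change energy u < energy (u + t • w)
  rw [energy_add_smul, hu w hw]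
  have ht0' : 0 < t := ht0
  have : 0 < t ^ 2 * (b + t * quad u w w w + t ^ 2 * (1 / 4 * quad w w w w)) := by positivity
  rw [hb] at this
  linarith

/-- A critical point in the closure of the states of lower energy is a saddle point. -/
theorem isConstrainedSaddlePoint_of_mem_closure (hd : 0 < d) (hL : 0 < L) {φ : ℝ} {u : H1L4 d L}
    (huX : u ∈ XSpace d L φ) (hu : ∀ w ∈ meanZero d L, firstVariation u w = 0)
    (hcl : u ∈ closure {v | v ∈ XSpace d L φ ∧ energy v < energy u}) :
    IsConstrainedSaddlePoint u := by
  refine ⟨hasFDerivAt_energy u hu, fun U hU => ?_⟩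
  obtain ⟨z, hz, hz'⟩ := exists_higher_energy hd hL u hu hU
  obtain ⟨ε, hε, hball⟩ := Metric.mem_nhds_iff.1 hU
  obtain ⟨v, ⟨hvX, hv⟩, hdist⟩ := Metric.mem_closure_iff.1 hcl ε hε
  refine ⟨⟨v - u, sub_mem_meanZero hL huX hvX⟩, hball ?_, z, hz, ?_, ?_⟩
  · refine (mem_ball_zero_iff (E := meanZero d L)).2 ?_
    change ‖v - u‖ < ε
    rwa [← dist_eq_norm, dist_comm]
  · simpa using hv
  · simpa using hz'

end CriticalPoints

/-! ### The uniform state is a strict local minimizer -/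

section LocalMinimizer

variable {d : ℕ} {L : ℝ}

theorem fn_smul (t : ℝ) (u : H1L4 d L) :
    fn (t • u) =ᵐ[cellMeasure d L] fun x => t * fn u x := Lp.coeFn_smul t u.1.1

theorem pairing_smul_self (t : ℝ) (u : H1L4 d L) :
    pairing (t • u) (t • u) = t ^ 2 * pairing u u := by
  rw [pairing, pairing, ← integral_const_mul]
  refine integral_congr_ae ?_
  filter_upwards [fn_smul t u] with x hx
  rw [hx]
  ring

theorem dirichlet_smul (t : ℝ) (u : H1L4 d L) : dirichlet (t • u) = t ^ 2 * dirichlet u := by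
  rw [dirichlet_eq_norm, dirichlet_eq_norm]
  change ‖t • u.1.2‖ ^ 2 = _
  rw [norm_smul, mul_pow, Real.norm_eq_abs, sq_abs]

theorem integrable_fn_sq (u : H1L4 d L) :
    Integrable (fun x => fn u x ^ 2) (cellMeasure d L) := (memLp_two_fn u).integrable_sq

theorem setIntegral_fn_sq_le (u : H1L4 d L) (A : Set (Fin d → ℝ)) :
    ∫ x in A, fn u x ^ 2 ∂(cellMeasure d L) ≤ pairing u u := by
  rw [← integral_fn_sq]
  exact setIntegral_le_integral (integrable_fn_sq u) (Eventually.of_forall fun x => sq_nonneg _)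

/-- The squares of the functions in the unit ball of `H¹` are uniformly integrable. -/
theorem exists_measure_setIntegral_sq_le (hL : 0 < L) {ε : ℝ} (hε : 0 < ε) :
    ∃ δ > 0, ∀ (w : H1L4 d L) (A : Set (Fin d → ℝ)), (cellMeasure d L).real A ≤ δ →
      ∫ x in A, fn w x ^ 2 ∂(cellMeasure d L) ≤ ε * (dirichlet w + pairing w w) := by
  by_contra! hcon
  have hseq : ∀ n : ℕ, ∃ (v : H1L4 d L) (A : Set (Fin d → ℝ)),
      (cellMeasure d L).real A ≤ 1 / ((n : ℝ) + 1) ∧ dirichlet v + pairing v v = 1 ∧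
      ε < ∫ x in A, fn v x ^ 2 ∂(cellMeasure d L) := by
    intro n
    obtain ⟨w, A, hA, hw⟩ := hcon (1 / ((n : ℝ) + 1)) (by positivity)
    have h1 := dirichlet_nonneg w
    have h2 := pairing_self_nonneg w
    have h3 := setIntegral_fn_sq_le w A
    have hs : 0 < dirichlet w + pairing w w := by
      rcases (add_nonneg h1 h2).eq_or_lt with h | h
      · rw [← h, mul_zero] at hw
        linarith
      · exact h
    set s := dirichlet w + pairing w w
    refine ⟨(√s)⁻¹ • w, A, hA, ?_, ?_⟩
    · rw [dirichlet_smul, pairing_smul_self, ← mul_add, inv_pow, Real.sq_sqrt hs.le,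
        inv_mul_cancel₀ hs.ne']
    · have e : ∫ x in A, fn ((√s)⁻¹ • w) x ^ 2 ∂(cellMeasure d L) =
          s⁻¹ * ∫ x in A, fn w x ^ 2 ∂(cellMeasure d L) := by
        rw [← integral_const_mul]
        refine integral_congr_ae (ae_restrict_of_ae ?_)
        filter_upwards [fn_smul (√s)⁻¹ w] with x hx
        rw [hx, mul_pow, inv_pow, Real.sq_sqrt hs.le]
      rw [e, inv_mul_eq_div, lt_div_iff₀ hs]
      exact hw
  choose v A hA hv hint using hseq
  have hP : ∀ n, pairing (v n) (v n) ≤ 1 := fun n => by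
    have := dirichlet_nonneg (v n)
    linarith [hv n]
  have hD : ∀ n, dirichlet (v n) ≤ 1 := fun n => by
    have := pairing_self_nonneg (v n)
    linarith [hv n]
  obtain ⟨τ, hτ, hcau⟩ := exists_cauchy_subseq hL hP hD
  obtain ⟨N, hN⟩ := hcau (ε / 8) (by positivity)
  -- the tail of the subsequence is close in `L²` to `g`, and `g ^ 2` is integrable
  set g := v (τ N)
  have hmeas : Tendsto (fun n => cellMeasure d L (A (τ n))) atTop (𝓝 0) := by
    have h1 : Tendsto (fun n => (cellMeasure d L).real (A n)) atTop (𝓝 0) :=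
      squeeze_zero (fun n => measureReal_nonneg) hA tendsto_one_div_add_atTop_nhds_zero_nat
    have h2 := (ENNReal.tendsto_ofReal h1).comp hτ.tendsto_atTop
    rw [ENNReal.ofReal_zero] at h2
    refine h2.congr fun n => ?_
    simp [Measure.real, ENNReal.ofReal_toReal]
  have hg := (integrable_fn_sq g).tendsto_setIntegral_nhds_zero hmeas
  obtain ⟨m, hm1, hm2⟩ := ((hg.eventually_lt_const (show 0 < ε / 8 by positivity)).and
    (eventually_ge_atTop N)).exists
  have h1 := hN m hm2 N le_rfl
  have h2 := setIntegral_fn_sq_le (v (τ m) - g) (A (τ m))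
  have h3 : ∫ x in A (τ m), fn (v (τ m)) x ^ 2 ∂(cellMeasure d L) ≤
      ∫ x in A (τ m), (2 * fn (v (τ m) - g) x ^ 2 + 2 * fn g x ^ 2) ∂(cellMeasure d L) := by
    refine integral_mono_ae (integrable_fn_sq _).integrableOn
      (((integrable_fn_sq _).const_mul 2).add ((integrable_fn_sq _).const_mul 2)).integrableOn
      (ae_restrict_of_ae ?_)
    filter_upwards [fn_add_smul (v (τ m)) g (-1)] with x hx
    rw [add_neg_one_smul] at hx
    rw [hx]
    nlinarith [sq_nonneg (fn (v (τ m)) x + -1 * fn g x - fn g x)]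
  rw [integral_add ((integrable_fn_sq _).const_mul 2).integrableOn
    ((integrable_fn_sq _).const_mul 2).integrableOn, integral_const_mul, integral_const_mul] at h3
  have h4 := hint (τ m)
  linarith

theorem firstVariation_uniformState (φ : ℝ) {w : H1L4 d L} (hw : w ∈ meanZero d L) :
    firstVariation (uniformState d L φ) w = 0 := by
  set c := -1 + φ with hc
  have hfn : fn (uniformState d L φ) =ᵐ[cellMeasure d L] fun _ => c := fn_constState c
  have h0 := mem_meanZero_iff.1 hw
  have e1 : gradPairing (uniformState d L φ) w = 0 := by
    refine integral_eq_zero_of_ae ?_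
    filter_upwards [grad_constState (d := d) (L := L) c] with x hx
    rw [uniformState, hx]
    simp
  have e2 : quad (uniformState d L φ) (uniformState d L φ) (uniformState d L φ) w = 0 := by
    have : quad (uniformState d L φ) (uniformState d L φ) (uniformState d L φ) w =
        ∫ x, c ^ 3 * fn w x ∂(cellMeasure d L) := by
      refine integral_congr_ae ?_
      filter_upwards [hfn] with x hx
      rw [hx]
      ring
    rw [this, integral_const_mul, h0, mul_zero]
  rw [firstVariation, e1, e2, uniformState, pairing_const, h0]
  ring

/-- In an `L²` neighbourhood of the uniform state the energy grows quadratically in `L²`. The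
quartic remainder of the energy density is bounded below by `w² / 4` except where `w > 1/4`, a set
of small measure, whose contribution is absorbed by uniform integrability. -/
theorem exists_energy_lower_bound (hL : 0 < L) {φ : ℝ} (hφ : 0 < φ) (hφ' : φ ≤ 1 / 10) :
    ∃ r > 0, ∀ w ∈ meanZero d L, pairing w w ≤ r →
      energy (uniformState d L φ) + 1 / 8 * pairing w w ≤ energy (uniformState d L φ + w) := by
  obtain ⟨δ, hδ, hUI⟩ := exists_measure_setIntegral_sq_le (d := d) hL
    (show (0 : ℝ) < 1 / 16 by norm_num)
  refine ⟨δ / 16, by positivity, fun w hw hr => ?_⟩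
  set c := -1 + φ with hc
  have hfn : fn (uniformState d L φ) =ᵐ[cellMeasure d L] fun _ => c := fn_constState c
  set A := {x | 1 / 4 < fn w x} with hA
  have hAm : MeasurableSet A :=
    measurableSet_lt measurable_const (Lp.stronglyMeasurable w.1.1).measurable
  -- Chebyshev's inequality; this is where `w` has to be small in `L²`
  have hAμ : (cellMeasure d L).real A ≤ δ := by
    have h1 := mul_meas_ge_le_integral_of_nonneg (μ := cellMeasure d L)
      (Eventually.of_forall fun x => sq_nonneg (fn w x)) (integrable_fn_sq w) (1 / 16)
    have h2 : (cellMeasure d L).real A ≤ (cellMeasure d L).real {x | 1 / 16 ≤ fn w x ^ 2} := by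
      refine measureReal_mono fun x hx => ?_
      have : 1 / 4 < fn w x := hx
      change 1 / 16 ≤ fn w x ^ 2
      nlinarith
    rw [integral_fn_sq] at h1
    linarith
  have hA2 := hUI w A hAμ
  have hfirst := firstVariation_uniformState φ hw
  have hrem : 1 / 4 * pairing w w - 2 * ∫ x in A, fn w x ^ 2 ∂(cellMeasure d L) ≤
      3 / 2 * quad (uniformState d L φ) (uniformState d L φ) w w - 1 / 2 * pairing w w +
        quad (uniformState d L φ) w w w + 1 / 4 * quad w w w w := by
    have i1 := (integrable_quad (uniformState d L φ) (uniformState d L φ) w w).const_mul (3 / 2)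
    have i2 := (integrable_fn_mul w w).const_mul (1 / 2)
    have i3 := integrable_quad (uniformState d L φ) w w w
    have i4 := (integrable_quad w w w w).const_mul (1 / 4)
    have i12 := integrable_fun_sub i1 i2
    have i13 := integrable_fun_add i12 i3
    have hI : Integrable (A.indicator fun x => fn w x ^ 2) (cellMeasure d L) :=
      (integrable_fn_sq w).indicator hAm
    have key : ∫ x, (1 / 4 * fn w x ^ 2 - 2 * A.indicator (fun x => fn w x ^ 2) x)
        ∂(cellMeasure d L) ≤ ∫ x, (3 / 2 * (fn (uniformState d L φ) x *
          fn (uniformState d L φ) x * (fn w x * fn w x)) - 1 / 2 * (fn w x * fn w x) +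
          fn (uniformState d L φ) x * fn w x * (fn w x * fn w x) +
          1 / 4 * (fn w x * fn w x * (fn w x * fn w x))) ∂(cellMeasure d L) := by
      refine integral_mono_ae (((integrable_fn_sq w).const_mul _).sub (hI.const_mul 2))
        (integrable_fun_add i13 i4) ?_
      filter_upwards [hfn] with x hx
      rw [hx]
      set s := fn w x
      have hs2 := sq_nonneg s
      have e : 3 / 2 * (c * c * (s * s)) - 1 / 2 * (s * s) + c * s * (s * s) +
          1 / 4 * (s * s * (s * s)) = s ^ 2 * ((3 * c ^ 2 - 1) / 2 + c * s + s ^ 2 / 4) := by ring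
      rw [e]
      by_cases hx : x ∈ A
      · rw [indicator_of_mem hx]
        have : 1 / 4 - 2 ≤ (3 * c ^ 2 - 1) / 2 + c * s + s ^ 2 / 4 := by
          nlinarith [sq_nonneg (c + s / 2), sq_nonneg c]
        nlinarith
      · rw [indicator_of_notMem hx]
        have hs : s ≤ 1 / 4 := not_lt.1 hx
        have : 1 / 4 ≤ (3 * c ^ 2 - 1) / 2 + c * s + s ^ 2 / 4 := by
          have h1 : c * (1 / 4) ≤ c * s := mul_le_mul_of_nonpos_left hs (by linarith)
          nlinarith
        nlinarith
    rw [integral_sub ((integrable_fn_sq w).const_mul _) (hI.const_mul 2), integral_const_mul,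
      integral_const_mul, integral_indicator hAm, integral_fn_sq, integral_add i13 i4,
      integral_add i12 i3, integral_sub i1 i2, integral_const_mul, integral_const_mul,
      integral_const_mul] at key
    exact key
  have he := energy_add_smul (uniformState d L φ) w 1
  rw [one_smul, hfirst] at he
  have := dirichlet_nonneg w
  have := pairing_self_nonneg w
  linarith

/-- Every admissible path crosses a barrier of a fixed height: it has to pass through the sphere
`∫ (u - ū)² = r`, as its endpoint lies below the energy of `ū`. -/
theorem exists_barrier_lower_bound (hL : 0 < L) {φ : ℝ} (hφ : 0 < φ) (hφ' : φ ≤ 1 / 10) :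
    ∃ b > 0, ∀ γ ∈ admissiblePaths d L φ, ∃ t : I,
      energy (uniformState d L φ) + b ≤ energy (γ t) := by
  obtain ⟨r, hr, hbound⟩ := exists_energy_lower_bound (d := d) hL hφ hφ'
  refine ⟨1 / 8 * r, by positivity, fun γ hγ => ?_⟩
  obtain ⟨hX, h0, h1⟩ := hγ
  have hmz : ∀ t, γ t - uniformState d L φ ∈ meanZero d L := fun t =>
    sub_mem_meanZero hL (constState_mem_XSpace hL φ) (hX t)
  set f : I → ℝ := fun t => pairing (γ t - uniformState d L φ) (γ t - uniformState d L φ) with hf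
  have hfc : Continuous f := continuous_pairing_self.comp (γ.continuous.sub continuous_const)
  have hf0 : f 0 = 0 := by
    simp only [hf, h0, sub_self]
    refine le_antisymm ?_ (pairing_self_nonneg _)
    simpa using pairing_self_le (0 : H1L4 d L)
  have hf1 : r ≤ f 1 := by
    by_contra! hlt
    have h := hbound _ (hmz 1) hlt.le
    have := pairing_self_nonneg (γ 1 - uniformState d L φ)
    rw [add_sub_cancel] at h
    linarith
  obtain ⟨t, ht⟩ := intermediate_value_univ 0 1 hfc (show r ∈ Icc (f 0) (f 1) from
    ⟨by rw [hf0]; exact hr.le, hf1⟩)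
  refine ⟨t, ?_⟩
  have h := hbound _ (hmz t) ht.le
  rw [add_sub_cancel] at h
  change pairing (γ t - uniformState d L φ) (γ t - uniformState d L φ) = r at ht
  rwa [ht] at h

end LocalMinimizer

/-! ### The minimax principle -/

section Minimax

variable {d : ℕ} {L : ℝ}

theorem eq_zero_of_convexEnergy_nonpos {u : H1L4 d L} (h : convexEnergy u ≤ 0) : u = 0 := by
  by_contra hne
  have hpos : 0 < ‖u‖ := norm_pos_iff.2 hne
  exact lt_irrefl _ (norm_lt_of_convexEnergy_lt hpos
    (h.trans_lt (lt_min (by positivity) (by positivity))))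

/-- Critical points of the energy on `X_φ` are fixed by the convex splitting step. -/
theorem splitStep_eq_self (hL : 0 < L) {φ : ℝ} {u : H1L4 d L} (huX : u ∈ XSpace d L φ)
    (hu : ∀ w ∈ meanZero d L, firstVariation u w = 0) : splitStep hL φ u = u := by
  have h1 := splitStep_spec hL u huX
  set v := splitStep hL φ u
  have h2 := hu _ (sub_mem_meanZero hL huX (splitStep_mem hL φ u))
  have h3 := convexEnergy_add_smul u (v - u) 1
  have h4 := pairing_add_smul u u (v - u) 1
  rw [add_one_smul_sub] at h3 h4
  have h5 := dirichlet_nonneg (v - u)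
  have h6 := quad_sq_nonneg u (v - u)
  have h7 := quad_sq_nonneg (v - u) (v - u)
  have h8 : -quad u (v - u) (v - u) (v - u) ≤
      quad u u (v - u) (v - u) + 1 / 4 * quad (v - u) (v - u) (v - u) (v - u) := by
    have := quad_mixed_sq_le u (v - u)
    refine abs_le_of_sq_le_sq' ?_ (by positivity) |>.2
    nlinarith [sq_nonneg (quad u u (v - u) (v - u) -
      1 / 4 * quad (v - u) (v - u) (v - u) (v - u))]
  have h9 : convexEnergy (u - v) ≤ 0 := by
    unfold splitEnergy at h1
    change firstVariation u (v - u) = 0 at h2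
    unfold firstVariation at h2
    linarith
  exact (sub_eq_zero.1 (eq_zero_of_convexEnergy_nonpos h9)).symm

/-- The convex splitting step acts on admissible paths. -/
theorem exists_admissible_splitStep (hL : 0 < L) {φ : ℝ} {γ : C(I, H1L4 d L)}
    (hγ : γ ∈ admissiblePaths d L φ) :
    ∃ γ' ∈ admissiblePaths d L φ, ∀ t, γ' t = splitStep hL φ (γ t) := by
  obtain ⟨hX, h0, h1⟩ := hγ
  refine ⟨⟨fun t => splitStep hL φ (γ t), (continuous_splitStep hL φ).comp γ.continuous⟩,
    ⟨fun t => splitStep_mem hL φ (γ t), ?_, ?_⟩, fun t => rfl⟩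
  · change splitStep hL φ (γ 0) = _
    rw [h0]
    exact splitStep_eq_self hL (constState_mem_XSpace hL φ)
      fun w hw => firstVariation_uniformState φ hw
  · have := energy_splitStep_le hL (hX 1)
    have := pairing_self_nonneg (γ 1 - splitStep hL φ (γ 1))
    change energy (splitStep hL φ (γ 1)) < _
    linarith

theorem exists_admissiblePath (hL : 0 < L) {φ : ℝ} {u : H1L4 d L} (hu : u ∈ XSpace d L φ)
    (hlt : energy u < energy (uniformState d L φ)) : (admissiblePaths d L φ).Nonempty := by
  refine ⟨⟨fun t : I => uniformState d L φ + (t : ℝ) • (u - uniformState d L φ), by fun_prop⟩,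
    fun t => add_smul_sub_mem_XSpace hL (constState_mem_XSpace hL φ) hu t, ?_, ?_⟩
  · simp
  · simpa using hlt

theorem exists_max_energy (γ : C(I, H1L4 d L)) : ∃ t, ∀ s, energy (γ s) ≤ energy (γ t) := by
  obtain ⟨t, -, ht⟩ := isCompact_univ.exists_isMaxOn univ_nonempty
    (continuous_energy.comp γ.continuous).continuousOn
  exact ⟨t, fun s => ht (mem_univ s)⟩

/-- The energy barrier is finite and positive as soon as there is an admissible path; here `c` is
the minimax level. -/
theorem exists_minimax_level (hL : 0 < L) {φ : ℝ} (hφ : 0 < φ) (hφ' : φ ≤ 1 / 10)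
    (hne : (admissiblePaths d L φ).Nonempty) :
    ∃ c : ℝ, energy (uniformState d L φ) < c ∧
      energyBarrier d L φ = ((c - energy (uniformState d L φ) : ℝ) : EReal) ∧
      (∀ γ ∈ admissiblePaths d L φ, ∃ t, c ≤ energy (γ t)) ∧
      ∀ ε > 0, ∃ γ ∈ admissiblePaths d L φ, ∀ t, energy (γ t) < c + ε := by
  set e := energy (uniformState d L φ) with he
  obtain ⟨b, hb, hbar⟩ := exists_barrier_lower_bound (d := d) hL hφ hφ'
  have hlow : (b : EReal) ≤ energyBarrier d L φ := by
    refine le_iInf₂ fun γ hγ => ?_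
    obtain ⟨t, ht⟩ := hbar γ hγ
    refine le_trans ?_ (le_iSup _ t)
    exact EReal.coe_le_coe_iff.2 (by linarith)
  have hup : ∀ γ ∈ admissiblePaths d L φ, ∃ t,
      energyBarrier d L φ ≤ ((energy (γ t) - e : ℝ) : EReal) := by
    intro γ hγ
    obtain ⟨t, ht⟩ := exists_max_energy γ
    refine ⟨t, (iInf₂_le γ hγ).trans (iSup_le fun s => ?_)⟩
    exact EReal.coe_le_coe_iff.2 (by linarith [ht s])
  obtain ⟨γ₀, hγ₀⟩ := hne
  obtain ⟨t₀, ht₀⟩ := hup γ₀ hγ₀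
  have htop : energyBarrier d L φ ≠ ⊤ := ne_top_of_le_ne_top (EReal.coe_ne_top _) ht₀
  have hbot : energyBarrier d L φ ≠ ⊥ := ne_bot_of_le_ne_bot (EReal.coe_ne_bot _) hlow
  obtain ⟨β, hβ⟩ : ∃ β : ℝ, energyBarrier d L φ = (β : EReal) :=
    ⟨_, (EReal.coe_toReal htop hbot).symm⟩
  rw [hβ] at hlow hup
  have hbβ : b ≤ β := EReal.coe_le_coe_iff.1 hlow
  refine ⟨e + β, by linarith, by rw [hβ, add_sub_cancel_left], fun γ hγ => ?_, fun ε hε => ?_⟩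
  · obtain ⟨t, ht⟩ := hup γ hγ
    exact ⟨t, by linarith [EReal.coe_le_coe_iff.1 ht]⟩
  · have hlt : energyBarrier d L φ < ((β + ε : ℝ) : EReal) := by
      rw [hβ]
      exact EReal.coe_lt_coe_iff.2 (by linarith)
    rw [energyBarrier, iInf_lt_iff] at hlt
    obtain ⟨γ, hlt⟩ := hlt
    rw [iInf_lt_iff] at hlt
    obtain ⟨hγ, hlt⟩ := hlt
    refine ⟨γ, hγ, fun t => ?_⟩
    have h := EReal.coe_lt_coe_iff.1 ((le_iSup (fun t : I =>
      ((energy (γ t) - energy (uniformState d L φ) : ℝ) : EReal)) t).trans_lt hlt)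
    linarith

/-- A path that climbs to the level `c` from below first meets it at a point of the closure of the
sublevel set. -/
theorem exists_first_hit {φ c : ℝ} {γ : C(I, H1L4 d L)} (hX : ∀ t, γ t ∈ XSpace d L φ)
    (h0 : energy (γ 0) < c) (h1 : ∃ t, c ≤ energy (γ t)) :
    ∃ t, energy (γ t) = c ∧ γ t ∈ closure {v | v ∈ XSpace d L φ ∧ energy v < c} := by
  have hc : Continuous fun t => energy (γ t) := continuous_energy.comp γ.continuous
  have hcl : IsClosed {t | c ≤ energy (γ t)} := isClosed_le continuous_const hc
  obtain ⟨t, ht, hmin⟩ := hcl.isCompact.exists_isLeast h1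
  have hlt : ∀ s < t, energy (γ s) < c := fun s hs => by
    by_contra! h
    exact absurd (hmin h) (not_le.2 hs)
  have ht0 : 0 < t := by
    refine lt_of_le_of_ne t.2.1 fun h => ?_
    have : c ≤ energy (γ t) := ht
    rw [← show (0 : I) = t from h] at this
    linarith
  have hmem : t ∈ closure (Iio t) := by
    rw [closure_Iio' (show (Iio t).Nonempty from ⟨0, ht0⟩)]
    exact self_mem_Iic
  refine ⟨t, le_antisymm ?_ ht, ?_⟩
  · exact (isClosed_le hc continuous_const).closure_subset_iff.2
      (fun s hs => (hlt s hs).le) hmem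
  · exact map_mem_closure γ.continuous hmem fun s hs => ⟨hX s, hlt s hs⟩

theorem dirichlet_le_of_energy_le {u : H1L4 d L} {M : ℝ} (h : energy u ≤ M) :
    dirichlet u ≤ 2 * M := by
  have := pairing_self_le_quad u
  rw [energy_eq] at h
  linarith

theorem pairing_le_of_energy_le {u : H1L4 d L} {M : ℝ} (h : energy u ≤ M) :
    pairing u u ≤ (cellMeasure d L).real univ + 1 + 4 * (cellMeasure d L).real univ * M := by
  have h0 : 0 ≤ (cellMeasure d L).real univ := measureReal_nonneg
  have h1 := pairing_self_sq_le u
  have h2 := dirichlet_nonneg u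
  rw [energy_eq] at h
  have h3 := mul_le_mul_of_nonneg_left h h0
  nlinarith [sq_nonneg (pairing u u - (cellMeasure d L).real univ - 1 / 2), mul_nonneg h0 h2]

theorem pairing_self_sub_le (u v w : H1L4 d L) : pairing (u - w) (u - w) ≤
    2 * pairing (u - v) (u - v) + 2 * pairing (v - w) (v - w) := by
  have h1 := pairing_self_add_smul (u - v) (v - w) 1
  have h2 := pairing_self_nonneg ((u - v) + (-1 : ℝ) • (v - w))
  rw [pairing_self_add_smul] at h2
  rw [one_smul, sub_add_sub_cancel] at h1
  linarith

/-- At the minimax level there is a fixed point of the convex splitting step in the closure of the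
sublevel set: apply the step to nearly optimal paths, and look where the new paths first meet the
level. There the step hardly moves, and compactness provides a limit. -/
theorem exists_fixed_point_at_level (hL : 0 < L) {φ c : ℝ}
    (hc : energy (uniformState d L φ) < c)
    (hpath : ∀ γ ∈ admissiblePaths d L φ, ∃ t, c ≤ energy (γ t))
    (hopt : ∀ ε > 0, ∃ γ ∈ admissiblePaths d L φ, ∀ t, energy (γ t) < c + ε) :
    ∃ u ∈ XSpace d L φ, energy u = c ∧ splitStep hL φ u = u ∧
      u ∈ closure {v | v ∈ XSpace d L φ ∧ energy v < c} := by
  have hseq : ∀ n : ℕ, ∃ x ∈ XSpace d L φ, energy x < c + 1 / ((n : ℝ) + 1) ∧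
      energy (splitStep hL φ x) = c ∧
      splitStep hL φ x ∈ closure {v | v ∈ XSpace d L φ ∧ energy v < c} := by
    intro n
    obtain ⟨γ, hγ, hlt⟩ := hopt (1 / ((n : ℝ) + 1)) (by positivity)
    obtain ⟨γ', hγ', hT⟩ := exists_admissible_splitStep hL hγ
    obtain ⟨t, ht1, ht2⟩ := exists_first_hit hγ'.1 (by rw [hγ'.2.1]; exact hc) (hpath γ' hγ')
    rw [hT] at ht1 ht2
    exact ⟨γ t, hγ.1 t, hlt t, ht1, ht2⟩
  choose x hxX hxlt hy hycl using hseq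
  have hle : ∀ n, energy (x n) ≤ c + 1 := fun n => by
    have : 1 / ((n : ℝ) + 1) ≤ 1 := by
      rw [div_le_one (by positivity)]
      linarith [(Nat.cast_nonneg n : (0 : ℝ) ≤ n)]
    linarith [hxlt n]
  set C := max (2 * (c + 1)) ((cellMeasure d L).real univ + 1 +
    4 * (cellMeasure d L).real univ * (c + 1))
  obtain ⟨τ, hτ, hcau⟩ := exists_cauchy_subseq hL (C := C) (u := x)
    (fun n => (pairing_le_of_energy_le (hle n)).trans (le_max_right _ _))
    (fun n => (dirichlet_le_of_energy_le (hle n)).trans (le_max_left _ _))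
  set y : ℕ → H1L4 d L := fun n => splitStep hL φ (x (τ n)) with hydef
  have hycau : CauchySeq y := by
    rw [cauchySeq_iff_tendsto_dist_atTop_0]
    have h : Tendsto (fun p : ℕ × ℕ => pairing (x (τ p.1) - x (τ p.2)) (x (τ p.1) - x (τ p.2)))
        atTop (𝓝 0) := by
      rw [Metric.tendsto_nhds]
      intro ε hε
      obtain ⟨N, hN⟩ := hcau ε hε
      filter_upwards [eventually_ge_atTop (N, N)] with p hp
      rw [Real.dist_eq, sub_zero, abs_of_nonneg (pairing_self_nonneg _)]
      exact hN p.1 hp.1 p.2 hp.2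
    have h' := tendsto_norm_splitStep_sub hL φ h
    exact h'.congr fun p => (dist_eq_norm _ _).symm
  obtain ⟨u, hu⟩ := cauchySeq_tendsto_of_complete hycau
  -- the energy drops by at most `1 / (n + 1)` under the step, which bounds the distance of the step
  have hxy : Tendsto (fun n => pairing (x (τ n) - y n) (x (τ n) - y n)) atTop (𝓝 0) := by
    have h1 : Tendsto (fun n : ℕ => 2 * (1 / ((n : ℝ) + 1))) atTop (𝓝 0) := by
      simpa using (tendsto_one_div_add_atTop_nhds_zero_nat (𝕜 := ℝ)).const_mul 2
    refine squeeze_zero (fun n => pairing_self_nonneg _) (fun n => ?_)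
      (h1.comp hτ.tendsto_atTop)
    have h2 := energy_splitStep_le hL (hxX (τ n))
    have h3 := hxlt (τ n)
    rw [hy] at h2
    simp only [hydef, Function.comp]
    linarith
  have hyu : Tendsto (fun n => pairing (y n - u) (y n - u)) atTop (𝓝 0) := by
    have hcont : Continuous fun v : H1L4 d L => pairing (v - u) (v - u) :=
      continuous_pairing_self.comp (continuous_id.sub continuous_const)
    have h := (hcont.tendsto u).comp hu
    have h0 : pairing (u - u) (u - u) = 0 := by
      refine le_antisymm ?_ (pairing_self_nonneg _)
      simpa using pairing_self_le (u - u)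
    rwa [h0] at h
  have hxu : Tendsto (fun n => pairing (x (τ n) - u) (x (τ n) - u)) atTop (𝓝 0) := by
    have h := (hxy.const_mul 2).add (hyu.const_mul 2)
    rw [mul_zero, add_zero] at h
    exact squeeze_zero (fun n => pairing_self_nonneg _)
      (fun n => pairing_self_sub_le _ (y n) _) h
  have hT : Tendsto y atTop (𝓝 (splitStep hL φ u)) := by
    rw [tendsto_iff_norm_sub_tendsto_zero]
    exact tendsto_norm_splitStep_sub hL φ (g := fun _ => u) hxu
  refine ⟨u, ?_, ?_, tendsto_nhds_unique hT hu, ?_⟩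
  · exact (isClosed_XSpace hL φ).mem_of_tendsto hu
      (Eventually.of_forall fun n => splitStep_mem hL φ _)
  · have h := (continuous_energy.tendsto u).comp hu
    exact tendsto_nhds_unique h (tendsto_const_nhds.congr fun n => (hy (τ n)).symm)
  · exact isClosed_closure.mem_of_tendsto hu (Eventually.of_forall fun n => hycl (τ n))

/-- The only constant function in `X_φ` is the uniform state; its gradient vanishes because its
Fourier coefficients do. -/
theorem eq_uniformState_of_ae_eq_const (hL : 0 < L) {φ c : ℝ} {u : H1L4 d L}
    (hu : u ∈ XSpace d L φ) (hc : fn u =ᵐ[cellMeasure d L] fun _ => c) :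
    u = uniformState d L φ := by
  have hLd : (0 : ℝ) < L ^ d := by positivity
  have hcφ : c = -1 + φ := by
    rw [mem_XSpace_iff hL, integral_congr_ae hc, integral_const, measureReal_cell hL,
      smul_eq_mul, mul_comm] at hu
    exact mul_right_cancel₀ hLd.ne' hu
  have hw : fn (u - uniformState d L φ) =ᵐ[cellMeasure d L] fun _ => 0 := by
    have h := fn_add_smul u (uniformState d L φ) (-1)
    rw [add_neg_one_smul] at h
    filter_upwards [h, hc, fn_constState (d := d) (L := L) (-1 + φ)] with x h1 h2 h3
    rw [h1, h2, uniformState, h3, hcφ]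
    ring
  set w := u - uniformState d L φ
  have hcos : ∀ k, cosCoeff L (fn w) k = 0 := fun k => by
    refine integral_eq_zero_of_ae ?_
    filter_upwards [hw] with x hx
    rw [hx, zero_mul, Pi.zero_apply]
  have hsin : ∀ k, sinCoeff L (fn w) k = 0 := fun k => by
    refine integral_eq_zero_of_ae ?_
    filter_upwards [hw] with x hx
    rw [hx, zero_mul, Pi.zero_apply]
  have hD := hasSum_dirichlet hL w
  simp only [hcos, hsin, ne_eq, OfNat.ofNat_ne_zero, not_false_eq_true, zero_pow, add_zero,
    mul_zero] at hD
  have hD0 : dirichlet w = 0 :=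
    (mul_eq_zero.1 (hD.unique hasSum_zero)).resolve_left hLd.ne'
  have hQ : quad w w w w = 0 := by
    refine integral_eq_zero_of_ae ?_
    filter_upwards [hw] with x hx
    rw [hx, Pi.zero_apply]
    ring
  refine sub_eq_zero.1 (eq_zero_of_convexEnergy_nonpos ?_)
  change convexEnergy w ≤ 0
  rw [convexEnergy, hD0, hQ]
  simp

/-- The mountain pass argument: a state of lower energy than the uniform state provides a saddle
point at the height of the barrier. -/
theorem hasBarrierSaddle_of_exists_lower (hd : 0 < d) (hL : 0 < L) {φ : ℝ} (hφ : 0 < φ)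
    (hφ' : φ ≤ 1 / 10)
    (hlow : ∃ v ∈ XSpace d L φ, energy v < energy (uniformState d L φ)) :
    HasBarrierSaddle d L φ := by
  obtain ⟨v, hvX, hv⟩ := hlow
  obtain ⟨c, hc, hbar, hpath, hopt⟩ :=
    exists_minimax_level hL hφ hφ' (exists_admissiblePath hL hvX hv)
  obtain ⟨u, huX, huc, hfix, hcl⟩ := exists_fixed_point_at_level hL hc hpath hopt
  have hcrit : ∀ w ∈ meanZero d L, firstVariation u w = 0 := fun w hw =>
    firstVariation_eq_zero hL hfix hw
  refine ⟨u, huX, ?_, ?_, exists_isWeakSolution hL hcrit, ?_⟩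
  · rintro ⟨k, hk⟩
    rw [eq_uniformState_of_ae_eq_const hL huX hk] at huc
    linarith
  · rw [← huc] at hcl
    exact isConstrainedSaddlePoint_of_mem_closure hd hL huX hcrit hcl
  · rw [hbar, huc, ← EReal.coe_add]
    congr 1
    ring

end Minimax

/-! ### The one-dimensional transition profile -/

section Profile

theorem hasDerivAt_max_zero_sq (x : ℝ) :
    HasDerivAt (fun x : ℝ => max x 0 ^ 2) (2 * max x 0) x := by
  rcases lt_trichotomy x 0 with hx | rfl | hx
  · rw [max_eq_right hx.le, mul_zero]
    refine (hasDerivAt_const x (0 : ℝ)).congr_of_eventuallyEq ?_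
    filter_upwards [Iio_mem_nhds hx] with y hy
    rw [max_eq_right (le_of_lt hy), zero_pow two_ne_zero]
  · have h : (fun x : ℝ => max x 0 ^ 2) =O[𝓝 0] fun x => ‖x - 0‖ ^ 2 := by
      refine Asymptotics.IsBigO.of_bound 1 (Eventually.of_forall fun y => ?_)
      rw [sub_zero, one_mul, norm_pow, norm_pow, norm_norm, Real.norm_eq_abs, Real.norm_eq_abs]
      refine pow_le_pow_left₀ (abs_nonneg _) ?_ 2
      rw [abs_of_nonneg (le_max_right _ _)]
      exact max_le (le_abs_self y) (abs_nonneg y)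
    have h' := Asymptotics.IsBigO.hasFDerivAt (𝕜 := ℝ) h one_lt_two
    simpa using h'.hasDerivAt
  · rw [max_eq_left hx.le]
    have h := hasDerivAt_pow 2 x
    refine (by simpa using h : HasDerivAt (fun x : ℝ => x ^ 2) (2 * x) x).congr_of_eventuallyEq ?_
    filter_upwards [Ioi_mem_nhds hx] with y hy
    rw [max_eq_left (le_of_lt hy)]

/-- A continuously differentiable version of the truncation `max (-1) (min 1 y)`, which differs
from it where `||y| - 1| < η`. -/
def softClip (η y : ℝ) : ℝ :=
  y - (max (y - (1 - η)) 0 ^ 2 - max (y - (1 + η)) 0 ^ 2) / (4 * η) +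
    (max (-y - (1 - η)) 0 ^ 2 - max (-y - (1 + η)) 0 ^ 2) / (4 * η)

/-- The derivative of `softClip η`. -/
def softClipDeriv (η y : ℝ) : ℝ :=
  1 - (max (y - (1 - η)) 0 - max (y - (1 + η)) 0) / (2 * η) -
    (max (-y - (1 - η)) 0 - max (-y - (1 + η)) 0) / (2 * η)

variable {η y : ℝ}

theorem hasDerivAt_softClip (hη : 0 < η) (y : ℝ) :
    HasDerivAt (softClip η) (softClipDeriv η y) y := by
  have h1 : ∀ c : ℝ, HasDerivAt (fun y : ℝ => max (y - c) 0 ^ 2) (2 * max (y - c) 0) y := fun c =>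
    (hasDerivAt_max_zero_sq (y - c)).comp_sub_const y c
  have h2 : ∀ c : ℝ, HasDerivAt (fun y : ℝ => max (-y - c) 0 ^ 2) (-(2 * max (-y - c) 0)) y :=
    fun c => by
      have h := (hasDerivAt_max_zero_sq (-y - c)).comp y ((hasDerivAt_neg y).sub_const c)
      rw [mul_neg_one] at h
      exact h
  have h := ((hasDerivAt_id y).fun_sub (((h1 (1 - η)).fun_sub (h1 (1 + η))).div_const
    (4 * η))).fun_add (((h2 (1 - η)).fun_sub (h2 (1 + η))).div_const (4 * η))
  refine h.congr_deriv ?_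
  unfold softClipDeriv
  field_simp
  ring

theorem continuous_softClipDeriv : Continuous (softClipDeriv η) := by
  unfold softClipDeriv
  fun_prop

theorem softClip_neg (η y : ℝ) : softClip η (-y) = -softClip η y := by
  unfold softClip
  rw [neg_neg]
  ring

theorem softClipDeriv_neg (η y : ℝ) : softClipDeriv η (-y) = softClipDeriv η y := by
  unfold softClipDeriv
  rw [neg_neg]
  ring

theorem softClip_of_ge (hη : 0 < η) (hη' : η ≤ 1 / 2) (hy : 1 + η ≤ y) :
    softClip η y = 1 ∧ softClipDeriv η y = 0 := by
  unfold softClip softClipDeriv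
  rw [max_eq_left (by linarith), max_eq_left (by linarith), max_eq_right (by linarith),
    max_eq_right (by linarith)]
  constructor
  · field_simp
    ring
  · field_simp
    ring

theorem softClip_bounds_of_nonneg (hη : 0 < η) (hη' : η ≤ 1 / 2) (hy : 0 ≤ y) :
    (0 ≤ softClip η y ∧ softClip η y ≤ 1) ∧ (0 ≤ softClipDeriv η y ∧ softClipDeriv η y ≤ 1) ∧
      (y ≤ 1 + 2 * η → y ≤ (1 + 2 * η) * softClip η y) := by
  rcases le_total (1 + η) y with h | h
  · obtain ⟨h1, h2⟩ := softClip_of_ge hη hη' h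
    rw [h1, h2]
    refine ⟨by norm_num, by norm_num, fun h => by linarith⟩
  · have e3 : max (-y - (1 - η)) 0 = 0 := max_eq_right (by linarith)
    have e4 : max (-y - (1 + η)) 0 = 0 := max_eq_right (by linarith)
    have e2 : max (y - (1 + η)) 0 = 0 := max_eq_right (by linarith)
    rcases le_total y (1 - η) with h' | h'
    · have e1 : max (y - (1 - η)) 0 = 0 := max_eq_right (by linarith)
      have c1 : softClip η y = y := by
        unfold softClip
        rw [e1, e2, e3, e4]
        ring
      have c2 : softClipDeriv η y = 1 := by
        unfold softClipDeriv
        rw [e1, e2, e3, e4]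
        ring
      rw [c1, c2]
      refine ⟨⟨hy, by linarith⟩, by norm_num, fun _ => by nlinarith⟩
    · have e1 : max (y - (1 - η)) 0 = y - (1 - η) := max_eq_left (by linarith)
      obtain ⟨τ, rfl⟩ : ∃ τ, y = 1 - η + τ := ⟨y - (1 - η), by ring⟩
      have hτ0 : 0 ≤ τ := by linarith
      have hτ1 : τ ≤ 2 * η := by linarith
      have c1 : softClip η (1 - η + τ) = 1 - η + τ - τ ^ 2 / (4 * η) := by
        unfold softClip
        rw [e1, e2, e3, e4]
        ring
      have c2 : softClipDeriv η (1 - η + τ) = 1 - τ / (2 * η) := by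
        unfold softClipDeriv
        rw [e1, e2, e3, e4]
        ring
      have hq : τ ^ 2 / (4 * η) ≤ τ / 2 := by
        rw [div_le_div_iff₀ (by positivity) (by norm_num)]
        nlinarith
      have hq' : τ - η ≤ τ ^ 2 / (4 * η) := by
        rw [le_div_iff₀ (by positivity)]
        nlinarith [sq_nonneg (τ - 2 * η)]
      have hr0 : 0 ≤ τ / (2 * η) := by positivity
      have hr1 : τ / (2 * η) ≤ 1 := by
        rw [div_le_one (by positivity)]
        exact hτ1
      rw [c1, c2]
      refine ⟨⟨by linarith, by linarith⟩, ⟨by linarith, by linarith⟩, fun _ => ?_⟩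
      nlinarith

theorem softClip_bounds (hη : 0 < η) (hη' : η ≤ 1 / 2) (y : ℝ) :
    |softClip η y| ≤ 1 ∧ (0 ≤ softClipDeriv η y ∧ softClipDeriv η y ≤ 1) ∧
      (|y| ≤ 1 + 2 * η → |y| ≤ (1 + 2 * η) * |softClip η y|) := by
  rcases le_total 0 y with hy | hy
  · obtain ⟨⟨h1, h2⟩, h3, h4⟩ := softClip_bounds_of_nonneg hη hη' hy
    rw [abs_of_nonneg h1, abs_of_nonneg hy]
    exact ⟨h2, h3, h4⟩
  · obtain ⟨⟨h1, h2⟩, h3, h4⟩ := softClip_bounds_of_nonneg hη hη' (neg_nonneg.2 hy)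
    rw [← abs_neg y, ← abs_neg (softClip η y), ← softClip_neg, ← softClipDeriv_neg,
      abs_of_nonneg h1, abs_of_nonneg (neg_nonneg.2 hy)]
    exact ⟨h2, h3, h4⟩

/-- The optimal profile `tanh (t / √2)`, which solves `p' = (1 - p²) / √2`. -/
def kink (t : ℝ) : ℝ := (Real.exp (√2 * t) - 1) / (Real.exp (√2 * t) + 1)

theorem hasDerivAt_kink (t : ℝ) : HasDerivAt kink ((1 - kink t ^ 2) / √2) t := by
  have hpos := Real.exp_pos (√2 * t)
  have h1 : HasDerivAt (fun t : ℝ => Real.exp (√2 * t)) (Real.exp (√2 * t) * √2) t := by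
    simpa using ((hasDerivAt_id t).const_mul √2).exp
  have h := (h1.sub_const 1).fun_div (h1.add_const 1) (by positivity)
  refine h.congr_deriv ?_
  unfold kink
  have h2 : (0 : ℝ) < √2 := by positivity
  have h3 : √2 ^ 2 = 2 := Real.sq_sqrt (by norm_num)
  field_simp
  rw [h3]
  ring

theorem continuous_kink : Continuous kink :=
  continuous_iff_continuousAt.2 fun t => (hasDerivAt_kink t).continuousAt

theorem kink_sq_lt_one (t : ℝ) : kink t ^ 2 < 1 := by
  have hpos := Real.exp_pos (√2 * t)
  unfold kink
  rw [div_pow, div_lt_one (by positivity)]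
  nlinarith

theorem kink_neg (t : ℝ) : kink (-t) = -kink t := by
  have hpos := Real.exp_pos (√2 * t)
  unfold kink
  rw [mul_neg, Real.exp_neg]
  field_simp
  ring

theorem exists_le_kink {c : ℝ} (hc : c < 1) : ∃ W > 0, ∀ t ≥ W, c ≤ kink t := by
  have h2 : (0 : ℝ) < √2 := by positivity
  have hlim : Tendsto (fun t : ℝ => Real.exp (√2 * t)) atTop atTop :=
    Real.tendsto_exp_atTop.comp (tendsto_id.const_mul_atTop h2)
  obtain ⟨W, hW⟩ := eventually_atTop.1 (hlim.eventually_ge_atTop ((1 + c) / (1 - c)))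
  refine ⟨max W 1, by positivity, fun t ht => ?_⟩
  have h := hW t ((le_max_left _ _).trans ht)
  have hpos := Real.exp_pos (√2 * t)
  rw [div_le_iff₀ (by linarith)] at h
  unfold kink
  rw [le_div_iff₀ (by positivity)]
  linarith

theorem transitionCost_eq : transitionCost = 2 * (2 / 3) / √2 := by
  have h : ∀ s ∈ uIcc (-1 : ℝ) 1, √(2 * doubleWell s) = (1 - s ^ 2) / √2 := by
    intro s hs
    rw [uIcc_of_le (by norm_num)] at hs
    have h1 : 0 ≤ 1 - s ^ 2 := by nlinarith [hs.1, hs.2]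
    rw [Real.sqrt_eq_iff_mul_self_eq (by unfold doubleWell; positivity) (by positivity)]
    have h3 : √2 * √2 = 2 := Real.mul_self_sqrt (by norm_num)
    rw [div_mul_div_comm, h3, doubleWell]
    ring
  rw [transitionCost, intervalIntegral.integral_congr h, intervalIntegral.integral_div]
  congr 1
  rw [intervalIntegral.integral_sub (by simp) (by simp), integral_pow]
  norm_num

theorem integral_kink_le (W : ℝ) :
    ∫ t in (-W)..W, (1 - kink t ^ 2) ^ 2 / 2 ≤ transitionCost := by
  have h2 : (0 : ℝ) < √2 := by positivity
  have h3 : √2 * √2 = 2 := Real.mul_self_sqrt (by norm_num)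
  have hd : ∀ t, HasDerivAt (fun t => (kink t - kink t ^ 3 / 3) / √2)
      ((1 - kink t ^ 2) ^ 2 / 2) t := by
    intro t
    have h := (hasDerivAt_kink t)
    have h' := (h.fun_sub ((h.fun_pow 3).div_const 3)).div_const √2
    refine h'.congr_deriv ?_
    have h4 : √2 ^ 2 = 2 := by rw [sq, h3]
    field_simp
    rw [h4]
    push_cast
    ring
  have hc := continuous_kink
  rw [intervalIntegral.integral_eq_sub_of_hasDerivAt (fun t _ => hd t)
    (Continuous.intervalIntegrable (by fun_prop) _ _), kink_neg, transitionCost_eq,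
    ← sub_div]
  refine div_le_div_of_nonneg_right ?_ h2.le
  have h1 := kink_sq_lt_one W
  have hle : kink W ≤ 1 := (abs_le_of_sq_le_sq' (by linarith) zero_le_one).2
  have hge : -1 ≤ kink W := (abs_le_of_sq_le_sq' (by linarith) zero_le_one).1
  nlinarith [mul_nonneg (sq_nonneg (1 - kink W)) (show 0 ≤ kink W + 2 by linarith)]

/-- There are compactly supported transitions from `1` to `-1` of almost optimal cost. They are
obtained by truncating a slightly amplified optimal profile. -/
theorem exists_profile {δ : ℝ} (hδ : 0 < δ) (hδ' : δ ≤ 1) :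
    ∃ (q q' : ℝ → ℝ) (W : ℝ), 0 < W ∧ (∀ t, HasDerivAt q (q' t) t) ∧ Continuous q' ∧
      (∀ t, |q t| ≤ 1) ∧ (∀ t ≤ -W, q t = 1) ∧ (∀ t ≥ W, q t = -1) ∧
      (∀ t, W ≤ |t| → q' t = 0) ∧
      ∫ t in (-W)..W, (1 / 2 * q' t ^ 2 + doubleWell (q t)) ≤ (1 + δ) ^ 2 * transitionCost := by
  set η := δ / 2 with hη
  have hη0 : 0 < η := by positivity
  have hη1 : η ≤ 1 / 2 := by linarith
  have hδη : 1 + δ = 1 + 2 * η := by rw [hη]; ring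
  obtain ⟨W, hW, hWk⟩ := exists_le_kink (c := (1 + η) / (1 + 2 * η))
    (by rw [div_lt_one (by positivity)]; linarith)
  have hbig : ∀ t ≥ W, 1 + η ≤ (1 + δ) * kink t := fun t ht => by
    have h := hWk t ht
    rw [div_le_iff₀ (by positivity)] at h
    rw [hδη]
    linarith
  have hpos : ∀ t ≥ W, softClip η ((1 + δ) * kink t) = 1 ∧
      softClipDeriv η ((1 + δ) * kink t) = 0 := fun t ht => softClip_of_ge hη0 hη1 (hbig t ht)
  have hneg : ∀ t ≤ -W, softClip η ((1 + δ) * kink t) = -1 ∧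
      softClipDeriv η ((1 + δ) * kink t) = 0 := fun t ht => by
    have h := hpos (-t) (by linarith)
    rw [kink_neg, mul_neg, softClip_neg, softClipDeriv_neg] at h
    exact ⟨by linarith [h.1], h.2⟩
  set q : ℝ → ℝ := fun t => -softClip η ((1 + δ) * kink t) with hq
  set q' : ℝ → ℝ := fun t =>
    -(softClipDeriv η ((1 + δ) * kink t) * ((1 + δ) * ((1 - kink t ^ 2) / √2))) with hq'
  have hqd : ∀ t, HasDerivAt q (q' t) t := fun t =>
    ((hasDerivAt_softClip hη0 _).comp t ((hasDerivAt_kink t).const_mul (1 + δ))).neg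
  have hkc := continuous_kink
  have hq'c : Continuous q' := by
    have := continuous_softClipDeriv (η := η)
    fun_prop
  have hqc : Continuous q := continuous_iff_continuousAt.2 fun t => (hqd t).continuousAt
  refine ⟨q, q', W, hW, hqd, hq'c, fun t => ?_, fun t ht => ?_, fun t ht => ?_, fun t ht => ?_, ?_⟩
  · simp only [hq, abs_neg]
    exact (softClip_bounds hη0 hη1 _).1
  · simp only [hq, (hneg t ht).1, neg_neg]
  · simp only [hq, (hpos t ht).1]
  · rcases le_abs.1 ht with h | h
    · simp only [hq', (hpos t h).2, zero_mul, neg_zero]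
    · simp only [hq', (hneg t (by linarith)).2, zero_mul, neg_zero]
  -- the truncation has slope at most one, and after amplification it does not lower the modulus
  · have hle : ∀ t, 1 / 2 * q' t ^ 2 + doubleWell (q t) ≤
        (1 + δ) ^ 2 * ((1 - kink t ^ 2) ^ 2 / 2) := by
      intro t
      obtain ⟨h1, ⟨h2, h3⟩, h4⟩ := softClip_bounds hη0 hη1 ((1 + δ) * kink t)
      have hk := kink_sq_lt_one t
      have hk1 : |kink t| ≤ 1 := abs_le_of_sq_le_sq (by linarith) zero_le_one
      have h5 : |kink t| ≤ |softClip η ((1 + δ) * kink t)| := by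
        have h6 := h4 (by
          rw [abs_mul, abs_of_pos (by positivity), ← hδη]
          nlinarith)
        rw [abs_mul, abs_of_pos (by positivity), ← hδη] at h6
        exact le_of_mul_le_mul_left h6 (by positivity)
      have h7 : kink t ^ 2 ≤ q t ^ 2 := by
        simp only [hq, neg_sq]
        exact sq_le_sq.2 h5
      have h8 : q t ^ 2 ≤ 1 := by
        simp only [hq, neg_sq]
        exact (sq_le_one_iff_abs_le_one _).2 h1
      have h9 : doubleWell (q t) ≤ (1 - kink t ^ 2) ^ 2 / 4 := by
        unfold doubleWell
        exact div_le_div_of_nonneg_right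
          (pow_le_pow_left₀ (by linarith) (by linarith) 2) (by norm_num)
      have h10 : q' t ^ 2 ≤ (1 + δ) ^ 2 * ((1 - kink t ^ 2) ^ 2 / 2) := by
        simp only [hq']
        rw [neg_sq, mul_pow, mul_pow, div_pow, Real.sq_sqrt (by norm_num)]
        refine mul_le_of_le_one_left (by positivity) (pow_le_one₀ h2 h3)
      have h11 : (1 - kink t ^ 2) ^ 2 / 4 ≤ (1 + δ) ^ 2 * ((1 - kink t ^ 2) ^ 2 / 4) :=
        le_mul_of_one_le_left (by positivity) (one_le_pow₀ (by linarith))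
      linarith
    have hdw : Continuous doubleWell := by
      unfold doubleWell
      fun_prop
    calc ∫ t in (-W)..W, (1 / 2 * q' t ^ 2 + doubleWell (q t))
        ≤ ∫ t in (-W)..W, (1 + δ) ^ 2 * ((1 - kink t ^ 2) ^ 2 / 2) :=
          intervalIntegral.integral_mono_on (by linarith)
            (Continuous.intervalIntegrable (by fun_prop) _ _)
            (Continuous.intervalIntegrable (by fun_prop) _ _) fun t _ => hle t
      _ = (1 + δ) ^ 2 * ∫ t in (-W)..W, (1 - kink t ^ 2) ^ 2 / 2 :=
          intervalIntegral.integral_const_mul _ _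
      _ ≤ (1 + δ) ^ 2 * transitionCost :=
          mul_le_mul_of_nonneg_left (integral_kink_le W) (by positivity)

end Profile

/-! ### Radial functions -/

section Radial

variable {d : ℕ} {L : ℝ}

/-- The Euclidean norm on `Fin d → ℝ`, whose own norm is the supremum norm. -/
def radius (x : Fin d → ℝ) : ℝ := ‖(WithLp.toLp 2 x : EuclideanSpace ℝ (Fin d))‖

theorem continuous_radius : Continuous (radius : (Fin d → ℝ) → ℝ) :=
  continuous_norm.comp (PiLp.continuous_toLp 2 _)

theorem radius_nonneg (x : Fin d → ℝ) : 0 ≤ radius x := norm_nonneg _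

theorem abs_le_radius (x : Fin d → ℝ) (i : Fin d) : |x i| ≤ radius x := by
  have h := PiLp.norm_apply_le (WithLp.toLp 2 x : EuclideanSpace ℝ (Fin d)) i
  exact h

theorem lt_radius_of_notMem_cell {x : Fin d → ℝ} (hx : x ∉ cell d L) : L / 2 < radius x := by
  by_contra! h
  refine hx ⟨fun i => ?_, fun i => ?_⟩
  · linarith [(abs_le.1 (abs_le_radius x i)).1]
  · linarith [(abs_le.1 (abs_le_radius x i)).2]

theorem radius_add_smul_single (x : Fin d → ℝ) (i : Fin d) (t : ℝ) :
    radius (x + t • Pi.single i 1) = √(radius x ^ 2 + 2 * t * x i + t ^ 2) := by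
  have e : (WithLp.toLp 2 (x + t • Pi.single i 1) : EuclideanSpace ℝ (Fin d)) =
      WithLp.toLp 2 x + t • EuclideanSpace.single i 1 := by
    rw [WithLp.toLp_add, WithLp.toLp_smul]
    rfl
  have h : radius (x + t • Pi.single i 1) ^ 2 = radius x ^ 2 + 2 * t * x i + t ^ 2 := by
    rw [radius, e, norm_add_sq_real, inner_smul_right, norm_smul, PiLp.norm_single,
      EuclideanSpace.inner_single_right, mul_pow, Real.norm_eq_abs, sq_abs, radius]
    simp
    ring
  rw [← h, Real.sqrt_sq (radius_nonneg _)]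

theorem hasDerivAt_radius {x : Fin d → ℝ} (hx : radius x ≠ 0) (i : Fin d) :
    HasDerivAt (fun t : ℝ => radius (x + t • Pi.single i 1)) (x i / radius x) 0 := by
  simp_rw [radius_add_smul_single]
  have h1 : HasDerivAt (fun t : ℝ => radius x ^ 2 + 2 * t * x i + t ^ 2) (2 * x i) 0 := by
    have h2 := (((hasDerivAt_id (0 : ℝ)).const_mul 2).mul_const (x i)).const_add (radius x ^ 2)
    simpa using h2.fun_add (hasDerivAt_pow 2 (0 : ℝ))
  have h3 := h1.sqrt (by simpa using hx)
  refine h3.congr_deriv ?_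
  simp [Real.sqrt_sq (radius_nonneg x)]
  field_simp

theorem setIntegral_cell_eq_integral {f : (Fin d → ℝ) → ℝ} (hf : ∀ x, L / 2 < radius x → f x = 0) :
    ∫ x, f x ∂(cellMeasure d L) = ∫ x, f x :=
  setIntegral_eq_integral_of_forall_compl_eq_zero fun x hx =>
    hf x (lt_radius_of_notMem_cell hx)

/-- Integration in polar coordinates of a radial function supported in the cell. -/
theorem integral_radial (hd : 0 < d) {F : ℝ → ℝ} (hF : ∀ s, L / 2 < s → F s = 0) :
    ∫ x, F (radius x) ∂(cellMeasure d L) =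
      sphereArea d * ∫ s in Ioi (0 : ℝ), s ^ (d - 1) * F s := by
  have : Nonempty (Fin d) := ⟨⟨0, hd⟩⟩
  rw [setIntegral_cell_eq_integral fun x hx => hF _ hx]
  have h1 := (PiLp.volume_preserving_toLp (Fin d)).integral_comp
    (MeasurableEquiv.toLp 2 (Fin d → ℝ)).measurableEmbedding
    (fun y : EuclideanSpace ℝ (Fin d) => F ‖y‖)
  have h2 := integral_fun_norm_addHaar (volume : Measure (EuclideanSpace ℝ (Fin d))) F
  rw [finrank_euclideanSpace_fin] at h2
  refine h1.trans (h2.trans ?_)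
  rw [sphereArea, Measure.toSphere_real_apply_univ, finrank_euclideanSpace_fin, nsmul_eq_mul,
    smul_eq_mul, mul_assoc]
  rfl

theorem sphereArea_pos (hd : 0 < d) : 0 < sphereArea d := by
  have : Nonempty (Fin d) := ⟨⟨0, hd⟩⟩
  rw [sphereArea, Measure.toSphere_real_apply_univ, finrank_euclideanSpace_fin]
  have : 0 < (volume : Measure (EuclideanSpace ℝ (Fin d))).real (Metric.ball 0 1) :=
    ENNReal.toReal_pos (Metric.measure_ball_pos _ _ one_pos).ne' measure_ball_lt_top.ne
  positivity

variable {q q' : ℝ → ℝ} {R W : ℝ}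

/-- The gradient of the radial function `x ↦ q (|x| - R)`. -/
def radialGradient (q' : ℝ → ℝ) (R : ℝ) (x : Fin d → ℝ) : EuclideanSpace ℝ (Fin d) :=
  (q' (radius x - R) / radius x) • WithLp.toLp 2 x

theorem continuous_radialGradient (hq' : Continuous q') (hWR : W < R)
    (h3 : ∀ t, W ≤ |t| → q' t = 0) :
    Continuous (radialGradient q' R : (Fin d → ℝ) → EuclideanSpace ℝ (Fin d)) := by
  have hκ : Continuous fun s : ℝ => q' (s - R) / s := by
    rw [continuous_iff_continuousAt]
    intro s
    rcases eq_or_ne s 0 with rfl | hs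
    · have h : (fun s : ℝ => q' (s - R) / s) =ᶠ[𝓝 0] fun _ => 0 := by
        filter_upwards [Iio_mem_nhds (show 0 < R - W by linarith)] with s hs
        have hs' : s < R - W := hs
        rw [h3 (s - R) (le_abs.2 (Or.inr (by linarith))), zero_div]
      exact continuousAt_const.congr h.symm
    · exact (hq'.comp (continuous_id.sub continuous_const)).continuousAt.div continuousAt_id hs
  exact (hκ.comp continuous_radius).smul (PiLp.continuous_toLp 2 _)

theorem norm_radialGradient_sq (hWR : W < R) (h3 : ∀ t, W ≤ |t| → q' t = 0) (x : Fin d → ℝ) :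
    ‖radialGradient q' R x‖ ^ 2 = q' (radius x - R) ^ 2 := by
  rw [radialGradient, norm_smul, mul_pow, Real.norm_eq_abs, sq_abs]
  change (q' (radius x - R) / radius x) ^ 2 * radius x ^ 2 = _
  rcases eq_or_ne (radius x) 0 with h | h
  · rw [h, h3 (0 - R) (le_abs.2 (Or.inr (by linarith)))]
    simp
  · field_simp

/-- At the origin, where the radius is not differentiable, the radial function is locally
constant. -/
theorem hasLineDerivAt_radial (hq : ∀ t, HasDerivAt q (q' t) t) (h1 : ∀ t ≤ -W, q t = 1)
    (hWR : W < R) (x : Fin d → ℝ) (i : Fin d) :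
    HasLineDerivAt ℝ (fun x => q (radius x - R) + 1) (radialGradient q' R x i) x
      (Pi.single i 1) := by
  unfold HasLineDerivAt
  rcases eq_or_ne (radius x) 0 with h | h
  · have e : radialGradient q' R x i = 0 := by
      change q' (radius x - R) / radius x * x i = 0
      rw [h, div_zero, zero_mul]
    rw [e]
    have hc : Continuous fun t : ℝ => radius (x + t • (Pi.single i 1 : Fin d → ℝ)) :=
      continuous_radius.comp (by fun_prop)
    have hlt := (hc.tendsto 0).eventually_lt_const (u := R - W) (by simp [h, hWR])
    refine (hasDerivAt_const (0 : ℝ) (2 : ℝ)).congr_of_eventuallyEq ?_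
    filter_upwards [hlt] with t ht
    rw [h1 _ (by linarith)]
    norm_num
  · have h0 : radius (x + (0 : ℝ) • (Pi.single i 1 : Fin d → ℝ)) = radius x := by simp
    have hr := (hasDerivAt_radius h i).sub_const R
    have hq0 := hq (radius (x + (0 : ℝ) • (Pi.single i 1 : Fin d → ℝ)) - R)
    have := (hq0.comp (0 : ℝ) hr).add_const 1
    rw [h0] at this
    refine this.congr_deriv ?_
    change _ = q' (radius x - R) / radius x * x i
    ring

/-- A radial function that is constant near the boundary of the cell has a weak gradient. -/
theorem hasWeakGradient_radial (hq : ∀ t, HasDerivAt q (q' t) t) (hq' : Continuous q')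
    (h1 : ∀ t ≤ -W, q t = 1) (h2 : ∀ t ≥ W, q t = -1) (h3 : ∀ t, W ≤ |t| → q' t = 0)
    (hWR : W < R) (hRL : R + W ≤ L / 2) :
    HasWeakGradient L (fun x : Fin d → ℝ => q (radius x - R) + 1) (radialGradient q' R) := by
  intro ψ hψ i
  set f : (Fin d → ℝ) → ℝ := fun x => q (radius x - R) + 1
  have hqc : Continuous q := continuous_iff_continuousAt.2 fun t => (hq t).continuousAt
  have hfc : Continuous f := by
    have := continuous_radius (d := d)
    fun_prop
  have hgc : Continuous fun x : Fin d → ℝ => radialGradient q' R x i :=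
    (EuclideanSpace.proj (𝕜 := ℝ) i).continuous.comp (continuous_radialGradient hq' hWR h3)
  have hf0 : ∀ x : Fin d → ℝ, L / 2 < radius x → f x = 0 := fun x hx => by
    simp only [f]
    rw [h2 _ (by linarith)]
    norm_num
  have hg0 : ∀ x : Fin d → ℝ, L / 2 < radius x → radialGradient q' R x i = 0 := fun x hx => by
    change q' (radius x - R) / radius x * x i = 0
    rw [h3 _ (le_abs.2 (Or.inl (by linarith))), zero_div, zero_mul]
  have hint : ∀ h : (Fin d → ℝ) → ℝ, Continuous h → (∀ x, L / 2 < radius x → h x = 0) →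
      Integrable h := fun h hc h0 =>
    hc.integrable_of_hasCompactSupport (HasCompactSupport.intro
      (isCompact_Icc : IsCompact (cell d L)) fun x hx => h0 x (lt_radius_of_notMem_cell hx))
  have hψc := hψ.contDiff.continuous
  have hψ'c := hψ.continuous_partial i
  rw [setIntegral_cell_eq_integral fun x hx => by rw [hf0 x hx, zero_mul],
    setIntegral_cell_eq_integral fun x hx => by rw [hg0 x hx, zero_mul]]
  have key := integral_bilinear_hasLineDerivAt_right_eq_neg_left_of_integrable
    (μ := (volume : Measure (Fin d → ℝ))) (B := ContinuousLinearMap.mul ℝ ℝ) (f := f)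
    (f' := fun x => radialGradient q' R x i) (g := ψ)
    (g' := fun x => fderiv ℝ ψ x (Pi.single i 1)) (v := Pi.single i 1)
    (hint _ (hgc.mul hψc) fun x hx => by
      simp only [ContinuousLinearMap.mul_apply', hg0 x hx, zero_mul])
    (hint _ (hfc.mul hψ'c) fun x hx => by
      simp only [ContinuousLinearMap.mul_apply', hf0 x hx, zero_mul])
    (hint _ (hfc.mul hψc) fun x hx => by
      simp only [ContinuousLinearMap.mul_apply', hf0 x hx, zero_mul])
    (fun x _ => hasLineDerivAt_radial hq h1 hWR x i)
    (fun x _ => (hψ.contDiff.differentiable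
      (by simp)).differentiableAt.hasFDerivAt.hasLineDerivAt _)
  simpa only [ContinuousLinearMap.mul_apply'] using key

/-- The cost of a radial transition layer is at most the area of its outer boundary times the
one-dimensional cost. -/
theorem integral_radial_layer_le (hd : 0 < d) {h : ℝ → ℝ} (hc : Continuous h) (h0 : ∀ t, 0 ≤ h t)
    (hsupp : ∀ t, W ≤ |t| → h t = 0) (hW : 0 < W) (hWR : W < R) (hRL : R + W ≤ L / 2) :
    ∫ x, h (radius x - R) ∂(cellMeasure d L) ≤
      sphereArea d * ((R + W) ^ (d - 1) * ∫ t in (-W)..W, h t) := by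
  rw [integral_radial hd (F := fun s => h (s - R))
    fun s hs => hsupp _ (le_abs.2 (Or.inl (by linarith)))]
  refine mul_le_mul_of_nonneg_left ?_ (sphereArea_pos hd).le
  have e1 : ∫ s in Ioi (0 : ℝ), s ^ (d - 1) * h (s - R) =
      ∫ s in Ioc (R - W) (R + W), s ^ (d - 1) * h (s - R) := by
    refine setIntegral_eq_of_subset_of_forall_sdiff_eq_zero measurableSet_Ioi
      (fun s hs => lt_trans (by linarith) hs.1) fun s hs => ?_
    rw [hsupp, mul_zero]
    by_contra! hlt
    obtain ⟨ha, hb⟩ := abs_lt.1 hlt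
    exact hs.2 ⟨by linarith, by linarith⟩
  have e2 : ∫ t in (-W)..W, h t = ∫ s in (R - W)..(R + W), h (s - R) := by
    rw [intervalIntegral.integral_comp_sub_right]
    congr 1 <;> ring
  rw [e1, ← intervalIntegral.integral_of_le (by linarith), e2,
    ← intervalIntegral.integral_const_mul]
  refine intervalIntegral.integral_mono_on (by linarith)
    (Continuous.intervalIntegrable (by fun_prop) _ _)
    (Continuous.intervalIntegrable (by fun_prop) _ _) fun s hs => ?_
  have hs0 : 0 ≤ s := by linarith [hs.1]
  exact mul_le_mul_of_nonneg_right (pow_le_pow_left₀ hs0 hs.2 _) (h0 _)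

theorem setIntegral_Ioi_pow_indicator (hd : 0 < d) {ρ : ℝ} (hρ : 0 ≤ ρ) :
    ∫ s in Ioi (0 : ℝ), s ^ (d - 1) * (Iic ρ).indicator (fun _ => (2 : ℝ)) s = 2 * ρ ^ d / d := by
  have e1 : ∫ s in Ioi (0 : ℝ), s ^ (d - 1) * (Iic ρ).indicator (fun _ => (2 : ℝ)) s =
      ∫ s in Ioc 0 ρ, s ^ (d - 1) * 2 := by
    rw [← integral_indicator measurableSet_Ioi, ← integral_indicator measurableSet_Ioc]
    congr 1
    funext s
    by_cases h1 : 0 < s <;> by_cases h2 : s ≤ ρ <;> simp [indicator, h1, h2]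
  rw [e1, ← intervalIntegral.integral_of_le hρ, intervalIntegral.integral_mul_const, integral_pow,
    Nat.sub_add_cancel hd]
  have h : ((d - 1 : ℕ) : ℝ) + 1 = d := by
    rw [← Nat.cast_add_one, Nat.sub_add_cancel hd]
  rw [h, zero_pow hd.ne']
  ring

/-- The excess mass of a droplet lies between those of the inner and the outer ball. -/
theorem integral_droplet_mass (hd : 0 < d) (hqc : Continuous q) (hq1 : ∀ t, |q t| ≤ 1)
    (h1 : ∀ t ≤ -W, q t = 1) (h2 : ∀ t ≥ W, q t = -1) (hW : 0 < W) (hWR : W < R)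
    (hRL : R + W ≤ L / 2) :
    2 * (sphereArea d / d) * (R - W) ^ d ≤
      ∫ x : Fin d → ℝ, (q (radius x - R) + 1) ∂(cellMeasure d L) ∧
    ∫ x : Fin d → ℝ, (q (radius x - R) + 1) ∂(cellMeasure d L) ≤
      2 * (sphereArea d / d) * (R + W) ^ d := by
  rw [integral_radial hd (F := fun s => q (s - R) + 1)
    fun s hs => by rw [h2 _ (by linarith)]; norm_num]
  have hind : ∀ ρ : ℝ, Integrable (fun s : ℝ => s ^ (d - 1) *
      (Iic ρ).indicator (fun _ => (2 : ℝ)) s) (volume.restrict (Ioi 0)) := by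
    intro ρ
    have h : IntegrableOn (fun s : ℝ => s ^ (d - 1) * 2) (Ioc (0 : ℝ) ρ) volume :=
      (Continuous.integrableOn_Icc (by fun_prop)).mono_set Ioc_subset_Icc_self
    rw [← integrable_indicator_iff measurableSet_Ioc] at h
    change IntegrableOn _ (Ioi (0 : ℝ)) volume
    rw [← integrable_indicator_iff measurableSet_Ioi]
    refine h.congr (Eventually.of_forall fun s => ?_)
    by_cases h1 : 0 < s <;> by_cases h2 : s ≤ ρ <;> simp [indicator, h1, h2]
  have hmid : Integrable (fun s : ℝ => s ^ (d - 1) * (q (s - R) + 1))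
      (volume.restrict (Ioi 0)) := by
    have h : IntegrableOn (fun s : ℝ => s ^ (d - 1) * (q (s - R) + 1)) (Ioc (0 : ℝ) (R + W))
        volume :=
      (Continuous.integrableOn_Icc (by fun_prop)).mono_set Ioc_subset_Icc_self
    rw [← integrable_indicator_iff measurableSet_Ioc] at h
    change IntegrableOn _ (Ioi (0 : ℝ)) volume
    rw [← integrable_indicator_iff measurableSet_Ioi]
    refine h.congr (Eventually.of_forall fun s => ?_)
    by_cases hs1 : 0 < s <;> by_cases hs2 : s ≤ R + W <;> simp [indicator, hs1, hs2]
    rw [h2 (s - R) (by linarith)]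
    norm_num
  have hb : ∀ s, -1 ≤ q s ∧ q s ≤ 1 := fun s => abs_le.1 (hq1 s)
  have key1 : ∫ s in Ioi (0 : ℝ), s ^ (d - 1) * (Iic (R - W)).indicator (fun _ => (2 : ℝ)) s ≤
      ∫ s in Ioi (0 : ℝ), s ^ (d - 1) * (q (s - R) + 1) := by
    refine setIntegral_mono_on (hind _) hmid measurableSet_Ioi fun s hs => ?_
    have hs0 : 0 < s := hs
    refine mul_le_mul_of_nonneg_left ?_ (by positivity)
    by_cases h : s ∈ Iic (R - W)
    · rw [indicator_of_mem h, h1 _ (by linarith [mem_Iic.1 h])]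
      norm_num
    · rw [indicator_of_notMem h]
      linarith [(hb (s - R)).1]
  have key2 : ∫ s in Ioi (0 : ℝ), s ^ (d - 1) * (q (s - R) + 1) ≤
      ∫ s in Ioi (0 : ℝ), s ^ (d - 1) * (Iic (R + W)).indicator (fun _ => (2 : ℝ)) s := by
    refine setIntegral_mono_on hmid (hind _) measurableSet_Ioi fun s hs => ?_
    have hs0 : 0 < s := hs
    refine mul_le_mul_of_nonneg_left ?_ (by positivity)
    by_cases h : s ∈ Iic (R + W)
    · rw [indicator_of_mem h]
      linarith [(hb (s - R)).2]
    · rw [indicator_of_notMem h, h2 _ (by linarith [not_le.1 (show ¬ s ≤ R + W from h)])]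
      norm_num
  rw [setIntegral_Ioi_pow_indicator hd (by linarith)] at key1 key2
  have hσ := sphereArea_pos hd
  constructor
  · refine le_trans (le_of_eq ?_) (mul_le_mul_of_nonneg_left key1 hσ.le)
    ring
  · refine (mul_le_mul_of_nonneg_left key2 hσ.le).trans (le_of_eq ?_)
    ring

end Radial

/-! ### The droplet competitor -/

section Droplet

variable {d : ℕ} {L : ℝ}

theorem continuous_doubleWell : Continuous doubleWell := by
  unfold doubleWell
  fun_prop

theorem doubleWell_nonneg (s : ℝ) : 0 ≤ doubleWell s := by
  unfold doubleWell
  positivity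

/-- Raising the profile by `m` costs the energy of the raised background, the energy of the
profile, and corrections supported on the layer (`1 - s²`) and in the droplet (`s + 1`). -/
theorem doubleWell_add_le {s m : ℝ} (hs : |s| ≤ 1) (hm : 0 ≤ m) :
    doubleWell (s + m) ≤
      doubleWell (-1 + m) + (doubleWell s + m * (1 - s ^ 2)) + m ^ 3 * (s + 1) := by
  obtain ⟨h1, h2⟩ := abs_le.1 hs
  have hs2 : 0 ≤ 1 - s ^ 2 := by nlinarith
  have key : doubleWell (-1 + m) + (doubleWell s + m * (1 - s ^ 2)) + m ^ 3 * (s + 1) -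
      doubleWell (s + m) = m * ((1 - s ^ 2) * (1 + s)) + 3 / 2 * m ^ 2 * (1 - s ^ 2) := by
    unfold doubleWell
    ring
  have h3 : 0 ≤ m * ((1 - s ^ 2) * (1 + s)) :=
    mul_nonneg hm (mul_nonneg hs2 (by linarith))
  have h4 : 0 ≤ 3 / 2 * m ^ 2 * (1 - s ^ 2) := by positivity
  linarith

/-- What the background gains when its mean is lowered from `-1 + φ` to `-1 + m`. -/
theorem doubleWell_background_le {m φ : ℝ} (hm : 0 ≤ m) (hmφ : m ≤ φ) (hφ : φ ≤ 1 / 2) :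
    doubleWell (-1 + m) - doubleWell (-1 + φ) ≤ -(1 - 2 * φ) * (φ ^ 2 - m ^ 2) := by
  have key : doubleWell (-1 + φ) - doubleWell (-1 + m) =
      (φ - m) * ((1 - (φ + m) / 2) * ((φ + m) - (φ ^ 2 + m ^ 2) / 2)) := by
    unfold doubleWell
    ring
  have h1 : (1 - φ) * ((φ + m) * (1 - φ / 2)) ≤
      (1 - (φ + m) / 2) * ((φ + m) - (φ ^ 2 + m ^ 2) / 2) := by
    apply mul_le_mul
    · linarith
    · nlinarith
    · exact mul_nonneg (by linarith) (by linarith)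
    · linarith
  have h2 : (1 - 2 * φ) * (φ + m) ≤ (1 - φ) * ((φ + m) * (1 - φ / 2)) := by
    have : 0 ≤ (φ + m) * (φ / 2 + φ ^ 2 / 2) := by
      have : 0 ≤ φ := hm.trans hmφ
      positivity
    linarith
  have h3 := mul_le_mul_of_nonneg_left (h2.trans h1) (sub_nonneg.2 hmφ)
  linarith

theorem energy_uniformState (hL : 0 < L) (φ : ℝ) :
    energy (uniformState d L φ) = L ^ d * doubleWell (-1 + φ) := by
  have h : energy (uniformState d L φ) =
      ∫ _ : Fin d → ℝ, doubleWell (-1 + φ) ∂(cellMeasure d L) := by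
    refine integral_congr_ae ?_
    filter_upwards [fn_constState (d := d) (L := L) (-1 + φ),
      grad_constState (d := d) (L := L) (-1 + φ)] with x h1 h2
    simp only [uniformState]
    rw [h1, h2]
    simp
  rw [h, integral_const, measureReal_cell hL, smul_eq_mul]

theorem integrable_of_continuous {f : (Fin d → ℝ) → ℝ} (hf : Continuous f) :
    Integrable f (cellMeasure d L) :=
  memLp_one_iff_integrable.1 (memLp_of_continuous hf 1)

/-- A droplet of radius `R` on the background `-1 + m`, with `m` chosen to meet the mean: its
excess mass `V` is that of a ball of radius about `R`, and its energy is compared with that of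
the uniform state. -/
theorem exists_droplet {q q' : ℝ → ℝ} {R W C φ : ℝ} (hd : 0 < d) (hL : 0 < L)
    (hq : ∀ t, HasDerivAt q (q' t) t) (hq' : Continuous q') (hq1 : ∀ t, |q t| ≤ 1)
    (h1 : ∀ t ≤ -W, q t = 1) (h2 : ∀ t ≥ W, q t = -1) (h3 : ∀ t, W ≤ |t| → q' t = 0)
    (hC : ∫ t in (-W)..W, (1 / 2 * q' t ^ 2 + doubleWell (q t)) ≤ C)
    (hW : 0 < W) (hWR : W < R) (hRL : R + W ≤ L / 2) (hφ : φ ≤ 1 / 2) :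
    ∃ V, 2 * (sphereArea d / d) * (R - W) ^ d ≤ V ∧ V ≤ 2 * (sphereArea d / d) * (R + W) ^ d ∧
      (V ≤ φ * L ^ d → ∃ u ∈ XSpace d L φ, energy u - energy (uniformState d L φ) ≤
        sphereArea d * (R + W) ^ (d - 1) * (C + 2 * W * φ) + φ ^ 3 * V -
          (1 - 2 * φ) * (2 * φ * V - V ^ 2 / L ^ d)) := by
  have hqc : Continuous q := continuous_iff_continuousAt.2 fun t => (hq t).continuousAt
  have hrc := continuous_radius (d := d)
  have hdw := continuous_doubleWell
  have hLd : 0 < L ^ d := by positivity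
  have hσ := sphereArea_pos hd
  obtain ⟨hV1, hV2⟩ := integral_droplet_mass hd hqc hq1 h1 h2 hW hWR hRL
  set V := ∫ x : Fin d → ℝ, (q (radius x - R) + 1) ∂(cellMeasure d L) with hVdef
  have hV0 : 0 ≤ V := le_trans (by have : 0 < R - W := by linarith
                                   positivity) hV1
  refine ⟨V, hV1, hV2, fun hVφ => ?_⟩
  set m := φ - V / L ^ d with hm
  have hm0 : 0 ≤ m := by
    rw [hm, sub_nonneg, div_le_iff₀ hLd]
    exact hVφ
  have hmφ : m ≤ φ := by
    have : 0 ≤ V / L ^ d := by positivity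
    linarith
  have hfc : Continuous fun x : Fin d → ℝ => q (radius x - R) + 1 := by fun_prop
  have hf := memLp_of_continuous (L := L) hfc 4
  have hg := memLp_of_continuous (L := L)
    (continuous_radialGradient (d := d) (q' := q') (R := R) hq' hWR h3) 2
  have hfg := hasWeakGradient_radial (d := d) (L := L) hq hq' h1 h2 h3 hWR hRL
  set w := ofWeakGradient hf hg hfg
  have hwf := fn_ofWeakGradient hf hg hfg
  have hwg := grad_ofWeakGradient hf hg hfg
  refine ⟨constState d L (-1 + m) + (1 : ℝ) • w, ?_, ?_⟩
  · rw [mem_XSpace_iff hL, integral_fn_add_smul, integral_congr_ae (fn_constState (-1 + m)),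
      integral_congr_ae hwf, integral_const, measureReal_cell hL, smul_eq_mul, ← hVdef, hm]
    field_simp
    ring
  set h : ℝ → ℝ := fun t => 1 / 2 * q' t ^ 2 + doubleWell (q t) + m * (1 - q t ^ 2) with hh
  have hhc : Continuous h := by fun_prop
  have hq2 : ∀ t, 0 ≤ 1 - q t ^ 2 := fun t => by
    have := sq_le_one_iff_abs_le_one (q t) |>.2 (hq1 t)
    linarith
  have hh0 : ∀ t, 0 ≤ h t := fun t => by
    have := doubleWell_nonneg (q t)
    have := mul_nonneg hm0 (hq2 t)
    positivity
  have hhs : ∀ t, W ≤ |t| → h t = 0 := by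
    intro t ht
    have hqt : q t ^ 2 = 1 := by
      rcases le_abs.1 ht with h | h
      · rw [h2 t h]
        norm_num
      · rw [h1 t (by linarith)]
        norm_num
    simp only [hh, doubleWell, h3 t ht, hqt]
    norm_num
  have hlayer := integral_radial_layer_le hd hhc hh0 hhs hW hWR hRL
  have hcost : ∫ t in (-W)..W, h t ≤ C + 2 * W * φ := by
    have e : ∫ t in (-W)..W, h t = (∫ t in (-W)..W, (1 / 2 * q' t ^ 2 + doubleWell (q t))) +
        ∫ t in (-W)..W, m * (1 - q t ^ 2) :=
      intervalIntegral.integral_add (Continuous.intervalIntegrable (by fun_prop) _ _)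
        (Continuous.intervalIntegrable (by fun_prop) _ _)
    have e2 : ∫ t in (-W)..W, m * (1 - q t ^ 2) ≤ ∫ _ in (-W)..W, φ := by
      refine intervalIntegral.integral_mono_on (by linarith)
        (Continuous.intervalIntegrable (by fun_prop) _ _)
        (Continuous.intervalIntegrable (by fun_prop) _ _) fun t _ => ?_
      nlinarith [sq_nonneg (q t), hq2 t]
    rw [intervalIntegral.integral_const, smul_eq_mul] at e2
    linarith
  have hE : energy (constState d L (-1 + m) + (1 : ℝ) • w) ≤
      ∫ x : Fin d → ℝ, (doubleWell (-1 + m) + h (radius x - R) +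
        m ^ 3 * (q (radius x - R) + 1)) ∂(cellMeasure d L) := by
    have e : energy (constState d L (-1 + m) + (1 : ℝ) • w) = ∫ x : Fin d → ℝ,
        (1 / 2 * q' (radius x - R) ^ 2 + doubleWell (q (radius x - R) + m))
          ∂(cellMeasure d L) := by
      refine integral_congr_ae ?_
      filter_upwards [fn_add_smul (constState d L (-1 + m)) w 1,
        grad_add_smul (constState d L (-1 + m)) w 1, fn_constState (d := d) (L := L) (-1 + m),
        grad_constState (d := d) (L := L) (-1 + m), hwf, hwg] with x k1 k2 k3 k4 k5 k6
      rw [k1, k2, k3, k4, k5, k6, Pi.zero_apply, zero_add, one_smul, norm_radialGradient_sq hWR h3]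
      congr 2
      ring
    rw [e]
    refine integral_mono (integrable_of_continuous (by fun_prop))
      (integrable_of_continuous (by fun_prop)) fun x => ?_
    have := doubleWell_add_le (hq1 (radius x - R)) hm0
    simp only [hh]
    linarith
  have i1 : Integrable (fun _ : Fin d → ℝ => doubleWell (-1 + m)) (cellMeasure d L) :=
    integrable_const _
  have i2 : Integrable (fun x : Fin d → ℝ => h (radius x - R)) (cellMeasure d L) :=
    integrable_of_continuous (by fun_prop)
  have i3 : Integrable (fun x : Fin d → ℝ => m ^ 3 * (q (radius x - R) + 1)) (cellMeasure d L) :=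
    integrable_of_continuous (by fun_prop)
  rw [integral_add (integrable_fun_add i1 i2) i3, integral_add i1 i2, integral_const,
    measureReal_cell hL, smul_eq_mul, integral_const_mul, ← hVdef] at hE
  have hbg := mul_le_mul_of_nonneg_left (doubleWell_background_le hm0 hmφ hφ) hLd.le
  have hLm : L ^ d * (φ ^ 2 - m ^ 2) = 2 * φ * V - V ^ 2 / L ^ d := by
    rw [hm]
    field_simp
    ring
  have hm3 : m ^ 3 * V ≤ φ ^ 3 * V :=
    mul_le_mul_of_nonneg_right (pow_le_pow_left₀ hm0 hmφ 3) hV0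
  have hl2 : sphereArea d * ((R + W) ^ (d - 1) * ∫ t in (-W)..W, h t) ≤
      sphereArea d * (R + W) ^ (d - 1) * (C + 2 * W * φ) := by
    rw [← mul_assoc]
    have : 0 < R + W := by linarith
    exact mul_le_mul_of_nonneg_left hcost (by positivity)
  have hbg' : L ^ d * doubleWell (-1 + m) - L ^ d * doubleWell (-1 + φ) ≤
      -((1 - 2 * φ) * (2 * φ * V - V ^ 2 / L ^ d)) := by
    rw [← hLm]
    linarith
  rw [energy_uniformState hL]
  linarith

end Droplet

/-! ### Droplets of low energy above the critical mean -/

section LowEnergy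

variable {d : ℕ}

theorem transitionCost_pos : 0 < transitionCost := by
  rw [transitionCost_eq]
  positivity

/-- The radius, in units of `1 / φ`, of the droplet that is cheapest at the critical mean. -/
def dropletRadius (d : ℕ) : ℝ := ((d : ℝ) + 1) * transitionCost / 4

theorem dropletRadius_pos : 0 < dropletRadius d := by
  have := transitionCost_pos
  unfold dropletRadius
  positivity

theorem criticalXi_pos (hd : 0 < d) : 0 < criticalXi d := by
  have := transitionCost_pos
  have := sphereArea_pos hd
  have : (0 : ℝ) < d := by exact_mod_cast hd
  unfold criticalXi
  positivity

theorem criticalXi_pow (hd : 0 < d) :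
    criticalXi d ^ (d + 1) * transitionCost =
      4 * (sphereArea d / d) * dropletRadius d ^ (d + 1) := by
  have hc := transitionCost_pos
  have hσ := sphereArea_pos hd
  have hd0 : (0 : ℝ) < d := by exact_mod_cast hd
  have hroot : ∀ x : ℝ, 0 ≤ x → (x ^ ((d : ℝ) / (d + 1))) ^ (d + 1) = x ^ d := fun x hx => by
    rw [← Real.rpow_natCast, ← Real.rpow_mul hx, Nat.cast_add_one,
      div_mul_cancel₀ _ (by positivity), Real.rpow_natCast]
  have hroot' : ∀ x : ℝ, 0 ≤ x → (x ^ (1 / ((d : ℝ) + 1))) ^ (d + 1) = x := fun x hx => by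
    rw [← Real.rpow_natCast, ← Real.rpow_mul hx, Nat.cast_add_one,
      div_mul_cancel₀ _ (by positivity), Real.rpow_one]
  rw [criticalXi, mul_pow, mul_pow, div_pow, mul_pow, hroot _ hc.le, hroot' _ hσ.le,
    hroot _ (by norm_num), hroot' _ hd0.le, dropletRadius, div_pow, mul_pow]
  field_simp
  ring

/-- If the mean exceeds the critical one, the rescaled energy of the sharp-interface droplet of
radius `dropletRadius d / φ` is negative. -/
theorem sharp_droplet_neg (hd : 0 < d) {z : ℝ} (hz : criticalXi d ^ (d + 1) * z < 1) :
    sphereArea d * dropletRadius d ^ (d - 1) * transitionCost <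
      4 * (sphereArea d / d) * dropletRadius d ^ d -
        (2 * (sphereArea d / d) * dropletRadius d ^ d) ^ 2 * z := by
  have hc := transitionCost_pos
  have hσ := sphereArea_pos hd
  have hK := dropletRadius_pos (d := d)
  have hd0 : (0 : ℝ) < d := by exact_mod_cast hd
  have hcrit := criticalXi_pow hd
  set a := sphereArea d / d with ha
  have hσa : sphereArea d = a * d := by
    rw [ha]
    field_simp
  have ha0 : 0 < a := by positivity
  obtain ⟨n, rfl⟩ : ∃ n, d = n + 1 := ⟨d - 1, by omega⟩
  have hKdef : ((n + 1 : ℕ) : ℝ) * transitionCost = 4 * dropletRadius (n + 1) - transitionCost := by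
    unfold dropletRadius
    ring
  rw [hσa, Nat.add_sub_cancel]
  set K := dropletRadius (n + 1)
  -- after cancelling `a K^n` this is the comparison of `z` with its critical value
  have h1 : 4 * a * K ^ (n + 1 + 1) * z < transitionCost := by
    rw [← hcrit]
    calc _ = (criticalXi (n + 1) ^ (n + 1 + 1) * z) * transitionCost := by ring
      _ < 1 * transitionCost := mul_lt_mul_of_pos_right hz hc
      _ = transitionCost := one_mul _
  have h2 : 0 < a * K ^ n * (transitionCost - 4 * a * K ^ (n + 1 + 1) * z) :=
    mul_pos (by positivity) (sub_pos.2 h1)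
  have e : a * ((n + 1 : ℕ) : ℝ) * K ^ n * transitionCost =
      a * K ^ n * (4 * K - transitionCost) := by
    rw [← hKdef]
    ring
  rw [e]
  have e2 : 4 * a * K ^ (n + 1) - (2 * a * K ^ (n + 1)) ^ 2 * z -
      a * K ^ n * (4 * K - transitionCost) =
      a * K ^ n * (transitionCost - 4 * a * K ^ (n + 1 + 1) * z) := by ring
  linarith

/-- At the critical mean the droplet takes up the fraction `2 / (d + 1)` of the excess mass. -/
theorem sharp_droplet_mass_lt (hd : 0 < d) {z : ℝ} (hz : criticalXi d ^ (d + 1) * z < 1) :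
    2 * (sphereArea d / d) * dropletRadius d ^ d * z < 1 := by
  have hc := transitionCost_pos
  have hK := dropletRadius_pos (d := d)
  have hd1 : (1 : ℝ) ≤ d := by exact_mod_cast hd
  have hcrit := criticalXi_pow hd
  have h1 : 4 * (sphereArea d / d) * dropletRadius d ^ (d + 1) * z < transitionCost := by
    rw [← hcrit]
    calc _ = (criticalXi d ^ (d + 1) * z) * transitionCost := by ring
      _ < 1 * transitionCost := mul_lt_mul_of_pos_right hz hc
      _ = transitionCost := one_mul _
  have h2 : transitionCost ≤ 2 * dropletRadius d := by
    unfold dropletRadius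
    nlinarith
  have h3 : (2 * dropletRadius d) * (2 * (sphereArea d / d) * dropletRadius d ^ d * z) <
      (2 * dropletRadius d) * 1 := by
    calc _ = 4 * (sphereArea d / d) * dropletRadius d ^ (d + 1) * z := by ring
      _ < 2 * dropletRadius d := h1.trans_le h2
      _ = _ := (mul_one _).symm
  exact lt_of_mul_lt_mul_left h3 (by positivity)

/-- If the mean exceeds the critical one by a fixed factor and is small, some state has lower
energy than the uniform one. -/
theorem exists_lower_energy (hd : 0 < d) {ξ : ℝ} (hξ : criticalXi d < ξ) :
    ∃ φ₀ : ℝ, 0 < φ₀ ∧ φ₀ ≤ 1 / 10 ∧ ∀ φ L : ℝ, 0 < φ → 0 < L → φ ≤ φ₀ →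
      ξ * L ^ (-((d : ℝ) / (d + 1))) ≤ φ →
        ∃ v ∈ XSpace d L φ, energy v < energy (uniformState d L φ) := by
  have hξc := criticalXi_pos hd
  have hξ0 : 0 < ξ := hξc.trans hξ
  have hc := transitionCost_pos
  have hσ := sphereArea_pos hd
  have hK := dropletRadius_pos (d := d)
  have hd0 : (0 : ℝ) < d := by exact_mod_cast hd
  set z := (ξ ^ (d + 1))⁻¹ with hz
  have hz0 : 0 < z := by positivity
  have hz1 : criticalXi d ^ (d + 1) * z < 1 := by
    rw [hz, ← div_eq_mul_inv, div_lt_one (by positivity)]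
    exact pow_lt_pow_left₀ hξ hξc.le (by omega)
  have hneg := sharp_droplet_neg hd hz1
  have hmass := sharp_droplet_mass_lt hd hz1
  set K := dropletRadius d
  set a := sphereArea d / d
  have ha : 0 < a := by positivity
  obtain ⟨δ, hδ0, hδ1, hδ⟩ : ∃ δ : ℝ, 0 < δ ∧ δ ≤ 1 ∧
      sphereArea d * K ^ (d - 1) * ((1 + δ) ^ 2 * transitionCost) <
        4 * a * K ^ d - (2 * a * K ^ d) ^ 2 * z := by
    have hcont : Continuous fun δ : ℝ =>
        sphereArea d * K ^ (d - 1) * ((1 + δ) ^ 2 * transitionCost) := by fun_prop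
    have h1 := (hcont.tendsto 0).eventually_lt_const
      (u := 4 * a * K ^ d - (2 * a * K ^ d) ^ 2 * z) (by simpa using hneg)
    have h2 := (h1.filter_mono nhdsWithin_le_nhds).and (Ioc_mem_nhdsGT (zero_lt_one' ℝ))
    obtain ⟨δ, h3, h4⟩ := h2.exists
    exact ⟨δ, h4.1, h4.2, h3⟩
  obtain ⟨q, q', W, hW, hq, hq', hq1, h1, h2, h3, hC⟩ := exists_profile hδ0 hδ1
  set C := (1 + δ) ^ 2 * transitionCost
  -- the rescaled excess masses of the balls of radius `K / φ ± W`
  set vm : ℝ → ℝ := fun φ => 2 * a * (K - φ * W) ^ d with hvm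
  set vp : ℝ → ℝ := fun φ => 2 * a * (K + φ * W) ^ d with hvp
  have e1 : ∀ᶠ φ in 𝓝 (0 : ℝ), φ * W < K :=
    (Continuous.tendsto (by fun_prop) 0).eventually_lt_const (by simpa using hK)
  have e2 : ∀ᶠ φ in 𝓝 (0 : ℝ), vp φ * z < 1 :=
    (Continuous.tendsto (f := fun φ => vp φ * z) (by fun_prop) 0).eventually_lt_const
      (by simpa [hvp] using hmass)
  have e3 : ∀ᶠ φ in 𝓝 (0 : ℝ), z * φ * (2 * (K + φ * W)) ^ d < 1 :=
    (Continuous.tendsto (f := fun φ => z * φ * (2 * (K + φ * W)) ^ d)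
      (by fun_prop) 0).eventually_lt_const (by simp)
  have e4 : ∀ᶠ φ in 𝓝 (0 : ℝ), sphereArea d * (K + φ * W) ^ (d - 1) * (C + 2 * W * φ) +
      φ ^ 2 * vp φ - (1 - 2 * φ) * (2 * vm φ - vp φ ^ 2 * z) < 0 := by
    refine (Continuous.tendsto (f := fun φ : ℝ => sphereArea d * (K + φ * W) ^ (d - 1) *
      (C + 2 * W * φ) + φ ^ 2 * vp φ - (1 - 2 * φ) * (2 * vm φ - vp φ ^ 2 * z))
      (by fun_prop) 0).eventually_lt_const ?_
    simp only [hvp, hvm, zero_mul, mul_zero, add_zero, sub_zero, one_mul]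
    have : (0 : ℝ) ^ 2 = 0 := by norm_num
    rw [this]
    linarith
  obtain ⟨r, hr, hr'⟩ := Metric.eventually_nhds_iff.1 (e1.and (e2.and (e3.and e4)))
  refine ⟨min (r / 2) (1 / 10), by positivity, min_le_right _ _, fun φ L hφ hL hφr hφL => ?_⟩
  obtain ⟨f1, f2, f3, f4⟩ := hr' (y := φ) (by
    rw [Real.dist_eq, sub_zero, abs_of_pos hφ]
    linarith [hφr.trans (min_le_left _ _)])
  have hφ10 : φ ≤ 1 / 10 := hφr.trans (min_le_right _ _)
  have hLd : 0 < L ^ d := by positivity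
  have hscale : 1 ≤ z * φ ^ (d + 1) * L ^ d := by
    have h := pow_le_pow_left₀ (by positivity) hφL (d + 1)
    rw [mul_pow, ← Real.rpow_natCast (L ^ _), ← Real.rpow_mul hL.le, Nat.cast_add_one, neg_mul,
      div_mul_cancel₀ _ (by positivity), Real.rpow_neg hL.le, Real.rpow_natCast,
      ← div_eq_mul_inv, div_le_iff₀ hLd] at h
    rw [hz, mul_assoc, ← div_eq_inv_mul, le_div_iff₀ (by positivity), one_mul]
    exact h
  have hWR : W < K / φ := by
    rw [lt_div_iff₀ hφ]
    linarith
  have hRL : K / φ + W ≤ L / 2 := by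
    have h : (2 * (K / φ + W)) ^ d ≤ L ^ d := by
      have e : 2 * (K / φ + W) = 2 * (K + φ * W) / φ := by field_simp
      rw [e, div_pow, div_le_iff₀ (by positivity)]
      have hzφ : 0 < z * φ := by positivity
      refine le_of_mul_le_mul_left ?_ hzφ
      calc z * φ * (2 * (K + φ * W)) ^ d ≤ 1 := f3.le
        _ ≤ z * φ ^ (d + 1) * L ^ d := hscale
        _ = z * φ * (L ^ d * φ ^ d) := by ring
    have := le_of_pow_le_pow_left₀ hd.ne' hL.le h
    linarith
  obtain ⟨V, hV1, hV2, hV⟩ := exists_droplet hd hL hq hq' hq1 h1 h2 h3 hC hW hWR hRL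
    (φ := φ) (by linarith)
  have hv1 : vm φ ≤ φ ^ d * V := by
    refine le_trans (le_of_eq ?_) (mul_le_mul_of_nonneg_left hV1 (by positivity))
    have e : K - φ * W = φ * (K / φ - W) := by field_simp
    simp only [hvm]
    rw [e, mul_pow]
    ring
  have hv2 : φ ^ d * V ≤ vp φ := by
    refine (mul_le_mul_of_nonneg_left hV2 (by positivity)).trans (le_of_eq ?_)
    have e : K + φ * W = φ * (K / φ + W) := by field_simp
    simp only [hvp]
    rw [e, mul_pow]
    ring
  have hvm0 : 0 < vm φ := by
    have : 0 < K - φ * W := by linarith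
    positivity
  have hV0 : 0 < V := pos_of_mul_pos_right (hvm0.trans_le hv1) (by positivity)
  have hVφ : V ≤ φ * L ^ d := by
    have hzφ : 0 < z * φ ^ d := by positivity
    refine le_of_mul_le_mul_left ?_ hzφ
    calc z * φ ^ d * V = φ ^ d * V * z := by ring
      _ ≤ vp φ * z := mul_le_mul_of_nonneg_right hv2 hz0.le
      _ ≤ 1 := f2.le
      _ ≤ z * φ ^ (d + 1) * L ^ d := hscale
      _ = z * φ ^ d * (φ * L ^ d) := by ring
  obtain ⟨u, hu, hE⟩ := hV hVφ
  refine ⟨u, hu, ?_⟩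
  -- the energy difference, multiplied by `φ ^ (d - 1)`
  have hquad : φ ^ (d - 1) * (V ^ 2 / L ^ d) ≤ vp φ ^ 2 * z := by
    rw [mul_div_assoc', div_le_iff₀ hLd]
    have hs : (φ ^ d * V) ^ 2 ≤ vp φ ^ 2 := pow_le_pow_left₀ (by positivity) hv2 2
    have hφ1 : 0 < φ ^ (d + 1) := by positivity
    refine le_of_mul_le_mul_left ?_ hφ1
    calc φ ^ (d + 1) * (φ ^ (d - 1) * V ^ 2) = (φ ^ d * V) ^ 2 * 1 := by
          obtain ⟨n, rfl⟩ : ∃ n, d = n + 1 := ⟨d - 1, by omega⟩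
          rw [Nat.add_sub_cancel]
          ring
      _ ≤ vp φ ^ 2 * (z * φ ^ (d + 1) * L ^ d) :=
          mul_le_mul hs hscale zero_le_one (by positivity)
      _ = φ ^ (d + 1) * (vp φ ^ 2 * z * L ^ d) := by ring
  have hsurf : φ ^ (d - 1) * (K / φ + W) ^ (d - 1) = (K + φ * W) ^ (d - 1) := by
    rw [← mul_pow]
    congr 1
    field_simp
  have hpow : φ ^ (d - 1) * φ = φ ^ d := by
    rw [← pow_succ, Nat.sub_add_cancel hd]
  have hE' := mul_le_mul_of_nonneg_left hE (show 0 ≤ φ ^ (d - 1) by positivity)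
  have hR : φ ^ (d - 1) * (sphereArea d * (K / φ + W) ^ (d - 1) * (C + 2 * W * φ) + φ ^ 3 * V -
      (1 - 2 * φ) * (2 * φ * V - V ^ 2 / L ^ d)) =
      sphereArea d * (K + φ * W) ^ (d - 1) * (C + 2 * W * φ) + φ ^ 2 * (φ ^ d * V) -
        (1 - 2 * φ) * (2 * (φ ^ d * V) - φ ^ (d - 1) * (V ^ 2 / L ^ d)) := by
    rw [← hsurf, ← hpow]
    ring
  have hlow : (1 - 2 * φ) * (2 * vm φ - vp φ ^ 2 * z) ≤
      (1 - 2 * φ) * (2 * (φ ^ d * V) - φ ^ (d - 1) * (V ^ 2 / L ^ d)) :=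
    mul_le_mul_of_nonneg_left (by linarith) (by linarith)
  have hcub : φ ^ 2 * (φ ^ d * V) ≤ φ ^ 2 * vp φ :=
    mul_le_mul_of_nonneg_left hv2 (by positivity)
  rw [hR] at hE'
  have hfin : φ ^ (d - 1) * (energy u - energy (uniformState d L φ)) < 0 := by linarith
  exact sub_neg.1 (neg_of_mul_neg_right hfin (by positivity))

end LowEnergy

end

end CahnHilliard

theorem mainTheorem3 (d : ℕ) (hd : 2 ≤ d) :
    (∃ ε : ℝ, 0 < ε ∧ ∀ φ L : ℝ, 0 < φ → 0 < L →
      L ^ (-((d : ℝ) / (d + 1))) ≤ ε * φ → φ ≤ ε → CahnHilliard.HasBarrierSaddle d L φ) ∧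
    (∀ ξ : ℝ, CahnHilliard.criticalXi d < ξ → ∃ φ₀ : ℝ, 0 < φ₀ ∧ ∀ φ L : ℝ, 0 < φ → 0 < L →
      φ = ξ * L ^ (-((d : ℝ) / (d + 1))) → φ ≤ φ₀ → CahnHilliard.HasBarrierSaddle d L φ) := by
  have hd0 : 0 < d := by omega
  constructor
  -- `ε` turns `L ^ (-d / (d + 1)) ≤ ε φ` into `φ ≥ ξ L ^ (-d / (d + 1))` with `ξ = ξ_d + 1`
  · have hξ := CahnHilliard.criticalXi_pos hd0
    obtain ⟨φ₀, h0, h10, h⟩ := CahnHilliard.exists_lower_energy hd0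
      (lt_add_one (CahnHilliard.criticalXi d))
    set ξ := CahnHilliard.criticalXi d + 1
    have hξ0 : 0 < ξ := by linarith
    refine ⟨min φ₀ (1 / ξ), by positivity, fun φ L hφ hL hLφ hle => ?_⟩
    have hφ0 : φ ≤ φ₀ := hle.trans (min_le_left _ _)
    refine CahnHilliard.hasBarrierSaddle_of_exists_lower hd0 hL hφ (hφ0.trans h10)
      (h φ L hφ hL hφ0 ?_)
    calc ξ * L ^ (-((d : ℝ) / (d + 1))) ≤ ξ * (1 / ξ * φ) :=
          mul_le_mul_of_nonneg_left (hLφ.trans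
            (mul_le_mul_of_nonneg_right (min_le_right _ _) hφ.le)) hξ0.le
      _ = φ := by field_simp
  · intro ξ hξ
    obtain ⟨φ₀, h0, h10, h⟩ := CahnHilliard.exists_lower_energy hd0 hξ
    exact ⟨φ₀, h0, fun φ L hφ hL heq hle =>
      CahnHilliard.hasBarrierSaddle_of_exists_lower hd0 hL hφ (hle.trans h10)
        (h φ L hφ hL hle heq.ge)⟩
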